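/- **Theorem (Erasure).** *Language.* Consider HeapLang extended with auxiliary constructs: an untyped call-by-value language (evaluation from right to left) with recursive functions, pairs, sums, a heap ($\mathsf{AllocN}$, $\mathsf{Free}$, $!$, $:=$, $\mathsf{CmpXchg}$, $\mathsf{Xchg}$, $\mathsf{FAA}$), prophecies ($\mathsf{NewProph}$, $\mathsf{Resolve}$), $\mathsf{let}$, $\mathsf{fork}\;s\;e$ (where $s$ is an auxiliary list of signals), atomic blocks $\langle e\rangle$ and $\mathsf{abort}$ (which turns all threads into $()$). Degrees and levels are values; they carry well-founded relations $<$, and $\delta_0$ is a minimal degree. Besides the real heap and the set of prophecies, a state has an auxiliary heap, a finite map from signals $s$ to (level, Boolean set/unset), and for each thread $\theta$ an obligation multiset of pairs (signal, level) or $\mathsf{Finished}$, a multiset of call permissions (degrees), and a multiset of expect permissions (signal, degree). Addresses are the disjoint union of real and auxiliary addresses, both copies of $\mathbb Z$. $(e,\sigma)\Downarrow_\theta(v,\sigma')$ means that $e$ reaches the value $v$ by finitely many steps of thread $\theta$ without forks, atomic blocks and observations. The steps are those of HeapLang, except: - A real function $\mathsf{rec}\,f\,x\,y.\,e$ takes an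 auxiliary second argument: $(\mathsf{rec}\,f\,x\,y.\,e)\;v\;e_1$ evaluates $e_1\Downarrow_\theta v'$, consumes one call permission $\delta_0$ of $\theta$ and becomes $e$ with $f,x,y$ replaced by the function, $v$, $v'$. The branches of a real $\mathsf{match}$ are real functions, applied to the payload and $()$. - An auxiliary function $\mathsf{rec}_A\,f\,x.\,e$ takes one argument, and its call is evaluated by $\Downarrow_\theta$ in one step, for free. $\mathsf{let}_A\,x=e_1\,\mathsf{in}\,e_2$ evaluates $e_1\Downarrow_\theta v$ and becomes $e_2[v/x]$ in one step. $\langle e\rangle$ evaluates $e\Downarrow_\theta v$ and becomes $v$ in one step. - $\mathsf{AllocN}(z,v)$, $z>0$, chooses $z$ consecutive fresh real addresses, sets them to $v$ and their entries in the auxiliary heap to $0$; $\mathsf{Free}(\ell)$ removes both entries. The auxiliary allocation, load and store act on the auxiliary heap; the auxiliary allocation chooses fresh auxiliary addresses. - $\mathsf{CurrentThread}$ returns $\theta$. $\mathsf{Finish}$ requires the obligations of $\theta$ to be $\emptyset$ and makes them $\mathsf{Finished}$. $\mathsf{lower}\;\delta\;n\;\delta'\;\theta'$ replaces a call permission $\delta$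 of $\theta'$ by $n$ call permissions $\delta'<\delta$. $\mathsf{NewSignal}\;\theta'\,\lambda$ creates and returns an unset signal $s$ of level $\lambda$ and adds the obligation $(s,\lambda)$ to the unfinished thread $\theta'$. $\mathsf{SetSignal}\;\theta'\,s$ sets $s$ and removes $(s,\lambda)$, if present, from the obligations of the unfinished thread $\theta'$. $\mathsf{NewExpectPerm}\;\theta'\,s\,\delta\,\delta'$ ($s$ allocated, $\delta'<\delta$) consumes a call permission $\delta$ of $\theta'$ and gives $\theta'$ the expect permission $(s,\delta')$. $\mathsf{Expect}\;\theta'\,s\,\delta$ requires that $s$ is unset with a level below those of all obligations of the unfinished thread $\theta'$ and that $\theta'$ has the expect permission $(s,\delta)$, and gives $\theta'$ a call permission $\delta$. All of these get stuck when $\theta'$ does not exist. - $\mathsf{fork}\;\bar s\;e$ moves obligations for the signals $\bar s$ from $\theta$ to a new thread, which runs $e;\mathsf{Finish}$ and starts with copies of the call and expect permissions of $\theta$. A configuration (list of threads, state) is *safe* if in every configuration reachable from it every thread is a value, can take a step, or aborts. *Syntactic constraints.* $e'$ is real code in A-normal form: the operands of all operations are values, variables or function definitions, and operations are combined by $\mathsf{let}$,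 $\mathsf{if}$ and $\mathsf{let}_A$. Auxiliary code occurs only as the bound expression of a $\mathsf{let}_A$, as second argument of a real call, or (a value or variable) as signal list of a $\mathsf{fork}$. Variables bound by $\mathsf{let}_A$ and second parameters of real functions do not occur free in real code, except inside such auxiliary code. Values in real code contain no auxiliary functions, auxiliary addresses or signals, and the functions they contain obey the same constraints. Auxiliary code contains no allocation on, deallocation from or write to the real heap, no call of a real function (and no real $\mathsf{match}$), no prophecy operation, no fork, no $\mathsf{abort}$, no atomic block and no real function definition (real function values may occur in it). An atomic block contains no call, $\mathsf{match}$, fork, $\mathsf{Resolve}$, $\mathsf{abort}$ or atomic block in its real code, and $\mathsf{AllocN}$ and $\mathsf{NewProph}$ occur in its real code only as its last operation. *Erasure.* $|e|$ is defined by structural recursion with $|\mathsf{let}_A\,x=e_1\,\mathsf{in}\,e_2|=|e_2|$, $|\mathsf{rec}\,f\,x\,y.\,e|=\mathsf{rec}\,f\,x\,\_.\,|e|$, $|e_1\,e_2\,e_3|=|e_1|\,|e_2|\,()$, $|\mathsf{fork}\,s\,e|=\mathsf{fork}\,()\,|e|$, $|\langle e\rangle|=\langle|e|\rangle$. The erased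 language has only the real heap and the prophecies as state; calls consume nothing, allocation chooses arbitrary fresh real addresses, and $\mathsf{fork}\;()\;e$ starts a thread running $e$. *Claim.* Let $e'$ meet the syntactic constraints and let $C$ be a finite multiset of degrees. If $e';\mathsf{Finish}$ is safe when run as the single thread $1$ from the state in which everything is empty except that thread $1$ has the call permissions $C$, then $|e'|$, run from the empty heap and the empty set of prophecies, has no infinite fair execution, i.e. there is no infinite sequence of steps of thread pools in which every thread that exists and is not a value at some point takes a step at that or a later point. -/

import Mathlib

namespace HLT

/-! ## Syntax -/

/-- Addresses. The address space is the disjoint union of the addresses of real cells and the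
addresses of purely auxiliary cells, each a copy of the integers. -/
inductive Loc where
  | real (n : ℤ)
  | aux (n : ℤ)
  deriving DecidableEq

/-- Pointer arithmetic. -/
def Loc.add : Loc → ℤ → Loc
  | .real n, i => .real (n + i)
  | .aux n, i => .aux (n + i)

/-- Literals. Thread identifiers are represented by integers. -/
inductive Lit where
  | int (z : ℤ)
  | bool (b : Bool)
  | unit
  | poison
  | loc (l : Loc)
  | proph (p : ℤ)
  | sig (s : ℕ)
  deriving DecidableEq

/-- A binder is a variable name or anonymous. -/
abbrev Binder := Option String

inductive UnOp where
  | minus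
  | not

inductive BinOp where
  | plus
  | minus
  | mult
  | quot
  | rem
  | lt
  | le
  | and
  | or
  | eq
  | ptrAdd

mutual
/-- Values. Degrees and levels are values. -/
inductive Val : Type where
  | lit (l : Lit)
  /-- instrumented (real) function with self name `f`, argument `x`, auxiliary argument `y` -/
  | recI (f x y : Binder) (e : Expr)
  /-- purely auxiliary function with self name `f` and argument `x` -/
  | recA (f x : Binder) (e : Expr)
  | pair (v w : Val)
  | inl (v : Val)
  | inr (v : Val)
/-- Expressions. -/
inductive Expr : Type where
  | val (v : Val)
  | var (x : String)
  | recI (f x y : Binder) (e : Expr)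
  | recA (f x : Binder) (e : Expr)
  /-- call of a real function; the third component is the auxiliary argument -/
  | app (e₁ e₂ e₃ : Expr)
  /-- call of an auxiliary function -/
  | appA (e₁ e₂ : Expr)
  | unop (o : UnOp) (e : Expr)
  | binop (o : BinOp) (e₁ e₂ : Expr)
  | ite (e e₁ e₂ : Expr)
  | pair (e₁ e₂ : Expr)
  | fst (e : Expr)
  | snd (e : Expr)
  | inl (e : Expr)
  | inr (e : Expr)
  /-- case distinction whose branches are real functions -/
  | case (e e₁ e₂ : Expr)
  /-- case distinction whose branches are auxiliary functions -/
  | caseA (e e₁ e₂ : Expr)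
  | alloc (e₁ e₂ : Expr)
  | free (e : Expr)
  | load (e : Expr)
  | store (e₁ e₂ : Expr)
  | cmpXchg (e₁ e₂ e₃ : Expr)
  | xchg (e₁ e₂ : Expr)
  | faa (e₁ e₂ : Expr)
  | newProph
  /-- `resolve e p v`: run the operation `e` and resolve the prophecy `p` to `v` -/
  | resolve (e₁ e₂ e₃ : Expr)
  | letR (x : Binder) (e₁ e₂ : Expr)
  /-- `fork s e`: fork `e`, handing over the obligations for the list `s` of signals -/
  | fork (e₁ e₂ : Expr)
  | atomic (e : Expr)
  | abort
  /-- the auxiliary let -/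
  | letA (x : Binder) (e₁ e₂ : Expr)
  | allocA (e₁ e₂ : Expr)
  | loadA (e : Expr)
  | storeA (e₁ e₂ : Expr)
  | currentThread
  | finish
  /-- `lower d n d' t`: lower `d` to `n` times `d'` at thread `t` -/
  | lower (e₁ e₂ e₃ e₄ : Expr)
  /-- `newSignal t l` -/
  | newSignal (e₁ e₂ : Expr)
  /-- `setSignal t s` -/
  | setSignal (e₁ e₂ : Expr)
  /-- `newExpectPerm t s d d'` -/
  | newExpectPerm (e₁ e₂ e₃ e₄ : Expr)
  /-- `expect t s d` -/
  | expect (e₁ e₂ e₃ : Expr)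
end

namespace Val
abbrev unit : Val := .lit .unit
abbrev int (z : ℤ) : Val := .lit (.int z)
abbrev bool (b : Bool) : Val := .lit (.bool b)
abbrev loc (l : Loc) : Val := .lit (.loc l)
abbrev proph (p : ℤ) : Val := .lit (.proph p)
abbrev sig (s : ℕ) : Val := .lit (.sig s)

/-- Lists of signals as values: `inl ()` is the empty list, `inr (s, t)` is `s` followed by `t`. -/
def sigList : List ℕ → Val
  | [] => .inl .unit
  | s :: t => .inr (.pair (.sig s) (sigList t))
end Val

def Expr.IsVal (e : Expr) : Prop := ∃ v, e = .val v

/-- Sequential composition. -/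
def Expr.seq (e₁ e₂ : Expr) : Expr := .letR none e₁ e₂

/-- `e; Finish`. -/
def Expr.thenFinish (e : Expr) : Expr := e.seq .finish

/-- Substitution of a value for a variable. Values are closed, so substitution does not enter
them. -/
def Expr.subst (x : String) (v : Val) : Expr → Expr
  | .val w => .val w
  | .var y => if y = x then .val v else .var y
  | .recI f z y e =>
      .recI f z y (if f = some x ∨ z = some x ∨ y = some x then e else e.subst x v)
  | .recA f z e => .recA f z (if f = some x ∨ z = some x then e else e.subst x v)
  | .app e₁ e₂ e₃ => .app (e₁.subst x v) (e₂.subst x v) (e₃.subst x v)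
  | .appA e₁ e₂ => .appA (e₁.subst x v) (e₂.subst x v)
  | .unop o e => .unop o (e.subst x v)
  | .binop o e₁ e₂ => .binop o (e₁.subst x v) (e₂.subst x v)
  | .ite e e₁ e₂ => .ite (e.subst x v) (e₁.subst x v) (e₂.subst x v)
  | .pair e₁ e₂ => .pair (e₁.subst x v) (e₂.subst x v)
  | .fst e => .fst (e.subst x v)
  | .snd e => .snd (e.subst x v)
  | .inl e => .inl (e.subst x v)
  | .inr e => .inr (e.subst x v)
  | .case e e₁ e₂ => .case (e.subst x v) (e₁.subst x v) (e₂.subst x v)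
  | .caseA e e₁ e₂ => .caseA (e.subst x v) (e₁.subst x v) (e₂.subst x v)
  | .alloc e₁ e₂ => .alloc (e₁.subst x v) (e₂.subst x v)
  | .free e => .free (e.subst x v)
  | .load e => .load (e.subst x v)
  | .store e₁ e₂ => .store (e₁.subst x v) (e₂.subst x v)
  | .cmpXchg e₁ e₂ e₃ => .cmpXchg (e₁.subst x v) (e₂.subst x v) (e₃.subst x v)
  | .xchg e₁ e₂ => .xchg (e₁.subst x v) (e₂.subst x v)
  | .faa e₁ e₂ => .faa (e₁.subst x v) (e₂.subst x v)
  | .newProph => .newProph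
  | .resolve e₁ e₂ e₃ => .resolve (e₁.subst x v) (e₂.subst x v) (e₃.subst x v)
  | .letR y e₁ e₂ => .letR y (e₁.subst x v) (if y = some x then e₂ else e₂.subst x v)
  | .fork e₁ e₂ => .fork (e₁.subst x v) (e₂.subst x v)
  | .atomic e => .atomic (e.subst x v)
  | .abort => .abort
  | .letA y e₁ e₂ => .letA y (e₁.subst x v) (if y = some x then e₂ else e₂.subst x v)
  | .allocA e₁ e₂ => .allocA (e₁.subst x v) (e₂.subst x v)
  | .loadA e => .loadA (e.subst x v)
  | .storeA e₁ e₂ => .storeA (e₁.subst x v) (e₂.subst x v)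
  | .currentThread => .currentThread
  | .finish => .finish
  | .lower e₁ e₂ e₃ e₄ => .lower (e₁.subst x v) (e₂.subst x v) (e₃.subst x v) (e₄.subst x v)
  | .newSignal e₁ e₂ => .newSignal (e₁.subst x v) (e₂.subst x v)
  | .setSignal e₁ e₂ => .setSignal (e₁.subst x v) (e₂.subst x v)
  | .newExpectPerm e₁ e₂ e₃ e₄ =>
      .newExpectPerm (e₁.subst x v) (e₂.subst x v) (e₃.subst x v) (e₄.subst x v)
  | .expect e₁ e₂ e₃ => .expect (e₁.subst x v) (e₂.subst x v) (e₃.subst x v)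

/-- Substitution for a binder. -/
def Expr.substB (b : Binder) (v : Val) (e : Expr) : Expr :=
  match b with
  | none => e
  | some x => e.subst x v

/-! ## Evaluation contexts -/

/-- Evaluation context items; evaluation is from right to left. -/
inductive CtxItem : Type where
  | appArg (e₁ e₃ : Expr)
  | appFun (v₂ : Val) (e₃ : Expr)
  | appAArg (e₁ : Expr)
  | appAFun (v₂ : Val)
  | unop (o : UnOp)
  | binopR (o : BinOp) (e₁ : Expr)
  | binopL (o : BinOp) (v₂ : Val)
  | ite (e₁ e₂ : Expr)
  | pairR (e₁ : Expr)
  | pairL (v₂ : Val)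
  | fst
  | snd
  | inl
  | inr
  | case (e₁ e₂ : Expr)
  | caseA (e₁ e₂ : Expr)
  | allocR (e₁ : Expr)
  | allocL (v₂ : Val)
  | free
  | load
  | storeR (e₁ : Expr)
  | storeL (v₂ : Val)
  | cmpXchgR (e₁ e₂ : Expr)
  | cmpXchgM (e₁ : Expr) (v₃ : Val)
  | cmpXchgL (v₂ v₃ : Val)
  | xchgR (e₁ : Expr)
  | xchgL (v₂ : Val)
  | faaR (e₁ : Expr)
  | faaL (v₂ : Val)
  | resolveR (e₁ e₂ : Expr)
  | resolveM (e₁ : Expr) (v₃ : Val)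
  /-- inside the operation of a prophecy resolution only a nonempty context is allowed -/
  | resolveL (K : CtxItem) (v₂ v₃ : Val)
  | letR (x : Binder) (e₂ : Expr)
  | fork (e₂ : Expr)
  | allocAR (e₁ : Expr)
  | allocAL (v₂ : Val)
  | loadA
  | storeAR (e₁ : Expr)
  | storeAL (v₂ : Val)
  | lower₄ (e₁ e₂ e₃ : Expr)
  | lower₃ (e₁ e₂ : Expr) (v₄ : Val)
  | lower₂ (e₁ : Expr) (v₃ v₄ : Val)
  | lower₁ (v₂ v₃ v₄ : Val)
  | newSignalR (e₁ : Expr)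
  | newSignalL (v₂ : Val)
  | setSignalR (e₁ : Expr)
  | setSignalL (v₂ : Val)
  | newExpectPerm₄ (e₁ e₂ e₃ : Expr)
  | newExpectPerm₃ (e₁ e₂ : Expr) (v₄ : Val)
  | newExpectPerm₂ (e₁ : Expr) (v₃ v₄ : Val)
  | newExpectPerm₁ (v₂ v₃ v₄ : Val)
  | expect₃ (e₁ e₂ : Expr)
  | expect₂ (e₁ : Expr) (v₃ : Val)
  | expect₁ (v₂ v₃ : Val)

def CtxItem.fill : CtxItem → Expr → Expr
  | .appArg e₁ e₃, e => .app e₁ e e₃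
  | .appFun v₂ e₃, e => .app e (.val v₂) e₃
  | .appAArg e₁, e => .appA e₁ e
  | .appAFun v₂, e => .appA e (.val v₂)
  | .unop o, e => .unop o e
  | .binopR o e₁, e => .binop o e₁ e
  | .binopL o v₂, e => .binop o e (.val v₂)
  | .ite e₁ e₂, e => .ite e e₁ e₂
  | .pairR e₁, e => .pair e₁ e
  | .pairL v₂, e => .pair e (.val v₂)
  | .fst, e => .fst e
  | .snd, e => .snd e
  | .inl, e => .inl e
  | .inr, e => .inr e
  | .case e₁ e₂, e => .case e e₁ e₂
  | .caseA e₁ e₂, e => .caseA e e₁ e₂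
  | .allocR e₁, e => .alloc e₁ e
  | .allocL v₂, e => .alloc e (.val v₂)
  | .free, e => .free e
  | .load, e => .load e
  | .storeR e₁, e => .store e₁ e
  | .storeL v₂, e => .store e (.val v₂)
  | .cmpXchgR e₁ e₂, e => .cmpXchg e₁ e₂ e
  | .cmpXchgM e₁ v₃, e => .cmpXchg e₁ e (.val v₃)
  | .cmpXchgL v₂ v₃, e => .cmpXchg e (.val v₂) (.val v₃)
  | .xchgR e₁, e => .xchg e₁ e
  | .xchgL v₂, e => .xchg e (.val v₂)
  | .faaR e₁, e => .faa e₁ e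
  | .faaL v₂, e => .faa e (.val v₂)
  | .resolveR e₁ e₂, e => .resolve e₁ e₂ e
  | .resolveM e₁ v₃, e => .resolve e₁ e (.val v₃)
  | .resolveL K v₂ v₃, e => .resolve (K.fill e) (.val v₂) (.val v₃)
  | .letR x e₂, e => .letR x e e₂
  | .fork e₂, e => .fork e e₂
  | .allocAR e₁, e => .allocA e₁ e
  | .allocAL v₂, e => .allocA e (.val v₂)
  | .loadA, e => .loadA e
  | .storeAR e₁, e => .storeA e₁ e
  | .storeAL v₂, e => .storeA e (.val v₂)
  | .lower₄ e₁ e₂ e₃, e => .lower e₁ e₂ e₃ e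
  | .lower₃ e₁ e₂ v₄, e => .lower e₁ e₂ e (.val v₄)
  | .lower₂ e₁ v₃ v₄, e => .lower e₁ e (.val v₃) (.val v₄)
  | .lower₁ v₂ v₃ v₄, e => .lower e (.val v₂) (.val v₃) (.val v₄)
  | .newSignalR e₁, e => .newSignal e₁ e
  | .newSignalL v₂, e => .newSignal e (.val v₂)
  | .setSignalR e₁, e => .setSignal e₁ e
  | .setSignalL v₂, e => .setSignal e (.val v₂)
  | .newExpectPerm₄ e₁ e₂ e₃, e => .newExpectPerm e₁ e₂ e₃ e
  | .newExpectPerm₃ e₁ e₂ v₄, e => .newExpectPerm e₁ e₂ e (.val v₄)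
  | .newExpectPerm₂ e₁ v₃ v₄, e => .newExpectPerm e₁ e (.val v₃) (.val v₄)
  | .newExpectPerm₁ v₂ v₃ v₄, e => .newExpectPerm e (.val v₂) (.val v₃) (.val v₄)
  | .expect₃ e₁ e₂, e => .expect e₁ e₂ e
  | .expect₂ e₁ v₃, e => .expect e₁ e (.val v₃)
  | .expect₁ v₂ v₃, e => .expect e (.val v₂) (.val v₃)

/-- An evaluation context is a list of items, the outermost one first. -/
abbrev Ctx := List CtxItem

def Ctx.fill (K : Ctx) (e : Expr) : Expr := K.foldr CtxItem.fill e

/-! ## States -/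

/-- The real part of the state: the heap and the allocated prophecy identifiers. -/
structure RealState where
  heap : Loc → Option Val
  prophs : Set ℤ

inductive Obls where
  | finished
  | active (O : Multiset (ℕ × Val))

/-- The state of the instrumented language. Maps indexed by thread identifiers are defined at the
live and finished threads. A signal has a level and a Boolean, true when the signal is set. -/
structure State extends RealState where
  heapA : Loc → Option Val
  signals : ℕ → Option (Val × Bool)
  obls : ℕ → Option Obls
  callPerms : ℕ → Option (Multiset Val)
  expectPerms : ℕ → Option (Multiset (ℕ × Val))

/-- The empty real state. -/
def RealState.empty : RealState where
  heap := fun _ => none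
  prophs := ∅

/-- The initial state: everything is empty, except that thread `1` exists, without obligations and
expect permissions, and with the call permissions `CP`. -/
def State.init (CP : Multiset Val) : State where
  toRealState := RealState.empty
  heapA := fun _ => none
  signals := fun _ => none
  obls := fun t => if t = 1 then some (.active 0) else none
  callPerms := fun t => if t = 1 then some CP else none
  expectPerms := fun t => if t = 1 then some 0 else none

/-- `m` is undefined at `l, l + 1, …, l + z - 1`. -/
def FreeRange (m : Loc → Option Val) (l : Loc) (z : ℤ) : Prop :=
  ∀ i, 0 ≤ i → i < z → m (l.add i) = none

open Classical in
/-- `m` with the cells `l, l + 1, …, l + z - 1` set to `v`. -/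
noncomputable def fillRange (m : Loc → Option Val) (l : Loc) (z : ℤ) (v : Val) :
    Loc → Option Val :=
  fun k => if ∃ i, 0 ≤ i ∧ i < z ∧ k = l.add i then some v else m k

/-- An observation: the prophecy `p`, the result of the operation, and the value resolved to. -/
abbrev Obs := ℤ × Val × Val

/-! ## Reduction steps shared by the instrumented and the erased language -/

def LitCompareSafe : Lit → Prop
  | .int _ => True
  | .bool _ => True
  | .unit => True
  | .loc _ => True
  | .poison => False
  | .proph _ => False
  | .sig _ => False

def ValCompareSafe : Val → Prop
  | .lit l => LitCompareSafe l
  | .inl (.lit l) => LitCompareSafe l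
  | .inr (.lit l) => LitCompareSafe l
  | _ => False

def ValEq (v w : Val) : Prop := v = w ∧ (ValCompareSafe v ∨ ValCompareSafe w)

def ValNe (v w : Val) : Prop := v ≠ w ∧ (ValCompareSafe v ∨ ValCompareSafe w)

inductive UnOpEval : UnOp → Val → Val → Prop
  | minus (z : ℤ) : UnOpEval .minus (.int z) (.int (-z))
  | not (b : Bool) : UnOpEval .not (.bool b) (.bool (!b))

inductive BinOpEval : BinOp → Val → Val → Val → Prop
  | plus (a b : ℤ) : BinOpEval .plus (.int a) (.int b) (.int (a + b))
  | minus (a b : ℤ) : BinOpEval .minus (.int a) (.int b) (.int (a - b))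
  | mult (a b : ℤ) : BinOpEval .mult (.int a) (.int b) (.int (a * b))
  | quot (a b : ℤ) : b ≠ 0 → BinOpEval .quot (.int a) (.int b) (.int (a.tdiv b))
  | rem (a b : ℤ) : b ≠ 0 → BinOpEval .rem (.int a) (.int b) (.int (a.tmod b))
  | lt (a b : ℤ) : BinOpEval .lt (.int a) (.int b) (.bool (decide (a < b)))
  | le (a b : ℤ) : BinOpEval .le (.int a) (.int b) (.bool (decide (a ≤ b)))
  | and (a b : Bool) : BinOpEval .and (.bool a) (.bool b) (.bool (a && b))
  | or (a b : Bool) : BinOpEval .or (.bool a) (.bool b) (.bool (a || b))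
  | eqTrue (v w : Val) : ValEq v w → BinOpEval .eq v w (.bool true)
  | eqFalse (v w : Val) : ValNe v w → BinOpEval .eq v w (.bool false)
  | ptrAdd (l : Loc) (z : ℤ) : BinOpEval .ptrAdd (.loc l) (.int z) (.loc (l.add z))

/-- Head steps that do not depend on the state. -/
inductive PureStep : Expr → Expr → Prop
  | recI (f x y : Binder) (e : Expr) : PureStep (.recI f x y e) (.val (.recI f x y e))
  | recA (f x : Binder) (e : Expr) : PureStep (.recA f x e) (.val (.recA f x e))
  | pair (v w : Val) : PureStep (.pair (.val v) (.val w)) (.val (.pair v w))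
  | inl (v : Val) : PureStep (.inl (.val v)) (.val (.inl v))
  | inr (v : Val) : PureStep (.inr (.val v)) (.val (.inr v))
  | unop (o : UnOp) (v w : Val) : UnOpEval o v w → PureStep (.unop o (.val v)) (.val w)
  | binop (o : BinOp) (v₁ v₂ w : Val) :
      BinOpEval o v₁ v₂ w → PureStep (.binop o (.val v₁) (.val v₂)) (.val w)
  | iteTrue (e₁ e₂ : Expr) : PureStep (.ite (.val (.bool true)) e₁ e₂) e₁
  | iteFalse (e₁ e₂ : Expr) : PureStep (.ite (.val (.bool false)) e₁ e₂) e₂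
  | fst (v w : Val) : PureStep (.fst (.val (.pair v w))) (.val v)
  | snd (v w : Val) : PureStep (.snd (.val (.pair v w))) (.val w)
  | caseInl (v : Val) (e₁ e₂ : Expr) :
      PureStep (.case (.val (.inl v)) e₁ e₂) (.app e₁ (.val v) (.val .unit))
  | caseInr (v : Val) (e₁ e₂ : Expr) :
      PureStep (.case (.val (.inr v)) e₁ e₂) (.app e₂ (.val v) (.val .unit))
  | caseAInl (v : Val) (e₁ e₂ : Expr) :
      PureStep (.caseA (.val (.inl v)) e₁ e₂) (.appA e₁ (.val v))
  | caseAInr (v : Val) (e₁ e₂ : Expr) :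
      PureStep (.caseA (.val (.inr v)) e₁ e₂) (.appA e₂ (.val v))
  | letR (x : Binder) (v : Val) (e : Expr) : PureStep (.letR x (.val v) e) (e.substB x v)

/-- Head steps on the real state, except allocation and deallocation. -/
inductive HeapStep : Expr → RealState → Expr → RealState → Prop
  | load (l : Loc) (v : Val) (r : RealState) :
      r.heap l = some v → HeapStep (.load (.val (.loc l))) r (.val v) r
  | store (l : Loc) (v w : Val) (r : RealState) :
      r.heap l = some v →
      HeapStep (.store (.val (.loc l)) (.val w)) r (.val .unit)
        { r with heap := Function.update r.heap l (some w) }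
  | cmpXchgTrue (l : Loc) (v w₁ w₂ : Val) (r : RealState) :
      r.heap l = some v → ValEq v w₁ →
      HeapStep (.cmpXchg (.val (.loc l)) (.val w₁) (.val w₂)) r (.val (.pair v (.bool true)))
        { r with heap := Function.update r.heap l (some w₂) }
  | cmpXchgFalse (l : Loc) (v w₁ w₂ : Val) (r : RealState) :
      r.heap l = some v → ValNe v w₁ →
      HeapStep (.cmpXchg (.val (.loc l)) (.val w₁) (.val w₂)) r (.val (.pair v (.bool false))) r
  | xchg (l : Loc) (v w : Val) (r : RealState) :
      r.heap l = some v →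
      HeapStep (.xchg (.val (.loc l)) (.val w)) r (.val v)
        { r with heap := Function.update r.heap l (some w) }
  | faa (l : Loc) (z₁ z₂ : ℤ) (r : RealState) :
      r.heap l = some (.int z₁) →
      HeapStep (.faa (.val (.loc l)) (.val (.int z₂))) r (.val (.int z₁))
        { r with heap := Function.update r.heap l (some (.int (z₁ + z₂))) }
  | newProph (p : ℤ) (r : RealState) :
      p ∉ r.prophs →
      HeapStep .newProph r (.val (.proph p)) { r with prophs := insert p r.prophs }

/-- `full` is the ordinary step relation; `nested` is its copy without forks and atomic blocks,
which is the one that big-step evaluation iterates. -/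
inductive Mode where
  | full
  | nested

/-! ## The instrumented language -/

/-- The parameters of the semantics: the orders on degrees and on levels, and the degree of the
call permission that a call of a real function consumes. -/
structure Params where
  degLt : Val → Val → Prop
  levLt : Val → Val → Prop
  deg₀ : Val

mutual
/-- `HeadStep P t m e σ κ e' σ' es`: the head step relation of thread `t`, with observations `κ`
and list of forked threads `es`. -/
inductive HeadStep (P : Params) (t : ℕ) :
    Mode → Expr → State → List Obs → Expr → State → List (ℕ × Expr) → Prop
  | pure {m : Mode} {e e' : Expr} {σ : State} :
      PureStep e e' → HeadStep P t m e σ [] e' σ []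
  | heap {m : Mode} {e e' : Expr} {σ : State} {r : RealState} :
      HeapStep e σ.toRealState e' r →
      HeadStep P t m e σ [] e' { σ with toRealState := r } []
  | alloc {m : Mode} {z n : ℤ} {v : Val} {σ : State} :
      0 < z → FreeRange σ.heap (.real n) z → FreeRange σ.heapA (.real n) z →
      HeadStep P t m (.alloc (.val (.int z)) (.val v)) σ [] (.val (.loc (.real n)))
        { σ with
          heap := fillRange σ.heap (.real n) z v
          heapA := fillRange σ.heapA (.real n) z (.int 0) } []
  | free {m : Mode} {l : Loc} {v : Val} {σ : State} :
      σ.heap l = some v →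
      HeadStep P t m (.free (.val (.loc l))) σ [] (.val .unit)
        { σ with
          heap := Function.update σ.heap l none
          heapA := Function.update σ.heapA l none } []
  | resolve {m : Mode} {e : Expr} {p : ℤ} {v w : Val} {σ σ' : State} {κ : List Obs}
      {es : List (ℕ × Expr)} :
      HeadStep P t m e σ κ (.val v) σ' es →
      HeadStep P t m (.resolve e (.val (.proph p)) (.val w)) σ (κ ++ [(p, v, w)]) (.val v) σ' es
  /-- A call of a real function evaluates the auxiliary argument and consumes a call permission. -/
  | beta {m : Mode} {f x y : Binder} {e e₃ : Expr} {v v' : Val} {σ σ' : State}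
      {CP CP' : Multiset Val} :
      σ.callPerms t = some CP → P.deg₀ ∈ CP →
      BigStep P t e₃ σ v' σ' →
      σ'.callPerms t = some (P.deg₀ ::ₘ CP') →
      HeadStep P t m (.app (.val (.recI f x y e)) (.val v) e₃) σ []
        (((e.substB f (.recI f x y e)).substB x v).substB y v')
        { σ' with callPerms := Function.update σ'.callPerms t (some CP') } []
  | betaA {m : Mode} {f x : Binder} {e e₂ : Expr} {v v' : Val} {σ σ' σ'' : State} :
      BigStep P t e₂ σ v σ' →
      BigStep P t ((e.substB f (.recA f x e)).substB x v) σ' v' σ'' →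
      HeadStep P t m (.appA (.val (.recA f x e)) e₂) σ [] (.val v') σ'' []
  | atomic {e : Expr} {v : Val} {σ σ' : State} :
      BigStep P t e σ v σ' →
      HeadStep P t .full (.atomic e) σ [] (.val v) σ' []
  | fork {e : Expr} {l : List (ℕ × Val)} {O : Multiset (ℕ × Val)} {CP : Multiset Val}
      {EP : Multiset (ℕ × Val)} {t' : ℕ} {σ : State} :
      σ.obls t = some (.active (O + (l : Multiset (ℕ × Val)))) →
      σ.callPerms t = some CP → σ.expectPerms t = some EP →
      IsLeast {k : ℕ | 0 < k ∧ σ.obls k = none} t' →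
      HeadStep P t .full (.fork (.val (Val.sigList (l.map Prod.fst))) e) σ [] (.val .unit)
        { σ with
          obls := Function.update
            (Function.update σ.obls t (some (.active O)))
            t' (some (.active (l : Multiset (ℕ × Val))))
          callPerms := Function.update σ.callPerms t' (some CP)
          expectPerms := Function.update σ.expectPerms t' (some EP) }
        [(t', e.thenFinish)]
  | letA {m : Mode} {x : Binder} {e₁ e₂ : Expr} {v : Val} {σ σ' : State} :
      BigStep P t e₁ σ v σ' →
      HeadStep P t m (.letA x e₁ e₂) σ [] (e₂.substB x v) σ' []
  | allocA {m : Mode} {z n : ℤ} {v : Val} {σ : State} :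
      0 < z → FreeRange σ.heap (.aux n) z → FreeRange σ.heapA (.aux n) z →
      HeadStep P t m (.allocA (.val (.int z)) (.val v)) σ [] (.val (.loc (.aux n)))
        { σ with heapA := fillRange σ.heapA (.aux n) z v } []
  | loadA {m : Mode} {l : Loc} {v : Val} {σ : State} :
      σ.heapA l = some v →
      HeadStep P t m (.loadA (.val (.loc l))) σ [] (.val v) σ []
  | storeA {m : Mode} {l : Loc} {v w : Val} {σ : State} :
      σ.heapA l = some v →
      HeadStep P t m (.storeA (.val (.loc l)) (.val w)) σ [] (.val .unit)
        { σ with heapA := Function.update σ.heapA l (some w) } []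
  | currentThread {m : Mode} {σ : State} :
      HeadStep P t m .currentThread σ [] (.val (.int t)) σ []
  | finish {m : Mode} {σ : State} :
      σ.obls t = some (.active 0) →
      HeadStep P t m .finish σ [] (.val .unit)
        { σ with obls := Function.update σ.obls t (some .finished) } []
  | lower {m : Mode} {d d' : Val} {n t' : ℕ} {CP : Multiset Val} {σ : State} :
      σ.callPerms t' = some (d ::ₘ CP) → P.degLt d' d →
      HeadStep P t m
        (.lower (.val d) (.val (.int n)) (.val d') (.val (.int t'))) σ [] (.val .unit)
        { σ with
          callPerms := Function.update σ.callPerms t'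
            (some (CP + Multiset.replicate n d')) } []
  | newSignal {m : Mode} {s t' : ℕ} {lev : Val} {O : Multiset (ℕ × Val)} {σ : State} :
      σ.signals s = none → σ.obls t' = some (.active O) →
      HeadStep P t m (.newSignal (.val (.int t')) (.val lev)) σ [] (.val (.sig s))
        { σ with
          obls := Function.update σ.obls t' (some (.active ((s, lev) ::ₘ O)))
          signals := Function.update σ.signals s (some (lev, false)) } []
  | setSignal {m : Mode} {s t' : ℕ} {lev : Val} {b : Bool} {O O' : Multiset (ℕ × Val)}
      {σ : State} :
      σ.signals s = some (lev, b) → σ.obls t' = some (.active O) →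
      O = (s, lev) ::ₘ O' ∨ ((s, lev) ∉ O ∧ O' = O) →
      HeadStep P t m (.setSignal (.val (.int t')) (.val (.sig s))) σ [] (.val .unit)
        { σ with
          obls := Function.update σ.obls t' (some (.active O'))
          signals := Function.update σ.signals s (some (lev, true)) } []
  | newExpectPerm {m : Mode} {s t' : ℕ} {d d' : Val} {x : Val × Bool} {CP : Multiset Val}
      {EP : Multiset (ℕ × Val)} {σ : State} :
      σ.signals s = some x → σ.callPerms t' = some (d ::ₘ CP) → P.degLt d' d →
      σ.expectPerms t' = some EP →
      HeadStep P t m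
        (.newExpectPerm (.val (.int t')) (.val (.sig s)) (.val d) (.val d')) σ [] (.val .unit)
        { σ with
          callPerms := Function.update σ.callPerms t' (some CP)
          expectPerms := Function.update σ.expectPerms t' (some ((s, d') ::ₘ EP)) } []
  | expect {m : Mode} {s t' : ℕ} {d lev : Val} {O : Multiset (ℕ × Val)} {CP : Multiset Val}
      {EP : Multiset (ℕ × Val)} {σ : State} :
      σ.signals s = some (lev, false) → σ.obls t' = some (.active O) →
      (∀ o ∈ O, P.levLt lev o.2) →
      σ.expectPerms t' = some EP → (s, d) ∈ EP → σ.callPerms t' = some CP →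
      HeadStep P t m
        (.expect (.val (.int t')) (.val (.sig s)) (.val d)) σ [] (.val .unit)
        { σ with callPerms := Function.update σ.callPerms t' (some (d ::ₘ CP)) } []
/-- Big-step evaluation: finitely many nested steps, without observations, to a value. -/
inductive BigStep (P : Params) (t : ℕ) : Expr → State → Val → State → Prop
  | done {v : Val} {σ : State} : BigStep P t (.val v) σ v σ
  | step {K : Ctx} {e₀ e e' : Expr} {v : Val} {σ σ' σ'' : State} :
      e₀ = K.fill e → HeadStep P t .nested e σ [] e' σ' [] →
      BigStep P t (K.fill e') σ' v σ'' → BigStep P t e₀ σ v σ''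
end

/-- Per-thread reduction. -/
inductive ThreadStep (P : Params) (t : ℕ) :
    Expr → State → List Obs → Expr → State → List (ℕ × Expr) → Prop
  | mk (K : Ctx) {e e' : Expr} {σ σ' : State} {κ : List Obs} {es : List (ℕ × Expr)} :
      HeadStep P t .full e σ κ e' σ' es → ThreadStep P t (K.fill e) σ κ (K.fill e') σ' es

/-- The next step of the thread aborts the program. -/
def Aborts (e : Expr) : Prop := ∃ K : Ctx, e = K.fill .abort

/-- A thread pool and a state. The thread at position `i` of the pool has identifier `i + 1`. -/
abbrev Config := List Expr × State

/-- `MachineStep P i c c'`: the thread at position `i` takes a step. -/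
inductive MachineStep (P : Params) : ℕ → Config → Config → Prop
  | step (T₁ T₂ : List Expr) {e e' : Expr} {σ σ' : State} {κ : List Obs}
      {es : List (ℕ × Expr)} :
      ThreadStep P (T₁.length + 1) e σ κ e' σ' es →
      es.map Prod.fst = List.range' (T₁.length + T₂.length + 2) es.length →
      MachineStep P T₁.length (T₁ ++ e :: T₂, σ) (T₁ ++ e' :: T₂ ++ es.map Prod.snd, σ')
  | abort (T₁ T₂ : List Expr) {e : Expr} {σ : State} :
      Aborts e →
      MachineStep P T₁.length (T₁ ++ e :: T₂, σ)
        ((T₁ ++ e :: T₂).map (fun _ => .val .unit), σ)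

def Reducible (P : Params) (t : ℕ) (e : Expr) (σ : State) : Prop :=
  (∃ κ e' σ' es, ThreadStep P t e σ κ e' σ' es) ∨ Aborts e

/-- A configuration is safe when no thread of a reachable configuration is stuck. -/
def Safe (P : Params) (c : Config) : Prop :=
  ∀ c', Relation.ReflTransGen (fun a b => ∃ i, MachineStep P i a b) c c' →
    ∀ i e, c'.1[i]? = some e → e.IsVal ∨ Reducible P (i + 1) e c'.2

/-! ## The erased language -/

mutual
/-- Head steps of the erased language: there is no auxiliary state, calls consume nothing and
forked threads are not extended by `Finish`. -/
inductive ErasedHeadStep :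
    Mode → Expr → RealState → List Obs → Expr → RealState → List Expr → Prop
  | pure {m : Mode} {e e' : Expr} {r : RealState} :
      PureStep e e' → ErasedHeadStep m e r [] e' r []
  | heap {m : Mode} {e e' : Expr} {r r' : RealState} :
      HeapStep e r e' r' → ErasedHeadStep m e r [] e' r' []
  | alloc {m : Mode} {z n : ℤ} {v : Val} {r : RealState} :
      0 < z → FreeRange r.heap (.real n) z →
      ErasedHeadStep m (.alloc (.val (.int z)) (.val v)) r [] (.val (.loc (.real n)))
        { r with heap := fillRange r.heap (.real n) z v } []
  | free {m : Mode} {l : Loc} {v : Val} {r : RealState} :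
      r.heap l = some v →
      ErasedHeadStep m (.free (.val (.loc l))) r [] (.val .unit)
        { r with heap := Function.update r.heap l none } []
  | resolve {m : Mode} {e : Expr} {p : ℤ} {v w : Val} {r r' : RealState} {κ : List Obs}
      {es : List Expr} :
      ErasedHeadStep m e r κ (.val v) r' es →
      ErasedHeadStep m (.resolve e (.val (.proph p)) (.val w)) r (κ ++ [(p, v, w)])
        (.val v) r' es
  | beta {m : Mode} {f x y : Binder} {e : Expr} {v v' : Val} {r : RealState} :
      ErasedHeadStep m (.app (.val (.recI f x y e)) (.val v) (.val v')) r []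
        (((e.substB f (.recI f x y e)).substB x v).substB y v') r []
  | atomic {e : Expr} {v : Val} {r r' : RealState} :
      ErasedBigStep e r v r' → ErasedHeadStep .full (.atomic e) r [] (.val v) r' []
  | fork {e : Expr} {v : Val} {r : RealState} :
      ErasedHeadStep .full (.fork (.val v) e) r [] (.val .unit) r [e]
inductive ErasedBigStep : Expr → RealState → Val → RealState → Prop
  | done {v : Val} {r : RealState} : ErasedBigStep (.val v) r v r
  | step {K : Ctx} {e₀ e e' : Expr} {v : Val} {r r' r'' : RealState} :
      e₀ = K.fill e → ErasedHeadStep .nested e r [] e' r' [] →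
      ErasedBigStep (K.fill e') r' v r'' → ErasedBigStep e₀ r v r''
end

inductive ErasedThreadStep : Expr → RealState → List Obs → Expr → RealState → List Expr → Prop
  | mk (K : Ctx) {e e' : Expr} {r r' : RealState} {κ : List Obs} {es : List Expr} :
      ErasedHeadStep .full e r κ e' r' es →
      ErasedThreadStep (K.fill e) r κ (K.fill e') r' es

abbrev ErasedConfig := List Expr × RealState

/-- The thread at position `i` takes a step. -/
inductive ErasedMachineStep : ℕ → ErasedConfig → ErasedConfig → Prop
  | step (T₁ T₂ : List Expr) {e e' : Expr} {r r' : RealState} {κ : List Obs} {es : List Expr} :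
      ErasedThreadStep e r κ e' r' es →
      ErasedMachineStep T₁.length (T₁ ++ e :: T₂, r) (T₁ ++ e' :: T₂ ++ es, r')
  | abort (T₁ T₂ : List Expr) {e : Expr} {r : RealState} :
      Aborts e →
      ErasedMachineStep T₁.length (T₁ ++ e :: T₂, r)
        ((T₁ ++ e :: T₂).map (fun _ => .val .unit), r)

/-- An infinite execution from `c` exists in which every thread that is present and not finished
in some configuration takes a step at that or a later point. -/
def HasInfiniteFairExecution (c : ErasedConfig) : Prop :=
  ∃ (run : ℕ → ErasedConfig) (sched : ℕ → ℕ),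
    run 0 = c ∧
    (∀ n, ErasedMachineStep (sched n) (run n) (run (n + 1))) ∧
    ∀ n i e, (run n).1[i]? = some e → ¬ e.IsVal → ∃ m, n ≤ m ∧ sched m = i

/-! ## Erasure -/

mutual
def Val.erase : Val → Val
  | .lit l => .lit l
  | .recI f x _ e => .recI f x none e.erase
  | .recA f x e => .recA f x e.erase
  | .pair v w => .pair v.erase w.erase
  | .inl v => .inl v.erase
  | .inr v => .inr v.erase
/-- Erasure of expressions: auxiliary lets are dropped, auxiliary parameters become anonymous and
auxiliary arguments become `()`; all other cases are by structural recursion. -/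
def Expr.erase : Expr → Expr
  | .letA _ _ e₂ => e₂.erase
  | .recI f x _ e => .recI f x none e.erase
  | .app e₁ e₂ _ => .app e₁.erase e₂.erase (.val .unit)
  | .fork _ e => .fork (.val .unit) e.erase
  | .atomic e => .atomic e.erase
  | .val v => .val v.erase
  | .var x => .var x
  | .recA f x e => .recA f x e.erase
  | .appA e₁ e₂ => .appA e₁.erase e₂.erase
  | .unop o e => .unop o e.erase
  | .binop o e₁ e₂ => .binop o e₁.erase e₂.erase
  | .ite e e₁ e₂ => .ite e.erase e₁.erase e₂.erase
  | .pair e₁ e₂ => .pair e₁.erase e₂.erase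
  | .fst e => .fst e.erase
  | .snd e => .snd e.erase
  | .inl e => .inl e.erase
  | .inr e => .inr e.erase
  | .case e e₁ e₂ => .case e.erase e₁.erase e₂.erase
  | .caseA e e₁ e₂ => .caseA e.erase e₁.erase e₂.erase
  | .alloc e₁ e₂ => .alloc e₁.erase e₂.erase
  | .free e => .free e.erase
  | .load e => .load e.erase
  | .store e₁ e₂ => .store e₁.erase e₂.erase
  | .cmpXchg e₁ e₂ e₃ => .cmpXchg e₁.erase e₂.erase e₃.erase
  | .xchg e₁ e₂ => .xchg e₁.erase e₂.erase
  | .faa e₁ e₂ => .faa e₁.erase e₂.erase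
  | .newProph => .newProph
  | .resolve e₁ e₂ e₃ => .resolve e₁.erase e₂.erase e₃.erase
  | .letR x e₁ e₂ => .letR x e₁.erase e₂.erase
  | .abort => .abort
  | .allocA e₁ e₂ => .allocA e₁.erase e₂.erase
  | .loadA e => .loadA e.erase
  | .storeA e₁ e₂ => .storeA e₁.erase e₂.erase
  | .currentThread => .currentThread
  | .finish => .finish
  | .lower e₁ e₂ e₃ e₄ => .lower e₁.erase e₂.erase e₃.erase e₄.erase
  | .newSignal e₁ e₂ => .newSignal e₁.erase e₂.erase
  | .setSignal e₁ e₂ => .setSignal e₁.erase e₂.erase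
  | .newExpectPerm e₁ e₂ e₃ e₄ => .newExpectPerm e₁.erase e₂.erase e₃.erase e₄.erase
  | .expect e₁ e₂ e₃ => .expect e₁.erase e₂.erase e₃.erase
end

/-! ## Syntactic constraints -/

/-- The position of a piece of real code: in a thread, in tail position of an atomic block, or
elsewhere in an atomic block. -/
inductive Pos where
  | thread
  | blockTail
  | blockInner

/-- The variable of the binder, if any. -/
def Binder.vars (b : Binder) : Set String := {x | b = some x}

/-- Literals of real code. -/
def RealLit : Lit → Prop
  | .sig _ => False
  | .loc (.aux _) => False
  | _ => True

mutual
/-- Values that may occur in real code. -/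
inductive RealVal : Val → Prop
  | lit {l : Lit} : RealLit l → RealVal (.lit l)
  | recI {f x y : Binder} {e : Expr} :
      RealCode .thread ((y.vars \ x.vars) \ f.vars) e → RealVal (.recI f x y e)
  | pair {v w : Val} : RealVal v → RealVal w → RealVal (.pair v w)
  | inl {v : Val} : RealVal v → RealVal (.inl v)
  | inr {v : Val} : RealVal v → RealVal (.inr v)
/-- Values that may occur in auxiliary code. -/
inductive AuxVal : Val → Prop
  | real {v : Val} : RealVal v → AuxVal v
  | lit {l : Lit} : AuxVal (.lit l)
  | recA {f x : Binder} {e : Expr} : AuxCode e → AuxVal (.recA f x e)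
  | pair {v w : Val} : AuxVal v → AuxVal w → AuxVal (.pair v w)
  | inl {v : Val} : AuxVal v → AuxVal (.inl v)
  | inr {v : Val} : AuxVal v → AuxVal (.inr v)
/-- Auxiliary code: no write to the real heap, no call of a real function, no prophecy operation,
no fork, no atomic block. -/
inductive AuxCode : Expr → Prop
  | val {v : Val} : AuxVal v → AuxCode (.val v)
  | var {x : String} : AuxCode (.var x)
  | recA {f x : Binder} {e : Expr} : AuxCode e → AuxCode (.recA f x e)
  | appA {e₁ e₂ : Expr} : AuxCode e₁ → AuxCode e₂ → AuxCode (.appA e₁ e₂)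
  | unop {o : UnOp} {e : Expr} : AuxCode e → AuxCode (.unop o e)
  | binop {o : BinOp} {e₁ e₂ : Expr} : AuxCode e₁ → AuxCode e₂ → AuxCode (.binop o e₁ e₂)
  | ite {e e₁ e₂ : Expr} : AuxCode e → AuxCode e₁ → AuxCode e₂ → AuxCode (.ite e e₁ e₂)
  | pair {e₁ e₂ : Expr} : AuxCode e₁ → AuxCode e₂ → AuxCode (.pair e₁ e₂)
  | fst {e : Expr} : AuxCode e → AuxCode (.fst e)
  | snd {e : Expr} : AuxCode e → AuxCode (.snd e)
  | inl {e : Expr} : AuxCode e → AuxCode (.inl e)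
  | inr {e : Expr} : AuxCode e → AuxCode (.inr e)
  | caseA {e e₁ e₂ : Expr} : AuxCode e → AuxCode e₁ → AuxCode e₂ → AuxCode (.caseA e e₁ e₂)
  | load {e : Expr} : AuxCode e → AuxCode (.load e)
  | letR {x : Binder} {e₁ e₂ : Expr} : AuxCode e₁ → AuxCode e₂ → AuxCode (.letR x e₁ e₂)
  | letA {x : Binder} {e₁ e₂ : Expr} : AuxCode e₁ → AuxCode e₂ → AuxCode (.letA x e₁ e₂)
  | allocA {e₁ e₂ : Expr} : AuxCode e₁ → AuxCode e₂ → AuxCode (.allocA e₁ e₂)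
  | loadA {e : Expr} : AuxCode e → AuxCode (.loadA e)
  | storeA {e₁ e₂ : Expr} : AuxCode e₁ → AuxCode e₂ → AuxCode (.storeA e₁ e₂)
  | currentThread : AuxCode .currentThread
  | finish : AuxCode .finish
  | lower {e₁ e₂ e₃ e₄ : Expr} : AuxCode e₁ → AuxCode e₂ → AuxCode e₃ → AuxCode e₄ →
      AuxCode (.lower e₁ e₂ e₃ e₄)
  | newSignal {e₁ e₂ : Expr} : AuxCode e₁ → AuxCode e₂ → AuxCode (.newSignal e₁ e₂)
  | setSignal {e₁ e₂ : Expr} : AuxCode e₁ → AuxCode e₂ → AuxCode (.setSignal e₁ e₂)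
  | newExpectPerm {e₁ e₂ e₃ e₄ : Expr} : AuxCode e₁ → AuxCode e₂ → AuxCode e₃ → AuxCode e₄ →
      AuxCode (.newExpectPerm e₁ e₂ e₃ e₄)
  | expect {e₁ e₂ e₃ : Expr} : AuxCode e₁ → AuxCode e₂ → AuxCode e₃ → AuxCode (.expect e₁ e₂ e₃)
/-- The operands of A-normal form: values, variables and function definitions. The set `A` holds
the auxiliary variables in scope, which may not occur free in real code. -/
inductive Operand : Set String → Expr → Prop
  | val {A : Set String} {v : Val} : RealVal v → Operand A (.val v)
  | var {A : Set String} {x : String} : x ∉ A → Operand A (.var x)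
  | recI {A : Set String} {f x y : Binder} {e : Expr} :
      RealCode .thread (((A ∪ y.vars) \ x.vars) \ f.vars) e → Operand A (.recI f x y e)
/-- Single operations on operands. -/
inductive Operation : Pos → Set String → Expr → Prop
  | unop {p : Pos} {A : Set String} {o : UnOp} {e : Expr} :
      Operand A e → Operation p A (.unop o e)
  | binop {p : Pos} {A : Set String} {o : BinOp} {e₁ e₂ : Expr} :
      Operand A e₁ → Operand A e₂ → Operation p A (.binop o e₁ e₂)
  | pair {p : Pos} {A : Set String} {e₁ e₂ : Expr} :
      Operand A e₁ → Operand A e₂ → Operation p A (.pair e₁ e₂)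
  | fst {p : Pos} {A : Set String} {e : Expr} : Operand A e → Operation p A (.fst e)
  | snd {p : Pos} {A : Set String} {e : Expr} : Operand A e → Operation p A (.snd e)
  | inl {p : Pos} {A : Set String} {e : Expr} : Operand A e → Operation p A (.inl e)
  | inr {p : Pos} {A : Set String} {e : Expr} : Operand A e → Operation p A (.inr e)
  | free {p : Pos} {A : Set String} {e : Expr} : Operand A e → Operation p A (.free e)
  | load {p : Pos} {A : Set String} {e : Expr} : Operand A e → Operation p A (.load e)
  | store {p : Pos} {A : Set String} {e₁ e₂ : Expr} :
      Operand A e₁ → Operand A e₂ → Operation p A (.store e₁ e₂)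
  | cmpXchg {p : Pos} {A : Set String} {e₁ e₂ e₃ : Expr} :
      Operand A e₁ → Operand A e₂ → Operand A e₃ → Operation p A (.cmpXchg e₁ e₂ e₃)
  | xchg {p : Pos} {A : Set String} {e₁ e₂ : Expr} :
      Operand A e₁ → Operand A e₂ → Operation p A (.xchg e₁ e₂)
  | faa {p : Pos} {A : Set String} {e₁ e₂ : Expr} :
      Operand A e₁ → Operand A e₂ → Operation p A (.faa e₁ e₂)
  /-- in an atomic block, operations with an arbitrary result may only come last -/
  | alloc {p : Pos} {A : Set String} {e₁ e₂ : Expr} :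
      p ≠ .blockInner → Operand A e₁ → Operand A e₂ → Operation p A (.alloc e₁ e₂)
  | newProph {p : Pos} {A : Set String} : p ≠ .blockInner → Operation p A .newProph
  | resolve {A : Set String} {e₁ e₂ e₃ : Expr} :
      Operation .thread A e₁ → Operand A e₂ → Operand A e₃ →
      Operation .thread A (.resolve e₁ e₂ e₃)
  | app {A : Set String} {e₁ e₂ e₃ : Expr} :
      Operand A e₁ → Operand A e₂ → AuxCode e₃ → Operation .thread A (.app e₁ e₂ e₃)
  | case {A : Set String} {e e₁ e₂ : Expr} :
      Operand A e → Operand A e₁ → Operand A e₂ → Operation .thread A (.case e e₁ e₂)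
  | forkVal {A : Set String} {v : Val} {e : Expr} :
      AuxVal v → RealCode .thread A e → Operation .thread A (.fork (.val v) e)
  | forkVar {A : Set String} {x : String} {e : Expr} :
      RealCode .thread A e → Operation .thread A (.fork (.var x) e)
  | atomic {A : Set String} {e : Expr} :
      RealCode .blockTail A e → Operation .thread A (.atomic e)
/-- Real code in A-normal form, with the auxiliary variables `A` in scope. The auxiliary let is the
only place, besides auxiliary arguments, where auxiliary code occurs. -/
inductive RealCode : Pos → Set String → Expr → Prop
  | operand {p : Pos} {A : Set String} {e : Expr} : Operand A e → RealCode p A e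
  | operation {p : Pos} {A : Set String} {e : Expr} : Operation p A e → RealCode p A e
  | ite {p : Pos} {A : Set String} {e e₁ e₂ : Expr} :
      Operand A e → RealCode p A e₁ → RealCode p A e₂ → RealCode p A (.ite e e₁ e₂)
  | letThread {A : Set String} {x : Binder} {e₁ e₂ : Expr} :
      RealCode .thread A e₁ → RealCode .thread (A \ x.vars) e₂ →
      RealCode .thread A (.letR x e₁ e₂)
  | letBlock {p : Pos} {A : Set String} {x : Binder} {e₁ e₂ : Expr} :
      p ≠ .thread → RealCode .blockInner A e₁ → RealCode p (A \ x.vars) e₂ →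
      RealCode p A (.letR x e₁ e₂)
  | letA {p : Pos} {A : Set String} {x : Binder} {e₁ e₂ : Expr} :
      AuxCode e₁ → RealCode p (A ∪ x.vars) e₂ → RealCode p A (.letA x e₁ e₂)
  | abort {A : Set String} : RealCode .thread A .abort
end

/-- An instrumented program that meets the syntactic constraints. -/
def Erasable (e : Expr) : Prop := RealCode .thread ∅ e

end HLT

open HLT

namespace HLT

/-! ## Unique decomposition -/

-- Suppose that the erased program has an infinite fair execution. It is lifted to an infinite run
-- of the instrumented program, and the permissions, obligations and signals of that run lead to a
-- contradiction.
--
-- Lifting. Between two erased steps no auxiliary let is due in any instrumented thread: the thread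
-- is either `E; Finish`, where `E` is normal real code whose erasure is the erased thread, or a
-- value with finished obligations (`ThreadRel`). When the erased thread moves, safety provides some
-- step of `E`. Its outcome may be the wrong one, because fresh addresses and prophecies are chosen
-- freely, but the same redex also has a step with the right outcome (`RealCode.ctxMatch`,
-- `Operation.headMatch`). In an atomic block the evaluation provided by safety is followed, and
-- only the result of its last operation is exchanged (`BigStep.simulate`); this is why operations
-- with an arbitrary result may only come last there. Auxiliary code leaves the real state alone
-- (`BigStep.auxCode`), so auxiliary lets that become due, and the final `Finish`, are run at once
-- without changing the erasure (`RealCode.normalize`). Thus each erased step becomes finitely many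
-- instrumented steps, among them one of the same thread (`Rel.step`). Abortion plays no role: it
-- leaves only values, after which nothing can step.
--
-- Termination. A step makes the code of its thread smaller or consumes a call permission of that
-- thread (`HeadStep.ghost`). Call permissions decrease in the multiset order, except that `Expect`
-- produces them, and does so repeatedly from one expect permission. Therefore an expect permission
-- `(s, d)` is counted as so many copies of `d` as there are expectations of `s` still to come in
-- the run. If each signal is expected finitely often, these counts are finite and the multiset of
-- the measures of all threads decreases at every step. Otherwise take a signal `s` of minimal level
-- among those expected infinitely often. It is never set, since only unset signals can be expected,
-- so at each time some thread holds the obligation for it. A holder expects only signals of lower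
-- levels, which are expected finitely often, so its own measure is meaningful: it never increases,
-- it decreases whenever the holder moves, and if the obligation passes to a forked thread, that
-- thread has a smaller measure than the holder had. A thread with an obligation is not finished,
-- its erasure is not a value, and fairness makes it move again and again, which is impossible
-- (`no_infinite_run`).

theorem Expr.isVal_val (v : Val) : (Expr.val v).IsVal := ⟨v, rfl⟩

/-- Continue with the value of `e`, or report `e` as the subexpression to be evaluated in `k`. -/
def nextIn (e : Expr) (k : CtxItem) (c : Val → Option (CtxItem × Expr)) :
    Option (CtxItem × Expr) :=
  match e with
  | .val v => c v
  | e => some (k, e)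

theorem nextIn_val (v : Val) (k : CtxItem) (c : Val → Option (CtxItem × Expr)) :
    nextIn (.val v) k c = c v := rfl

theorem nextIn_of_not_isVal {e : Expr} (h : ¬ e.IsVal) (k : CtxItem)
    (c : Val → Option (CtxItem × Expr)) : nextIn e k c = some (k, e) := by
  cases e <;> first | rfl | exact (h ⟨_, rfl⟩).elim

/-- The outermost evaluation context item and the subexpression to be evaluated in it. -/
def Expr.next : Expr → Option (CtxItem × Expr)
  | .app e₁ e₂ e₃ => nextIn e₂ (.appArg e₁ e₃) fun v₂ => nextIn e₁ (.appFun v₂ e₃) fun _ => none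
  | .appA e₁ e₂ => nextIn e₂ (.appAArg e₁) fun v₂ => nextIn e₁ (.appAFun v₂) fun _ => none
  | .unop o e => nextIn e (.unop o) fun _ => none
  | .binop o e₁ e₂ => nextIn e₂ (.binopR o e₁) fun v₂ => nextIn e₁ (.binopL o v₂) fun _ => none
  | .ite e e₁ e₂ => nextIn e (.ite e₁ e₂) fun _ => none
  | .pair e₁ e₂ => nextIn e₂ (.pairR e₁) fun v₂ => nextIn e₁ (.pairL v₂) fun _ => none
  | .fst e => nextIn e .fst fun _ => none
  | .snd e => nextIn e .snd fun _ => none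
  | .inl e => nextIn e .inl fun _ => none
  | .inr e => nextIn e .inr fun _ => none
  | .case e e₁ e₂ => nextIn e (.case e₁ e₂) fun _ => none
  | .caseA e e₁ e₂ => nextIn e (.caseA e₁ e₂) fun _ => none
  | .alloc e₁ e₂ => nextIn e₂ (.allocR e₁) fun v₂ => nextIn e₁ (.allocL v₂) fun _ => none
  | .free e => nextIn e .free fun _ => none
  | .load e => nextIn e .load fun _ => none
  | .store e₁ e₂ => nextIn e₂ (.storeR e₁) fun v₂ => nextIn e₁ (.storeL v₂) fun _ => none
  | .cmpXchg e₁ e₂ e₃ =>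
      nextIn e₃ (.cmpXchgR e₁ e₂) fun v₃ =>
        nextIn e₂ (.cmpXchgM e₁ v₃) fun v₂ => nextIn e₁ (.cmpXchgL v₂ v₃) fun _ => none
  | .xchg e₁ e₂ => nextIn e₂ (.xchgR e₁) fun v₂ => nextIn e₁ (.xchgL v₂) fun _ => none
  | .faa e₁ e₂ => nextIn e₂ (.faaR e₁) fun v₂ => nextIn e₁ (.faaL v₂) fun _ => none
  | .resolve e₁ e₂ e₃ =>
      nextIn e₃ (.resolveR e₁ e₂) fun v₃ =>
        nextIn e₂ (.resolveM e₁ v₃) fun v₂ =>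
          e₁.next.map fun p => (.resolveL p.1 v₂ v₃, p.2)
  | .letR x e₁ e₂ => nextIn e₁ (.letR x e₂) fun _ => none
  | .fork e₁ e₂ => nextIn e₁ (.fork e₂) fun _ => none
  | .allocA e₁ e₂ => nextIn e₂ (.allocAR e₁) fun v₂ => nextIn e₁ (.allocAL v₂) fun _ => none
  | .loadA e => nextIn e .loadA fun _ => none
  | .storeA e₁ e₂ => nextIn e₂ (.storeAR e₁) fun v₂ => nextIn e₁ (.storeAL v₂) fun _ => none
  | .lower e₁ e₂ e₃ e₄ =>
      nextIn e₄ (.lower₄ e₁ e₂ e₃) fun v₄ => nextIn e₃ (.lower₃ e₁ e₂ v₄) fun v₃ =>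
        nextIn e₂ (.lower₂ e₁ v₃ v₄) fun v₂ => nextIn e₁ (.lower₁ v₂ v₃ v₄) fun _ => none
  | .newSignal e₁ e₂ =>
      nextIn e₂ (.newSignalR e₁) fun v₂ => nextIn e₁ (.newSignalL v₂) fun _ => none
  | .setSignal e₁ e₂ =>
      nextIn e₂ (.setSignalR e₁) fun v₂ => nextIn e₁ (.setSignalL v₂) fun _ => none
  | .newExpectPerm e₁ e₂ e₃ e₄ =>
      nextIn e₄ (.newExpectPerm₄ e₁ e₂ e₃) fun v₄ =>
        nextIn e₃ (.newExpectPerm₃ e₁ e₂ v₄) fun v₃ =>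
          nextIn e₂ (.newExpectPerm₂ e₁ v₃ v₄) fun v₂ =>
            nextIn e₁ (.newExpectPerm₁ v₂ v₃ v₄) fun _ => none
  | .expect e₁ e₂ e₃ =>
      nextIn e₃ (.expect₃ e₁ e₂) fun v₃ =>
        nextIn e₂ (.expect₂ e₁ v₃) fun v₂ => nextIn e₁ (.expect₁ v₂ v₃) fun _ => none
  | _ => none

/-- `Expr.next` inspects the operands in evaluation order and stops at the first one that is not a
value, which is the one in the hole. Contexts can thus be compared item by item. -/
theorem CtxItem.next_fill (k : CtxItem) {e : Expr} (h : ¬ e.IsVal) :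
    (k.fill e).next = some (k, e) := by
  induction k with
  | resolveL k v₂ v₃ ih => simp [CtxItem.fill, Expr.next, nextIn_val, ih]
  | _ => simp [CtxItem.fill, Expr.next, nextIn_of_not_isVal h, nextIn_val]

theorem CtxItem.fill_not_isVal (k : CtxItem) (e : Expr) : ¬ (k.fill e).IsVal := by
  rintro ⟨v, hv⟩
  cases k <;> simp [CtxItem.fill] at hv

theorem Ctx.fill_not_isVal (K : Ctx) {e : Expr} (h : ¬ e.IsVal) : ¬ (K.fill e).IsVal := by
  cases K with
  | nil => exact h
  | cons k K => exact k.fill_not_isVal _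

theorem Ctx.fill_nil (e : Expr) : Ctx.fill [] e = e := rfl

theorem Ctx.fill_cons (k : CtxItem) (K : Ctx) (e : Expr) :
    Ctx.fill (k :: K) e = k.fill (Ctx.fill K e) := rfl

/-- A redex: neither a value nor a context filled with a non-value. -/
structure Expr.Redex (e : Expr) : Prop where
  not_isVal : ¬ e.IsVal
  next_eq : e.next = none

/-- A nonempty context around a non-value always has something to evaluate inside. -/
theorem Ctx.eq_nil_of_next_eq_none {R R' : Expr} {K : Ctx} (hR : R.next = none)
    (hR' : ¬ R'.IsVal) (h : R = K.fill R') : K = [] := by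
  cases K with
  | nil => rfl
  | cons k K =>
    rw [h, Ctx.fill_cons, k.next_fill (Ctx.fill_not_isVal K hR')] at hR
    cases hR

/-- The decomposition into a context and a redex is unique. -/
theorem Expr.Redex.unique {R R' : Expr} (hR : R.Redex) (hR' : R'.Redex) :
    ∀ {K K' : Ctx}, K.fill R = K'.fill R' → R = R'
  | [], K', h => by
    obtain rfl := Ctx.eq_nil_of_next_eq_none hR.next_eq hR'.not_isVal h
    exact h
  | k :: K, [], h => by
    cases Ctx.eq_nil_of_next_eq_none hR'.next_eq hR.not_isVal h.symm
  | k :: K, k' :: K', h => by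
    have h₁ := k.next_fill (Ctx.fill_not_isVal K hR.not_isVal)
    have h₂ := k'.next_fill (Ctx.fill_not_isVal K' hR'.not_isVal)
    rw [← Ctx.fill_cons] at h₁ h₂
    rw [h, h₂] at h₁
    simp only [Option.some.injEq, Prod.mk.injEq] at h₁
    exact Expr.Redex.unique hR hR' h₁.2.symm

/-- A call of an auxiliary function, possibly below prophecy resolutions: its argument is evaluated
both by contexts and by the call itself. -/
def Expr.IsAppA : Expr → Prop
  | .appA _ _ => True
  | .resolve e _ _ => e.IsAppA
  | _ => False

theorem redex_abort : Expr.Redex .abort := ⟨(by rintro ⟨v, h⟩; cases h), rfl⟩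

theorem redex_letA (x : Binder) (e₁ e₂ : Expr) : Expr.Redex (.letA x e₁ e₂) :=
  ⟨(by rintro ⟨v, h⟩; cases h), rfl⟩

theorem PureStep.redex {e e' : Expr} (h : PureStep e e') : e.Redex := by
  constructor
  · rintro ⟨v, rfl⟩; cases h
  · cases h <;> rfl

theorem HeapStep.redex {e e' : Expr} {r r' : RealState} (h : HeapStep e r e' r') : e.Redex := by
  constructor
  · rintro ⟨v, rfl⟩; cases h
  · cases h <;> rfl

theorem HeadStep.not_isVal {P : Params} {t : ℕ} {m : Mode} {e e' : Expr} {σ σ' : State}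
    {κ : List Obs} {es : List (ℕ × Expr)} (h : HeadStep P t m e σ κ e' σ' es) : ¬ e.IsVal := by
  rintro ⟨v, rfl⟩
  cases h with
  | pure h => cases h
  | heap h => cases h

/-- Auxiliary calls are excluded because `betaA` accepts an argument that is not yet a value, which
a context could evaluate as well. Real calls cause no such ambiguity: their auxiliary argument is
never an evaluation position. -/
theorem HeadStep.redex {P : Params} {t : ℕ} {m : Mode} {e e' : Expr} {σ σ' : State}
    {κ : List Obs} {es : List (ℕ × Expr)} (h : HeadStep P t m e σ κ e' σ' es)
    (he : ¬ e.IsAppA) : e.Redex := by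
  refine ⟨h.not_isVal, ?_⟩
  induction h using HeadStep.rec (motive_2 := fun _ _ _ _ _ => True) with
  | pure h => exact h.redex.next_eq
  | heap h => exact h.redex.next_eq
  | resolve h ih => simp [Expr.next, nextIn_val, ih he]
  | betaA => exact (he trivial).elim
  | done => trivial
  | step => trivial
  | _ => rfl

/-- No exception is needed here, as the erased language has no rule for auxiliary calls. -/
theorem ErasedHeadStep.redex {m : Mode} {e e' : Expr} {r r' : RealState}
    {κ : List Obs} {es : List Expr} (h : ErasedHeadStep m e r κ e' r' es) : e.Redex := by
  constructor
  · rintro ⟨v, rfl⟩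
    cases h with
    | pure h => cases h
    | heap h => cases h
  · induction h using ErasedHeadStep.rec (motive_2 := fun _ _ _ _ _ => True) with
    | pure h => exact h.redex.next_eq
    | heap h => exact h.redex.next_eq
    | resolve h ih => simp [Expr.next, nextIn_val, ih]
    | done => trivial
    | step => trivial
    | _ => rfl

/-- A step of the instrumented language in an evaluation context. -/
inductive CtxStep (P : Params) (t : ℕ) (m : Mode) :
    Expr → State → List Obs → Expr → State → List (ℕ × Expr) → Prop
  | mk (K : Ctx) {e e' : Expr} {σ σ' : State} {κ : List Obs} {es : List (ℕ × Expr)} :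
      HeadStep P t m e σ κ e' σ' es → CtxStep P t m (K.fill e) σ κ (K.fill e') σ' es

/-- A step of the erased language in an evaluation context. -/
inductive ErasedCtxStep (m : Mode) :
    Expr → RealState → List Obs → Expr → RealState → List Expr → Prop
  | mk (K : Ctx) {e e' : Expr} {r r' : RealState} {κ : List Obs} {es : List Expr} :
      ErasedHeadStep m e r κ e' r' es → ErasedCtxStep m (K.fill e) r κ (K.fill e') r' es

-- Inversion of steps in evaluation contexts, for threads and for nested evaluation

section
variable {P : Params} {t : ℕ} {m : Mode} {e e' : Expr} {k : CtxItem} {e₁ : Expr}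

theorem CtxStep.threadStep {σ σ' : State} {κ : List Obs} {es : List (ℕ × Expr)}
    (h : CtxStep P t .full e σ κ e' σ' es) : ThreadStep P t e σ κ e' σ' es := by
  cases h with
  | mk K h => exact .mk K h

theorem ThreadStep.ctxStep {σ σ' : State} {κ : List Obs} {es : List (ℕ × Expr)}
    (h : ThreadStep P t e σ κ e' σ' es) : CtxStep P t .full e σ κ e' σ' es := by
  cases h with
  | mk K h => exact .mk K h

theorem ErasedThreadStep.ctxStep {r r' : RealState} {κ : List Obs} {es : List Expr}
    (h : ErasedThreadStep e r κ e' r' es) : ErasedCtxStep .full e r κ e' r' es := by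
  cases h with
  | mk K h => exact .mk K h

theorem HeadStep.ctxStep {σ σ' : State} {κ : List Obs} {es : List (ℕ × Expr)}
    (h : HeadStep P t m e σ κ e' σ' es) : CtxStep P t m e σ κ e' σ' es :=
  .mk [] h

theorem CtxStep.fill {σ σ' : State} {κ : List Obs} {es : List (ℕ × Expr)}
    (h : CtxStep P t m e σ κ e' σ' es) (k : CtxItem) :
    CtxStep P t m (k.fill e) σ κ (k.fill e') σ' es := by
  cases h with
  | mk K h => exact .mk (k :: K) h

theorem CtxStep.not_isVal {σ σ' : State} {κ : List Obs} {es : List (ℕ × Expr)}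
    (h : CtxStep P t m e σ κ e' σ' es) : ¬ e.IsVal := by
  cases h with
  | mk K h => exact Ctx.fill_not_isVal K h.not_isVal

theorem ErasedCtxStep.not_isVal {r r' : RealState} {κ : List Obs} {es : List Expr}
    (h : ErasedCtxStep m e r κ e' r' es) : ¬ e.IsVal := by
  cases h with
  | mk K h => exact Ctx.fill_not_isVal K h.redex.not_isVal

/-- Head steps take place at redexes, for which `next` is undefined. So the context of the step is
nonempty, and its outermost item is the one that `next` finds. -/
theorem CtxStep.of_next {σ σ' : State} {κ : List Obs} {es : List (ℕ × Expr)}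
    (h : CtxStep P t m e σ κ e' σ' es) (he : ¬ e.IsAppA) (hn : e.next = some (k, e₁)) :
    ∃ e₁', e' = k.fill e₁' ∧ CtxStep P t m e₁ σ κ e₁' σ' es := by
  cases h with
  | mk K h =>
    cases K with
    | nil =>
      rw [Ctx.fill_nil] at he hn
      rw [(h.redex he).next_eq] at hn
      cases hn
    | cons k' K =>
      rw [Ctx.fill_cons, k'.next_fill (Ctx.fill_not_isVal K h.not_isVal)] at hn
      cases hn
      exact ⟨_, rfl, .mk K h⟩

theorem ErasedCtxStep.of_next {r r' : RealState} {κ : List Obs} {es : List Expr}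
    (h : ErasedCtxStep m e r κ e' r' es) (hn : e.next = some (k, e₁)) :
    ∃ e₁', e' = k.fill e₁' ∧ ErasedCtxStep m e₁ r κ e₁' r' es := by
  cases h with
  | mk K h =>
    cases K with
    | nil =>
      rw [Ctx.fill_nil, h.redex.next_eq] at hn
      cases hn
    | cons k' K =>
      rw [Ctx.fill_cons, k'.next_fill (Ctx.fill_not_isVal K h.redex.not_isVal)] at hn
      cases hn
      exact ⟨_, rfl, .mk K h⟩

theorem CtxStep.headStep {σ σ' : State} {κ : List Obs} {es : List (ℕ × Expr)}
    (h : CtxStep P t m e σ κ e' σ' es) (hn : e.next = none) :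
    HeadStep P t m e σ κ e' σ' es := by
  generalize he : e = e₀ at h
  cases h with
  | mk K h =>
    cases Ctx.eq_nil_of_next_eq_none (hn) h.not_isVal he
    subst he
    exact h

theorem ErasedCtxStep.headStep {r r' : RealState} {κ : List Obs} {es : List Expr}
    (h : ErasedCtxStep m e r κ e' r' es) (hn : e.next = none) :
    ErasedHeadStep m e r κ e' r' es := by
  generalize he : e = e₀ at h
  cases h with
  | mk K h =>
    cases Ctx.eq_nil_of_next_eq_none (hn) h.redex.not_isVal he
    subst he
    exact h

theorem Aborts.eq_abort (h : Aborts e) (hn : e.next = none) : e = .abort := by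
  obtain ⟨K, rfl⟩ := h
  cases Ctx.eq_nil_of_next_eq_none hn redex_abort.not_isVal rfl
  rfl

theorem Aborts.of_next (h : Aborts e) (hn : e.next = some (k, e₁)) : Aborts e₁ := by
  obtain ⟨K, rfl⟩ := h
  cases K with
  | nil => cases hn
  | cons k' K =>
    rw [Ctx.fill_cons, k'.next_fill (Ctx.fill_not_isVal K redex_abort.not_isVal)] at hn
    cases hn
    exact ⟨K, rfl⟩

end

/-! ## Size -/

/-- The size of the code that is executed without a call of a real function. -/
def Expr.size : Expr → ℕ
  | .val _ => 1
  | .var _ => 1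
  -- Bodies of functions do not count, as they run only after a call has been paid for. The constant
  -- exceeds the size of a value, so that evaluating a definition makes the code smaller.
  | .recI _ _ _ _ => 2
  | .recA _ _ _ => 2
  -- The auxiliary argument is evaluated within the step of the call and does not count.
  | .app e₁ e₂ _ => e₁.size + e₂.size + 1
  | .appA e₁ e₂ => e₁.size + e₂.size + 1
  | .unop _ e => e.size + 1
  | .binop _ e₁ e₂ => e₁.size + e₂.size + 1
  | .ite e e₁ e₂ => e.size + e₁.size + e₂.size + 1
  | .pair e₁ e₂ => e₁.size + e₂.size + 1
  | .fst e => e.size + 1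
  | .snd e => e.size + 1
  | .inl e => e.size + 1
  | .inr e => e.size + 1
  | .case e e₁ e₂ => e.size + e₁.size + e₂.size + 1
  | .caseA e e₁ e₂ => e.size + e₁.size + e₂.size + 1
  | .alloc e₁ e₂ => e₁.size + e₂.size + 1
  | .free e => e.size + 1
  | .load e => e.size + 1
  | .store e₁ e₂ => e₁.size + e₂.size + 1
  | .cmpXchg e₁ e₂ e₃ => e₁.size + e₂.size + e₃.size + 1
  | .xchg e₁ e₂ => e₁.size + e₂.size + 1
  | .faa e₁ e₂ => e₁.size + e₂.size + 1
  | .newProph => 2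
  | .resolve e₁ e₂ e₃ => e₁.size + e₂.size + e₃.size + 1
  | .letR _ e₁ e₂ => e₁.size + e₂.size + 1
  -- The constant leaves room for `e₂.thenFinish`, of size `e₂.size + 3`: the new thread, too, must
  -- be smaller than the fork.
  | .fork e₁ e₂ => e₁.size + e₂.size + 10
  | .atomic e => e.size + 1
  | .abort => 2
  | .letA _ _ e₂ => e₂.size + 1
  | .allocA e₁ e₂ => e₁.size + e₂.size + 1
  | .loadA e => e.size + 1
  | .storeA e₁ e₂ => e₁.size + e₂.size + 1
  | .currentThread => 2
  | .finish => 2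
  | .lower e₁ e₂ e₃ e₄ => e₁.size + e₂.size + e₃.size + e₄.size + 1
  | .newSignal e₁ e₂ => e₁.size + e₂.size + 1
  | .setSignal e₁ e₂ => e₁.size + e₂.size + 1
  | .newExpectPerm e₁ e₂ e₃ e₄ => e₁.size + e₂.size + e₃.size + e₄.size + 1
  | .expect e₁ e₂ e₃ => e₁.size + e₂.size + e₃.size + 1

theorem Expr.size_pos (e : Expr) : 0 < e.size := by
  cases e <;> simp [Expr.size]

/-- Variables and values all have size 1, and bodies of function definitions do not count. -/
theorem Expr.size_subst (x : String) (v : Val) (e : Expr) : (e.subst x v).size = e.size := by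
  induction e using Expr.rec (motive_1 := fun _ => True) with
  | letR y e₁ e₂ ih₁ ih₂ => simp only [Expr.subst, Expr.size, ih₁]; split <;> simp [ih₂]
  | letA y e₁ e₂ ih₁ ih₂ => simp only [Expr.subst, Expr.size]; split <;> simp [ih₂]
  | var y => simp only [Expr.subst]; split <;> rfl
  | lit => trivial
  | _ => first | trivial | simp_all [Expr.subst, Expr.size]

theorem Expr.size_substB (b : Binder) (v : Val) (e : Expr) : (e.substB b v).size = e.size := by
  cases b with
  | none => rfl
  | some x => exact e.size_subst x v

theorem CtxItem.size_fill_lt (k : CtxItem) {e e' : Expr} (h : e.size < e'.size) :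
    (k.fill e).size < (k.fill e').size := by
  induction k with
  | resolveL k v₂ v₃ ih => simp only [CtxItem.fill, Expr.size]; omega
  | _ => simp only [CtxItem.fill, Expr.size]; omega

theorem Ctx.size_fill_lt (K : Ctx) {e e' : Expr} (h : e.size < e'.size) :
    (Ctx.fill K e).size < (Ctx.fill K e').size := by
  induction K with
  | nil => exact h
  | cons k K ih => exact k.size_fill_lt ih

theorem CtxItem.size_lt_fill (k : CtxItem) (e : Expr) : e.size < (k.fill e).size := by
  induction k with
  | resolveL k v₂ v₃ ih => simp only [CtxItem.fill, Expr.size]; omega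
  | _ => simp only [CtxItem.fill, Expr.size]; omega

theorem Ctx.size_le_fill (K : Ctx) (e : Expr) : e.size ≤ (Ctx.fill K e).size := by
  induction K with
  | nil => exact le_rfl
  | cons k K ih => exact ih.trans (k.size_lt_fill _).le

theorem PureStep.size_lt {e e' : Expr} (h : PureStep e e') : e'.size < e.size := by
  cases h <;> simp only [Expr.size, Expr.size_substB] <;>
    grind [Expr.size_pos]

theorem HeapStep.size_lt {e e' : Expr} {r r' : RealState} (h : HeapStep e r e' r') :
    e'.size < e.size := by
  cases h <;> simp [Expr.size]

/-! ## Substitution, erasure and the syntactic constraints -/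

mutual
-- The set of auxiliary variables only forbids occurrences, so it may be made smaller.
theorem Operand.anti {A B : Set String} {e : Expr} (hBA : B ⊆ A) :
    Operand A e → Operand B e
  | .val h => .val h
  | .var h => .var fun hx => h (hBA hx)
  | .recI h => .recI (h.anti (by gcongr))
theorem Operation.anti {p : Pos} {A B : Set String} {e : Expr} (hBA : B ⊆ A) :
    Operation p A e → Operation p B e
  | .unop h => .unop (h.anti hBA)
  | .binop h₁ h₂ => .binop (h₁.anti hBA) (h₂.anti hBA)
  | .pair h₁ h₂ => .pair (h₁.anti hBA) (h₂.anti hBA)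
  | .fst h => .fst (h.anti hBA)
  | .snd h => .snd (h.anti hBA)
  | .inl h => .inl (h.anti hBA)
  | .inr h => .inr (h.anti hBA)
  | .free h => .free (h.anti hBA)
  | .load h => .load (h.anti hBA)
  | .store h₁ h₂ => .store (h₁.anti hBA) (h₂.anti hBA)
  | .cmpXchg h₁ h₂ h₃ => .cmpXchg (h₁.anti hBA) (h₂.anti hBA) (h₃.anti hBA)
  | .xchg h₁ h₂ => .xchg (h₁.anti hBA) (h₂.anti hBA)
  | .faa h₁ h₂ => .faa (h₁.anti hBA) (h₂.anti hBA)
  | .alloc hp h₁ h₂ => .alloc hp (h₁.anti hBA) (h₂.anti hBA)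
  | .newProph hp => .newProph hp
  | .resolve h₁ h₂ h₃ => .resolve (h₁.anti hBA) (h₂.anti hBA) (h₃.anti hBA)
  | .app h₁ h₂ h₃ => .app (h₁.anti hBA) (h₂.anti hBA) h₃
  | .case h h₁ h₂ => .case (h.anti hBA) (h₁.anti hBA) (h₂.anti hBA)
  | .forkVal hv h => .forkVal hv (h.anti hBA)
  | .forkVar h => .forkVar (h.anti hBA)
  | .atomic h => .atomic (h.anti hBA)
theorem RealCode.anti {p : Pos} {A B : Set String} {e : Expr} (hBA : B ⊆ A) :
    RealCode p A e → RealCode p B e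
  | .operand h => .operand (h.anti hBA)
  | .operation h => .operation (h.anti hBA)
  | .ite h h₁ h₂ => .ite (h.anti hBA) (h₁.anti hBA) (h₂.anti hBA)
  | .letThread h₁ h₂ => .letThread (h₁.anti hBA) (h₂.anti (by gcongr))
  | .letBlock hp h₁ h₂ => .letBlock hp (h₁.anti hBA) (h₂.anti (by gcongr))
  | .letA h₁ h₂ => .letA h₁ (h₂.anti (by gcongr))
  | .abort => .abort
end

theorem AuxCode.ite_subst {c : Prop} [Decidable c] {e e' : Expr} (h : AuxCode e)
    (h' : AuxCode e') : AuxCode (if c then e else e') := by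
  split <;> assumption

theorem AuxCode.subst {x : String} {v : Val} (hv : AuxVal v) {e : Expr} :
    AuxCode e → AuxCode (e.subst x v)
  | .val h => .val h
  | .var => AuxCode.ite_subst (.val hv) .var
  | .recA h => .recA (ite_subst h (h.subst hv))
  | .appA h₁ h₂ => .appA (h₁.subst hv) (h₂.subst hv)
  | .unop h => .unop (h.subst hv)
  | .binop h₁ h₂ => .binop (h₁.subst hv) (h₂.subst hv)
  | .ite h h₁ h₂ => .ite (h.subst hv) (h₁.subst hv) (h₂.subst hv)
  | .pair h₁ h₂ => .pair (h₁.subst hv) (h₂.subst hv)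
  | .fst h => .fst (h.subst hv)
  | .snd h => .snd (h.subst hv)
  | .inl h => .inl (h.subst hv)
  | .inr h => .inr (h.subst hv)
  | .caseA h h₁ h₂ => .caseA (h.subst hv) (h₁.subst hv) (h₂.subst hv)
  | .load h => .load (h.subst hv)
  | .letR h₁ h₂ => .letR (h₁.subst hv) (ite_subst h₂ (h₂.subst hv))
  | .letA h₁ h₂ => .letA (h₁.subst hv) (ite_subst h₂ (h₂.subst hv))
  | .allocA h₁ h₂ => .allocA (h₁.subst hv) (h₂.subst hv)
  | .loadA h => .loadA (h.subst hv)
  | .storeA h₁ h₂ => .storeA (h₁.subst hv) (h₂.subst hv)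
  | .currentThread => .currentThread
  | .finish => .finish
  | .lower h₁ h₂ h₃ h₄ => .lower (h₁.subst hv) (h₂.subst hv) (h₃.subst hv) (h₄.subst hv)
  | .newSignal h₁ h₂ => .newSignal (h₁.subst hv) (h₂.subst hv)
  | .setSignal h₁ h₂ => .setSignal (h₁.subst hv) (h₂.subst hv)
  | .newExpectPerm h₁ h₂ h₃ h₄ =>
      .newExpectPerm (h₁.subst hv) (h₂.subst hv) (h₃.subst hv) (h₄.subst hv)
  | .expect h₁ h₂ h₃ => .expect (h₁.subst hv) (h₂.subst hv) (h₃.subst hv)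

theorem AuxCode.substB {b : Binder} {v : Val} (hv : AuxVal v) {e : Expr} (h : AuxCode e) :
    AuxCode (e.substB b v) := by
  cases b with
  | none => exact h
  | some x => exact h.subst hv

/-- A value that may be substituted for `x` in real code: an auxiliary value may only be substituted
for auxiliary variables. -/
def SubstVal (A : Set String) (x : String) (v : Val) : Prop := AuxVal v ∧ (x ∉ A → RealVal v)

theorem SubstVal.mono {A B : Set String} {x : String} {v : Val} (h : SubstVal A x v)
    (hAB : x ∈ A → x ∈ B) : SubstVal B x v :=
  ⟨h.1, fun hx => h.2 fun hA => hx (hAB hA)⟩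

mutual
-- Values are closed, so after the substitution `x` no longer occurs free and may be added to the
-- forbidden variables. This bookkeeping pays off in `RealCode.call`, where three substitutions
-- follow each other.
theorem Operand.subst {A : Set String} {x : String} {v : Val} {e : Expr}
    (hv : SubstVal A x v) : Operand A e → Operand (A ∪ {x}) (e.subst x v)
  | .val h => .val h
  | .var (x := y) h => by
    simp only [Expr.subst]
    split
    · next hy => subst hy; exact .val (hv.2 h)
    · next hy => exact .var (by simp [h, hy])
  | .recI (f := f) (x := z) (y := y) h => by
    simp only [Expr.subst]
    refine .recI ?_
    split
    · next hx =>
      refine h.anti fun w hw => ?_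
      simp only [Set.mem_sdiff, Set.mem_union, Set.mem_singleton_iff, Binder.vars,
        Set.mem_ofPred_eq] at hw ⊢
      grind
    · next hx =>
      refine (h.subst (hv.mono fun hA => ?_)).anti fun w hw => ?_
      · simp only [Set.mem_sdiff, Set.mem_union, Binder.vars, Set.mem_ofPred_eq]
        grind
      · simp only [Set.mem_sdiff, Set.mem_union, Set.mem_singleton_iff, Binder.vars,
          Set.mem_ofPred_eq] at hw ⊢
        grind
theorem Operation.subst {p : Pos} {A : Set String} {x : String} {v : Val} {e : Expr}
    (hv : SubstVal A x v) : Operation p A e → Operation p (A ∪ {x}) (e.subst x v)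
  | .unop h => .unop (h.subst hv)
  | .binop h₁ h₂ => .binop (h₁.subst hv) (h₂.subst hv)
  | .pair h₁ h₂ => .pair (h₁.subst hv) (h₂.subst hv)
  | .fst h => .fst (h.subst hv)
  | .snd h => .snd (h.subst hv)
  | .inl h => .inl (h.subst hv)
  | .inr h => .inr (h.subst hv)
  | .free h => .free (h.subst hv)
  | .load h => .load (h.subst hv)
  | .store h₁ h₂ => .store (h₁.subst hv) (h₂.subst hv)
  | .cmpXchg h₁ h₂ h₃ => .cmpXchg (h₁.subst hv) (h₂.subst hv) (h₃.subst hv)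
  | .xchg h₁ h₂ => .xchg (h₁.subst hv) (h₂.subst hv)
  | .faa h₁ h₂ => .faa (h₁.subst hv) (h₂.subst hv)
  | .alloc hp h₁ h₂ => .alloc hp (h₁.subst hv) (h₂.subst hv)
  | .newProph hp => .newProph hp
  | .resolve h₁ h₂ h₃ => .resolve (h₁.subst hv) (h₂.subst hv) (h₃.subst hv)
  | .app h₁ h₂ h₃ => .app (h₁.subst hv) (h₂.subst hv) (h₃.subst hv.1)
  | .case h h₁ h₂ => .case (h.subst hv) (h₁.subst hv) (h₂.subst hv)
  | .forkVal hw h => .forkVal hw (h.subst hv)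
  | .forkVar (x := y) h => by
    simp only [Expr.subst]
    split
    · exact .forkVal hv.1 (h.subst hv)
    · exact .forkVar (h.subst hv)
  | .atomic h => .atomic (h.subst hv)
theorem RealCode.subst {p : Pos} {A : Set String} {x : String} {v : Val} {e : Expr}
    (hv : SubstVal A x v) : RealCode p A e → RealCode p (A ∪ {x}) (e.subst x v)
  | .operand h => .operand (h.subst hv)
  | .operation h => .operation (h.subst hv)
  | .ite h h₁ h₂ => .ite (h.subst hv) (h₁.subst hv) (h₂.subst hv)
  | .letThread (x := y) h₁ h₂ => by
    simp only [Expr.subst]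
    refine .letThread (h₁.subst hv) ?_
    split
    · refine h₂.anti fun w hw => ?_
      simp only [Set.mem_sdiff, Set.mem_union, Set.mem_singleton_iff, Binder.vars,
        Set.mem_ofPred_eq] at hw ⊢
      grind
    · refine (h₂.subst (hv.mono fun hA => ?_)).anti fun w hw => ?_
      all_goals
        simp only [Set.mem_sdiff, Set.mem_union, Set.mem_singleton_iff, Binder.vars,
          Set.mem_ofPred_eq] at *
        grind
  | .letBlock (x := y) hp h₁ h₂ => by
    simp only [Expr.subst]
    refine .letBlock hp (h₁.subst hv) ?_
    split
    · refine h₂.anti fun w hw => ?_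
      simp only [Set.mem_sdiff, Set.mem_union, Set.mem_singleton_iff, Binder.vars,
        Set.mem_ofPred_eq] at hw ⊢
      grind
    · refine (h₂.subst (hv.mono fun hA => ?_)).anti fun w hw => ?_
      all_goals
        simp only [Set.mem_sdiff, Set.mem_union, Set.mem_singleton_iff, Binder.vars,
          Set.mem_ofPred_eq] at *
        grind
  | .letA (x := y) h₁ h₂ => by
    simp only [Expr.subst]
    refine .letA (h₁.subst hv.1) ?_
    split
    · refine h₂.anti fun w hw => ?_
      simp only [Set.mem_union, Set.mem_singleton_iff, Binder.vars,
        Set.mem_ofPred_eq] at hw ⊢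
      grind
    · refine (h₂.subst (hv.mono fun hA => ?_)).anti fun w hw => ?_
      all_goals
        simp only [Set.mem_union, Set.mem_singleton_iff, Binder.vars,
          Set.mem_ofPred_eq] at *
        grind
  | .abort => .abort
end

mutual
/-- Auxiliary variables do not occur in erased code. -/
theorem Operand.subst_erase {A : Set String} {x : String} {w : Val} {e : Expr} (hx : x ∈ A) :
    Operand A e → e.erase.subst x w = e.erase
  | .val h => rfl
  | .var h => by
    simp only [Expr.erase, Expr.subst]
    rw [if_neg]
    rintro rfl
    exact h hx
  | .recI (f := f) (x := z) (y := y) h => by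
    simp only [Expr.erase, Expr.subst]
    split
    · rfl
    · next hn =>
      rw [h.subst_erase]
      simp only [Set.mem_sdiff, Set.mem_union, Binder.vars, Set.mem_ofPred_eq]
      grind
theorem Operation.subst_erase {p : Pos} {A : Set String} {x : String} {w : Val} {e : Expr}
    (hx : x ∈ A) : Operation p A e → e.erase.subst x w = e.erase
  | .unop h => by simp only [Expr.erase, Expr.subst, h.subst_erase hx]
  | .binop h₁ h₂ => by
    simp only [Expr.erase, Expr.subst, h₁.subst_erase hx, h₂.subst_erase hx]
  | .pair h₁ h₂ => by
    simp only [Expr.erase, Expr.subst, h₁.subst_erase hx, h₂.subst_erase hx]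
  | .fst h => by simp only [Expr.erase, Expr.subst, h.subst_erase hx]
  | .snd h => by simp only [Expr.erase, Expr.subst, h.subst_erase hx]
  | .inl h => by simp only [Expr.erase, Expr.subst, h.subst_erase hx]
  | .inr h => by simp only [Expr.erase, Expr.subst, h.subst_erase hx]
  | .free h => by simp only [Expr.erase, Expr.subst, h.subst_erase hx]
  | .load h => by simp only [Expr.erase, Expr.subst, h.subst_erase hx]
  | .store h₁ h₂ => by
    simp only [Expr.erase, Expr.subst, h₁.subst_erase hx, h₂.subst_erase hx]
  | .cmpXchg h₁ h₂ h₃ => by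
    simp only [Expr.erase, Expr.subst, h₁.subst_erase hx, h₂.subst_erase hx, h₃.subst_erase hx]
  | .xchg h₁ h₂ => by
    simp only [Expr.erase, Expr.subst, h₁.subst_erase hx, h₂.subst_erase hx]
  | .faa h₁ h₂ => by
    simp only [Expr.erase, Expr.subst, h₁.subst_erase hx, h₂.subst_erase hx]
  | .alloc hp h₁ h₂ => by
    simp only [Expr.erase, Expr.subst, h₁.subst_erase hx, h₂.subst_erase hx]
  | .newProph hp => rfl
  | .resolve h₁ h₂ h₃ => by
    simp only [Expr.erase, Expr.subst, h₁.subst_erase hx, h₂.subst_erase hx, h₃.subst_erase hx]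
  | .app h₁ h₂ h₃ => by
    simp only [Expr.erase, Expr.subst, h₁.subst_erase hx, h₂.subst_erase hx]
  | .case h h₁ h₂ => by
    simp only [Expr.erase, Expr.subst, h.subst_erase hx, h₁.subst_erase hx, h₂.subst_erase hx]
  | .forkVal hw h => by simp only [Expr.erase, Expr.subst, h.subst_erase hx]
  | .forkVar h => by simp only [Expr.erase, Expr.subst, h.subst_erase hx]
  | .atomic h => by simp only [Expr.erase, Expr.subst, h.subst_erase hx]
theorem RealCode.subst_erase {p : Pos} {A : Set String} {x : String} {w : Val} {e : Expr}
    (hx : x ∈ A) : RealCode p A e → e.erase.subst x w = e.erase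
  | .operand h => h.subst_erase hx
  | .operation h => h.subst_erase hx
  | .ite h h₁ h₂ => by
    simp only [Expr.erase, Expr.subst, h.subst_erase hx, h₁.subst_erase hx, h₂.subst_erase hx]
  | .letThread (x := y) h₁ h₂ => by
    simp only [Expr.erase, Expr.subst, h₁.subst_erase hx]
    split
    · rfl
    · next hn => exact congrArg _ (h₂.subst_erase (show x ∈ _ \ _ from ⟨hx, hn⟩))
  | .letBlock (x := y) hp h₁ h₂ => by
    simp only [Expr.erase, Expr.subst, h₁.subst_erase hx]
    split
    · rfl
    · next hn => exact congrArg _ (h₂.subst_erase (show x ∈ _ \ _ from ⟨hx, hn⟩))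
  | .letA (x := y) h₁ h₂ => by
    simp only [Expr.erase]
    exact h₂.subst_erase (Or.inl hx)
  | .abort => rfl
end

mutual
/-- Erasure commutes with substitution in real code. -/
theorem Operand.erase_subst {A : Set String} {x : String} {v : Val} {e : Expr} :
    Operand A e → (e.subst x v).erase = e.erase.subst x v.erase
  | .val h => rfl
  | .var h => by
    simp only [Expr.erase, Expr.subst]
    split <;> rfl
  | .recI (f := f) (x := z) (y := y) h => by
    simp only [Expr.erase, Expr.subst]
    by_cases hfz : f = some x ∨ z = some x
    · rw [if_pos (by tauto), if_pos (by tauto)]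
    · rw [if_neg (c := _ ∨ _ ∨ none = some x) (by simp; tauto)]
      split
      -- Here `x` is the auxiliary parameter: substitution stops at the instrumented function but
      -- enters the erased one, whose parameter is anonymous. The erased body does not contain `x`,
      -- so nothing changes.
      · next hn =>
        rw [h.subst_erase]
        simp only [Set.mem_sdiff, Set.mem_union, Binder.vars, Set.mem_ofPred_eq]
        grind
      · rw [h.erase_subst]
theorem Operation.erase_subst {p : Pos} {A : Set String} {x : String} {v : Val} {e : Expr} :
    Operation p A e → (e.subst x v).erase = e.erase.subst x v.erase
  | .unop h => by simp only [Expr.erase, Expr.subst, h.erase_subst]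
  | .binop h₁ h₂ => by simp only [Expr.erase, Expr.subst, h₁.erase_subst, h₂.erase_subst]
  | .pair h₁ h₂ => by simp only [Expr.erase, Expr.subst, h₁.erase_subst, h₂.erase_subst]
  | .fst h => by simp only [Expr.erase, Expr.subst, h.erase_subst]
  | .snd h => by simp only [Expr.erase, Expr.subst, h.erase_subst]
  | .inl h => by simp only [Expr.erase, Expr.subst, h.erase_subst]
  | .inr h => by simp only [Expr.erase, Expr.subst, h.erase_subst]
  | .free h => by simp only [Expr.erase, Expr.subst, h.erase_subst]
  | .load h => by simp only [Expr.erase, Expr.subst, h.erase_subst]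
  | .store h₁ h₂ => by simp only [Expr.erase, Expr.subst, h₁.erase_subst, h₂.erase_subst]
  | .cmpXchg h₁ h₂ h₃ => by
    simp only [Expr.erase, Expr.subst, h₁.erase_subst, h₂.erase_subst, h₃.erase_subst]
  | .xchg h₁ h₂ => by simp only [Expr.erase, Expr.subst, h₁.erase_subst, h₂.erase_subst]
  | .faa h₁ h₂ => by simp only [Expr.erase, Expr.subst, h₁.erase_subst, h₂.erase_subst]
  | .alloc hp h₁ h₂ => by simp only [Expr.erase, Expr.subst, h₁.erase_subst, h₂.erase_subst]
  | .newProph hp => rfl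
  | .resolve h₁ h₂ h₃ => by
    simp only [Expr.erase, Expr.subst, h₁.erase_subst, h₂.erase_subst, h₃.erase_subst]
  | .app h₁ h₂ h₃ => by simp only [Expr.erase, Expr.subst, h₁.erase_subst, h₂.erase_subst]
  | .case h h₁ h₂ => by
    simp only [Expr.erase, Expr.subst, h.erase_subst, h₁.erase_subst, h₂.erase_subst]
  | .forkVal hw h => by simp only [Expr.erase, Expr.subst, h.erase_subst]
  | .forkVar h => by simp only [Expr.erase, Expr.subst, h.erase_subst]
  | .atomic h => by simp only [Expr.erase, Expr.subst, h.erase_subst]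
theorem RealCode.erase_subst {p : Pos} {A : Set String} {x : String} {v : Val} {e : Expr} :
    RealCode p A e → (e.subst x v).erase = e.erase.subst x v.erase
  | .operand h => h.erase_subst
  | .operation h => h.erase_subst
  | .ite h h₁ h₂ => by
    simp only [Expr.erase, Expr.subst, h.erase_subst, h₁.erase_subst, h₂.erase_subst]
  | .letThread (x := y) h₁ h₂ => by
    simp only [Expr.erase, Expr.subst, h₁.erase_subst]
    split
    · rfl
    · rw [h₂.erase_subst]
  | .letBlock (x := y) hp h₁ h₂ => by
    simp only [Expr.erase, Expr.subst, h₁.erase_subst]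
    split
    · rfl
    · rw [h₂.erase_subst]
  | .letA (x := y) h₁ h₂ => by
    simp only [Expr.erase, Expr.subst]
    split
    -- The let that binds `x` disappears in the erasure, so substitution enters the erased body. It
    -- has no effect there, since `x` is auxiliary.
    · next hy => rw [h₂.subst_erase (Or.inr hy)]
    · rw [h₂.erase_subst]
  | .abort => rfl
end

theorem RealCode.substB {p : Pos} {A : Set String} {b : Binder} {v : Val} {e : Expr}
    (h : RealCode p A e) (hv : AuxVal v) (hv' : ¬ b.vars ⊆ A → RealVal v) :
    RealCode p (A ∪ b.vars) (e.substB b v) := by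
  cases b with
  | none => exact h.anti (by simp [Binder.vars])
  | some x =>
    refine (h.subst (x := x) ⟨hv, fun hx => hv' fun hA => hx (hA rfl)⟩).anti ?_
    intro w hw
    simpa [Binder.vars, eq_comm] using hw

theorem RealCode.erase_substB {p : Pos} {A : Set String} {b : Binder} {v : Val} {e : Expr}
    (h : RealCode p A e) : (e.substB b v).erase = e.erase.substB b v.erase := by
  cases b with
  | none => rfl
  | some x => exact h.erase_subst

theorem RealCode.erase_substB_of_subset {p : Pos} {A : Set String} {b : Binder} {v : Val}
    {e : Expr} (h : RealCode p A e) (hb : b.vars ⊆ A) : (e.substB b v).erase = e.erase := by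
  cases b with
  | none => rfl
  | some x => exact h.erase_subst.trans (h.subst_erase (hb rfl))

/-- The body of a real function whose call is evaluated. -/
theorem RealCode.call {f x y : Binder} {e : Expr} {v v' : Val}
    (h : RealCode .thread ((y.vars \ x.vars) \ f.vars) e) (hv : RealVal v) (hv' : AuxVal v') :
    RealCode .thread ∅ (((e.substB f (.recI f x y e)).substB x v).substB y v') ∧
      (((e.substB f (.recI f x y e)).substB x v).substB y v').erase =
        (e.erase.substB f (Val.recI f x y e).erase).substB x v.erase := by
  have h₁ := h.substB (b := f) (v := .recI f x y e) (.real (.recI h)) fun _ => .recI h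
  have h₂ := h₁.substB (b := x) (.real hv) fun _ => hv
  -- The auxiliary parameter either is forbidden from the start or coincides with `f` or `x`, which
  -- have been substituted already. In each case substituting the auxiliary argument cannot be seen
  -- in the erasure.
  have hy : y.vars ⊆ (y.vars \ x.vars) \ f.vars ∪ f.vars ∪ x.vars := by
    intro w hw
    by_cases hwf : w ∈ f.vars <;> by_cases hwx : w ∈ x.vars <;> simp [*]
  refine ⟨(h₂.substB (b := y) hv' fun hn => (hn hy).elim).anti (Set.empty_subset _), ?_⟩
  rw [h₂.erase_substB_of_subset hy, h₁.erase_substB, h.erase_substB]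

/-! ## Auxiliary code -/

/-- The auxiliary heap covers at most the real heap and purely auxiliary addresses, and the heaps
hold values of the right kind. -/
structure State.HeapOK (σ : State) : Prop where
  heap : ∀ l v, σ.heap l = some v → RealVal v
  heapA : ∀ l v, σ.heapA l = some v → AuxVal v
  -- Instrumented allocation needs addresses that are fresh in both heaps. Through this field, an
  -- address that the erased program may choose is also available to the instrumented program.
  dom : ∀ n, σ.heap (.real n) = none → σ.heapA (.real n) = none

theorem RealVal.pair_inv {v w : Val} (h : RealVal (.pair v w)) : RealVal v ∧ RealVal w := by
  cases h with
  | pair h₁ h₂ => exact ⟨h₁, h₂⟩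

theorem RealVal.inl_inv {v : Val} (h : RealVal (.inl v)) : RealVal v := by
  cases h with
  | inl h => exact h

theorem RealVal.inr_inv {v : Val} (h : RealVal (.inr v)) : RealVal v := by
  cases h with
  | inr h => exact h

theorem AuxVal.pair_inv {v w : Val} (h : AuxVal (.pair v w)) : AuxVal v ∧ AuxVal w := by
  cases h with
  | real h => exact ⟨.real h.pair_inv.1, .real h.pair_inv.2⟩
  | pair h₁ h₂ => exact ⟨h₁, h₂⟩

theorem AuxVal.inl_inv {v : Val} (h : AuxVal (.inl v)) : AuxVal v := by
  cases h with
  | real h => exact .real h.inl_inv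
  | inl h => exact h

theorem AuxVal.inr_inv {v : Val} (h : AuxVal (.inr v)) : AuxVal v := by
  cases h with
  | real h => exact .real h.inr_inv
  | inr h => exact h

theorem AuxVal.recA_inv {f x : Binder} {e : Expr} (h : AuxVal (.recA f x e)) : AuxCode e := by
  cases h with
  | real h => cases h
  | recA h => exact h

theorem AuxCode.val_inv {v : Val} (h : AuxCode (.val v)) : AuxVal v := by
  cases h with
  | val h => exact h

theorem AuxCode.fill_inv {k : CtxItem} {e : Expr} (h : AuxCode (k.fill e)) :
    AuxCode e ∧ ∀ e', AuxCode e' → AuxCode (k.fill e') := by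
  cases k <;> cases h <;> refine ⟨by assumption, fun e' h' => ?_⟩ <;> constructor <;> assumption

theorem AuxCode.ctx_fill_inv {K : Ctx} {e : Expr} (h : AuxCode (K.fill e)) :
    AuxCode e ∧ ∀ e', AuxCode e' → AuxCode (K.fill e') := by
  induction K with
  | nil => exact ⟨h, fun _ h => h⟩
  | cons k K ih =>
    obtain ⟨h₁, h₂⟩ := fill_inv (k := k) h
    exact ⟨(ih h₁).1, fun e' h' => h₂ _ ((ih h₁).2 e' h')⟩

theorem UnOpEval.lit {o : UnOp} {v w : Val} (h : UnOpEval o v w) : ∃ l, w = .lit l := by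
  cases h <;> exact ⟨_, rfl⟩

theorem BinOpEval.lit {o : BinOp} {v₁ v₂ w : Val} (h : BinOpEval o v₁ v₂ w) :
    ∃ l, w = .lit l := by
  cases h <;> exact ⟨_, rfl⟩

theorem PureStep.auxCode {e e' : Expr} (h : PureStep e e') (he : AuxCode e) : AuxCode e' := by
  cases h with
  | recI => cases he
  | recA =>
    cases he with
    | recA he => exact .val (.recA he)
  | pair =>
    cases he with
    | pair h₁ h₂ => exact .val (.pair h₁.val_inv h₂.val_inv)
  | inl =>
    cases he with
    | inl h => exact .val (.inl h.val_inv)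
  | inr =>
    cases he with
    | inr h => exact .val (.inr h.val_inv)
  | unop _ _ _ h =>
    obtain ⟨l, rfl⟩ := h.lit
    exact .val .lit
  | binop _ _ _ _ h =>
    obtain ⟨l, rfl⟩ := h.lit
    exact .val .lit
  | iteTrue =>
    cases he with
    | ite h h₁ h₂ => exact h₁
  | iteFalse =>
    cases he with
    | ite h h₁ h₂ => exact h₂
  | fst =>
    cases he with
    | fst h => exact .val h.val_inv.pair_inv.1
  | snd =>
    cases he with
    | snd h => exact .val h.val_inv.pair_inv.2
  | caseInl => cases he
  | caseInr => cases he
  | caseAInl =>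
    cases he with
    | caseA h h₁ h₂ => exact .appA h₁ (.val h.val_inv.inl_inv)
  | caseAInr =>
    cases he with
    | caseA h h₁ h₂ => exact .appA h₂ (.val h.val_inv.inr_inv)
  | letR =>
    cases he with
    | letR h₁ h₂ => exact h₂.substB h₁.val_inv

theorem State.HeapOK.update_heapA {σ : State} (h : σ.HeapOK) {l : Loc} {v w : Val}
    (hl : σ.heapA l = some v) (hw : AuxVal w) :
    State.HeapOK { σ with heapA := Function.update σ.heapA l (some w) } where
  heap := h.heap
  heapA l' v' hv' := by
    dsimp only [Function.update_apply] at hv'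
    rw [Function.update_apply] at hv'
    split at hv'
    · cases hv'; exact hw
    · exact h.heapA _ _ hv'
  dom n hn := by
    dsimp only
    rw [Function.update_apply]
    split
    -- A store needs an existing auxiliary cell, and at a real address there is one only if the real
    -- cell exists.
    · next hnl =>
      rw [← hnl, h.dom n hn] at hl
      cases hl
    · exact h.dom n hn

theorem State.HeapOK.fillRange_heapA {σ : State} (h : σ.HeapOK) {n z : ℤ} {v : Val}
    (hv : AuxVal v) :
    State.HeapOK { σ with heapA := fillRange σ.heapA (.aux n) z v } where
  heap := h.heap
  heapA l' v' hv' := by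
    dsimp only [fillRange] at hv'
    split at hv'
    · cases hv'; exact hv
    · exact h.heapA _ _ hv'
  dom n hn := by
    dsimp only [fillRange]
    rw [if_neg]
    · exact h.dom n hn
    · rintro ⟨i, -, -, hi⟩
      simp [Loc.add] at hi

theorem State.HeapOK.of_eq {σ σ' : State} (h : σ.HeapOK) (h₁ : σ'.heap = σ.heap)
    (h₂ : σ'.heapA = σ.heapA) : σ'.HeapOK where
  heap := h₁ ▸ h.heap
  heapA := h₂ ▸ h.heapA
  dom := by rw [h₁, h₂]; exact h.dom

mutual
-- The only access of auxiliary code to the real state is `load`, and the heap holds real values.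
-- The statement is mutual with the one on big steps because auxiliary calls and lets evaluate
-- further auxiliary code inside one step.
theorem HeadStep.auxCode {P : Params} {t : ℕ} {m : Mode} {e e' : Expr} {σ σ' : State}
    {κ : List Obs} {es : List (ℕ × Expr)} (he : AuxCode e) (hσ : σ.HeapOK) :
    HeadStep P t m e σ κ e' σ' es →
      AuxCode e' ∧ σ'.HeapOK ∧ σ'.toRealState = σ.toRealState
  | .pure h => ⟨h.auxCode he, hσ, rfl⟩
  | .heap h => by
    cases h with
    | load l v r hl => exact ⟨.val (.real (hσ.heap _ _ hl)), hσ, rfl⟩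
    | _ => cases he
  | .betaA h₁ h₂ => by
    cases he with
    | appA he₁ he₂ =>
      have hf := he₁.val_inv
      obtain ⟨hv, hσ', hr⟩ := BigStep.auxCode he₂ hσ h₁
      obtain ⟨hv', hσ'', hr'⟩ := BigStep.auxCode ((hf.recA_inv.substB hf).substB hv) hσ' h₂
      exact ⟨.val hv', hσ'', hr'.trans hr⟩
  | .letA h => by
    cases he with
    | letA he₁ he₂ =>
      obtain ⟨hv, hσ', hr⟩ := BigStep.auxCode he₁ hσ h
      exact ⟨he₂.substB hv, hσ', hr⟩
  | .allocA _ _ _ => by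
    cases he with
    | allocA _ he₂ => exact ⟨.val .lit, hσ.fillRange_heapA he₂.val_inv, rfl⟩
  | .loadA h => ⟨.val (hσ.heapA _ _ h), hσ, rfl⟩
  | .storeA h => by
    cases he with
    | storeA _ he₂ => exact ⟨.val .lit, hσ.update_heapA h he₂.val_inv, rfl⟩
  | .currentThread => ⟨.val .lit, hσ, rfl⟩
  | .finish _ => ⟨.val .lit, hσ.of_eq rfl rfl, rfl⟩
  | .lower _ _ => ⟨.val .lit, hσ.of_eq rfl rfl, rfl⟩
  | .newSignal _ _ => ⟨.val .lit, hσ.of_eq rfl rfl, rfl⟩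
  | .setSignal _ _ _ => ⟨.val .lit, hσ.of_eq rfl rfl, rfl⟩
  | .newExpectPerm _ _ _ _ => ⟨.val .lit, hσ.of_eq rfl rfl, rfl⟩
  | .expect _ _ _ _ _ _ => ⟨.val .lit, hσ.of_eq rfl rfl, rfl⟩
  | .alloc _ _ _ => nomatch he
  | .free _ => nomatch he
  | .resolve _ => nomatch he
  | .beta _ _ _ _ => nomatch he
  | .atomic _ => nomatch he
  | .fork _ _ _ _ => nomatch he
/-- Evaluation of auxiliary code keeps the real state. -/
theorem BigStep.auxCode {P : Params} {t : ℕ} {e : Expr} {v : Val} {σ σ' : State}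
    (he : AuxCode e) (hσ : σ.HeapOK) :
    BigStep P t e σ v σ' → AuxVal v ∧ σ'.HeapOK ∧ σ'.toRealState = σ.toRealState
  | .done => ⟨he.val_inv, hσ, rfl⟩
  | .step hK h₁ h₂ => by
    subst hK
    obtain ⟨he', hK⟩ := he.ctx_fill_inv
    obtain ⟨he'', hσ', hr⟩ := HeadStep.auxCode he' hσ h₁
    obtain ⟨hv, hσ'', hr'⟩ := BigStep.auxCode (hK _ he'') hσ' h₂
    exact ⟨hv, hσ'', hr'.trans hr⟩
end

/-! ## Matching of basic operations -/

theorem Val.erase_eq_lit {v : Val} {l : Lit} (h : v.erase = .lit l) : v = .lit l := by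
  cases v <;> simp_all [Val.erase]

theorem Val.erase_eq_pair {v a b : Val} (h : v.erase = .pair a b) :
    ∃ a' b', v = .pair a' b' ∧ a'.erase = a ∧ b'.erase = b := by
  cases v <;> simp_all [Val.erase]

theorem Val.erase_eq_inl {v a : Val} (h : v.erase = .inl a) : ∃ a', v = .inl a' ∧ a'.erase = a := by
  cases v <;> simp_all [Val.erase]

theorem Val.erase_eq_inr {v a : Val} (h : v.erase = .inr a) : ∃ a', v = .inr a' ∧ a'.erase = a := by
  cases v <;> simp_all [Val.erase]

theorem Val.erase_lit (l : Lit) : (Val.lit l).erase = .lit l := by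
  simp [Val.erase]

theorem ValCompareSafe.cases {v : Val} (h : ValCompareSafe v) :
    ∃ l, v = .lit l ∨ v = .inl (.lit l) ∨ v = .inr (.lit l) := by
  unfold ValCompareSafe at h
  split at h <;> simp_all

/-- Erasure may identify different functions, but values that are safe to compare are literals under
at most one injection, and on these erasure is injective. As a legal comparison involves such a
value, its answer survives erasure. -/
theorem ValCompareSafe.eq_of_erase {v w : Val} (h : ValCompareSafe v.erase)
    (hvw : v.erase = w.erase) : v = w := by
  obtain ⟨l, hl | hl | hl⟩ := h.cases
  · rw [Val.erase_eq_lit hl, Val.erase_eq_lit (hvw.symm.trans hl)]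
  · obtain ⟨a, rfl, ha⟩ := Val.erase_eq_inl hl
    obtain ⟨b, rfl, hb⟩ := Val.erase_eq_inl (hvw.symm.trans hl)
    rw [Val.erase_eq_lit ha, Val.erase_eq_lit hb]
  · obtain ⟨a, rfl, ha⟩ := Val.erase_eq_inr hl
    obtain ⟨b, rfl, hb⟩ := Val.erase_eq_inr (hvw.symm.trans hl)
    rw [Val.erase_eq_lit ha, Val.erase_eq_lit hb]

theorem ValCompareSafe.of_erase {v : Val} (h : ValCompareSafe v.erase) : ValCompareSafe v := by
  have h' := h
  obtain ⟨l, hl | hl | hl⟩ := h.cases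
  · rw [hl] at h'; rwa [Val.erase_eq_lit hl]
  · obtain ⟨a, rfl, ha⟩ := Val.erase_eq_inl hl
    rw [hl] at h'; rwa [Val.erase_eq_lit ha]
  · obtain ⟨a, rfl, ha⟩ := Val.erase_eq_inr hl
    rw [hl] at h'; rwa [Val.erase_eq_lit ha]

theorem ValEq.of_erase {v w : Val} (h : ValEq v.erase w.erase) : ValEq v w := by
  obtain ⟨h₁, h₂⟩ := h
  refine ⟨?_, h₂.imp .of_erase .of_erase⟩
  rw [← h₁, or_self] at h₂
  exact h₂.eq_of_erase h₁

theorem ValNe.of_erase {v w : Val} (h : ValNe v.erase w.erase) : ValNe v w :=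
  ⟨fun hvw => h.1 (hvw ▸ rfl), h.2.imp .of_erase .of_erase⟩

theorem UnOpEval.of_erase {o : UnOp} {v w : Val} (h : UnOpEval o v.erase w) :
    UnOpEval o v w ∧ RealVal w ∧ w.erase = w := by
  generalize hv' : v.erase = v' at h
  cases h <;> cases Val.erase_eq_lit hv' <;>
    exact ⟨by constructor, .lit trivial, Val.erase_lit _⟩

theorem BinOpEval.of_erase {o : BinOp} {v₁ v₂ w : Val} (hv₁ : RealVal v₁)
    (h : BinOpEval o v₁.erase v₂.erase w) :
    BinOpEval o v₁ v₂ w ∧ RealVal w ∧ w.erase = w := by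
  generalize hv₁' : v₁.erase = v₁' at h
  generalize hv₂' : v₂.erase = v₂' at h
  cases h with
  | eqTrue _ _ h =>
    subst hv₁' hv₂'
    exact ⟨.eqTrue _ _ h.of_erase, .lit trivial, Val.erase_lit _⟩
  | eqFalse _ _ h =>
    subst hv₁' hv₂'
    exact ⟨.eqFalse _ _ h.of_erase, .lit trivial, Val.erase_lit _⟩
  -- The only operation that yields an address; the address is real because the one it starts from
  -- is.
  | ptrAdd l z =>
    cases Val.erase_eq_lit hv₁'
    cases Val.erase_eq_lit hv₂'
    refine ⟨.ptrAdd l z, .lit ?_, Val.erase_lit _⟩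
    cases hv₁ with
    | lit h =>
      cases l with
      | real n => trivial
      | aux n => exact h
  | _ =>
    cases Val.erase_eq_lit hv₁'
    cases Val.erase_eq_lit hv₂'
    exact ⟨by constructor <;> assumption, .lit trivial, Val.erase_lit _⟩

/-- The erased state `r` is the erasure of the state `σ`. -/
structure Sim (σ : State) (r : RealState) : Prop where
  heapOK : σ.HeapOK
  heap : ∀ l, r.heap l = (σ.heap l).map Val.erase
  prophs : r.prophs = σ.prophs

section
variable {σ : State} {r : RealState}

theorem Sim.of_eq {σ' : State} (h : Sim σ r) (h' : σ'.HeapOK)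
    (hr : σ'.toRealState = σ.toRealState) : Sim σ' r where
  heapOK := h'
  heap := hr ▸ h.heap
  prophs := hr ▸ h.prophs

theorem Sim.exists_heap (h : Sim σ r) {l : Loc} {v : Val} (hl : r.heap l = some v) :
    ∃ v', σ.heap l = some v' ∧ RealVal v' ∧ v'.erase = v := by
  rw [h.heap, Option.map_eq_some_iff] at hl
  obtain ⟨v', hv', hv⟩ := hl
  exact ⟨v', hv', h.heapOK.heap _ _ hv', hv⟩

theorem Sim.update (h : Sim σ r) {l : Loc} {w w' : Val}
    (hw : RealVal w) (hw' : w.erase = w') :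
    Sim { σ with heap := Function.update σ.heap l (some w) }
      { r with heap := Function.update r.heap l (some w') } where
  heapOK :=
    { heap := fun k u hu => by
        dsimp only at hu
        rw [Function.update_apply] at hu
        split at hu
        · cases hu; exact hw
        · exact h.heapOK.heap _ _ hu
      heapA := h.heapOK.heapA
      dom := fun n hn => by
        dsimp only at hn
        rw [Function.update_apply] at hn
        split at hn
        · cases hn
        · exact h.heapOK.dom n hn }
  heap k := by
    dsimp only
    rw [Function.update_apply, Function.update_apply]
    split
    · rw [Option.map_some, hw']
    · exact h.heap k
  prophs := h.prophs

theorem Sim.alloc (h : Sim σ r) {n z : ℤ} {v v' : Val} (hv : RealVal v) (hv' : v.erase = v') :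
    Sim { σ with
          heap := fillRange σ.heap (.real n) z v
          heapA := fillRange σ.heapA (.real n) z (.int 0) }
      { r with heap := fillRange r.heap (.real n) z v' } where
  heapOK :=
    { heap := fun k u hu => by
        dsimp only [fillRange] at hu
        split at hu
        · cases hu; exact hv
        · exact h.heapOK.heap _ _ hu
      heapA := fun k u hu => by
        dsimp only [fillRange] at hu
        split at hu
        · cases hu; exact .lit
        · exact h.heapOK.heapA _ _ hu
      dom := fun k hk => by
        dsimp only [fillRange] at hk ⊢
        split at hk
        · cases hk
        · next hn => rw [if_neg hn]; exact h.heapOK.dom k hk }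
  heap k := by
    dsimp only [fillRange]
    split
    · rw [Option.map_some, hv']
    · exact h.heap k
  prophs := h.prophs

theorem Sim.free (h : Sim σ r) (l : Loc) :
    Sim { σ with
          heap := Function.update σ.heap l none
          heapA := Function.update σ.heapA l none }
      { r with heap := Function.update r.heap l none } where
  heapOK :=
    { heap := fun k u hu => by
        dsimp only at hu
        rw [Function.update_apply] at hu
        split at hu
        · cases hu
        · exact h.heapOK.heap _ _ hu
      heapA := fun k u hu => by
        dsimp only at hu
        rw [Function.update_apply] at hu
        split at hu
        · cases hu
        · exact h.heapOK.heapA _ _ hu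
      dom := fun k hk => by
        dsimp only at hk ⊢
        rw [Function.update_apply] at hk ⊢
        split
        · rfl
        · next hn => rw [if_neg hn] at hk; exact h.heapOK.dom k hk }
  heap k := by
    dsimp only
    rw [Function.update_apply, Function.update_apply]
    split
    · rfl
    · exact h.heap k
  prophs := h.prophs

theorem Sim.newProph (h : Sim σ r) (p : ℤ) :
    Sim { σ with prophs := insert p σ.prophs } { r with prophs := insert p r.prophs } where
  heapOK := h.heapOK.of_eq rfl rfl
  heap := h.heap
  prophs := by rw [h.prophs]

end

/-- An operand that is not a value is evaluated before the operation. When nothing is due in a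
context, the operands are therefore recognised as values one after the other, from right to left. -/
theorem nextIn_eq_none {A : Set String} {e : Expr} {k : CtxItem}
    {c : Val → Option (CtxItem × Expr)} (he : Operand A e) (h : nextIn e k c = none) :
    ∃ v, e = .val v ∧ RealVal v ∧ c v = none := by
  cases he with
  | val hv => exact ⟨_, rfl, hv, h⟩
  | var => cases h
  | recI => cases h

/-- The operations that are allowed in atomic blocks. -/
inductive BasicRedex : Expr → Prop
  | unop {o : UnOp} {v : Val} : RealVal v → BasicRedex (.unop o (.val v))
  | binop {o : BinOp} {v₁ v₂ : Val} : RealVal v₁ → RealVal v₂ →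
      BasicRedex (.binop o (.val v₁) (.val v₂))
  | pair {v₁ v₂ : Val} : RealVal v₁ → RealVal v₂ → BasicRedex (.pair (.val v₁) (.val v₂))
  | fst {v : Val} : RealVal v → BasicRedex (.fst (.val v))
  | snd {v : Val} : RealVal v → BasicRedex (.snd (.val v))
  | inl {v : Val} : RealVal v → BasicRedex (.inl (.val v))
  | inr {v : Val} : RealVal v → BasicRedex (.inr (.val v))
  | free {v : Val} : RealVal v → BasicRedex (.free (.val v))
  | load {v : Val} : RealVal v → BasicRedex (.load (.val v))
  | store {v₁ v₂ : Val} : RealVal v₁ → RealVal v₂ → BasicRedex (.store (.val v₁) (.val v₂))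
  | cmpXchg {v₁ v₂ v₃ : Val} : RealVal v₁ → RealVal v₂ → RealVal v₃ →
      BasicRedex (.cmpXchg (.val v₁) (.val v₂) (.val v₃))
  | xchg {v₁ v₂ : Val} : RealVal v₁ → RealVal v₂ → BasicRedex (.xchg (.val v₁) (.val v₂))
  | faa {v₁ v₂ : Val} : RealVal v₁ → RealVal v₂ → BasicRedex (.faa (.val v₁) (.val v₂))
  | alloc {v₁ v₂ : Val} : RealVal v₁ → RealVal v₂ → BasicRedex (.alloc (.val v₁) (.val v₂))
  | newProph : BasicRedex .newProph
  | recI {f x y : Binder} {e : Expr} : RealVal (.recI f x y e) → BasicRedex (.recI f x y e)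

/-- A basic operation of the instrumented language makes the step of its erasure. -/
theorem BasicRedex.simulate {P : Params} {t : ℕ} {m : Mode} {R e : Expr} {σ : State}
    {r r' : RealState} {κ : List Obs} {es : List Expr} (hR : BasicRedex R) (hs : Sim σ r)
    (h : ErasedHeadStep m R.erase r κ e r' es) :
    ∃ v σ', HeadStep P t m R σ [] (.val v) σ' [] ∧ RealVal v ∧ e = .val v.erase ∧ Sim σ' r' ∧
      κ = [] ∧ es = [] := by
  cases hR with
  | @unop o v hv =>
    simp only [Expr.erase] at h
    generalize hv' : v.erase = v' at h
    cases h with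
    | heap h => cases h
    | pure h =>
      cases h with
      | unop _ _ w h =>
        subst hv'
        obtain ⟨h₁, h₂, h₃⟩ := h.of_erase
        exact ⟨w, σ, .pure (.unop _ _ _ h₁), h₂, by rw [h₃], hs, rfl, rfl⟩
  | @binop o v w hv hw =>
    simp only [Expr.erase] at h
    generalize hv' : v.erase = v' at h
    generalize hw' : w.erase = w' at h
    cases h with
    | heap h => cases h
    | pure h =>
      cases h with
      | binop _ _ _ u h =>
        subst hv' hw'
        obtain ⟨h₁, h₂, h₃⟩ := h.of_erase hv
        exact ⟨u, σ, .pure (.binop _ _ _ _ h₁), h₂, by rw [h₃], hs, rfl, rfl⟩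
  | @pair v w hv hw =>
    simp only [Expr.erase] at h
    generalize hv' : v.erase = v' at h
    generalize hw' : w.erase = w' at h
    cases h with
    | heap h => cases h
    | pure h =>
      cases h with
      | pair =>
        subst hv' hw'
        exact ⟨_, σ, .pure (.pair _ _), .pair hv hw, by simp only [Val.erase], hs, rfl, rfl⟩
  | @fst v hv =>
    simp only [Expr.erase] at h
    generalize hv' : v.erase = v' at h
    cases h with
    | heap h => cases h
    | pure h =>
      cases h with
      | fst =>
        obtain ⟨a, b, rfl, rfl, rfl⟩ := Val.erase_eq_pair hv'
        exact ⟨_, σ, .pure (.fst _ _), hv.pair_inv.1, rfl, hs, rfl, rfl⟩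
  | @snd v hv =>
    simp only [Expr.erase] at h
    generalize hv' : v.erase = v' at h
    cases h with
    | heap h => cases h
    | pure h =>
      cases h with
      | snd =>
        obtain ⟨a, b, rfl, rfl, rfl⟩ := Val.erase_eq_pair hv'
        exact ⟨_, σ, .pure (.snd _ _), hv.pair_inv.2, rfl, hs, rfl, rfl⟩
  | @inl v hv =>
    simp only [Expr.erase] at h
    generalize hv' : v.erase = v' at h
    cases h with
    | heap h => cases h
    | pure h =>
      cases h with
      | inl =>
        subst hv'
        exact ⟨_, σ, .pure (.inl _), .inl hv, by simp only [Val.erase], hs, rfl, rfl⟩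
  | @inr v hv =>
    simp only [Expr.erase] at h
    generalize hv' : v.erase = v' at h
    cases h with
    | heap h => cases h
    | pure h =>
      cases h with
      | inr =>
        subst hv'
        exact ⟨_, σ, .pure (.inr _), .inr hv, by simp only [Val.erase], hs, rfl, rfl⟩
  | @free v hv =>
    simp only [Expr.erase] at h
    generalize hv' : v.erase = v' at h
    cases h with
    | heap h => cases h
    | pure h => cases h
    | free h =>
      cases Val.erase_eq_lit hv'
      obtain ⟨u, hu, -, -⟩ := hs.exists_heap h
      exact ⟨_, _, .free hu, .lit trivial, by rw [Val.erase_lit], hs.free _, rfl, rfl⟩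
  | @load v hv =>
    simp only [Expr.erase] at h
    generalize hv' : v.erase = v' at h
    cases h with
    | pure h => cases h
    | heap h =>
      cases h with
      | load _ _ _ h =>
        cases Val.erase_eq_lit hv'
        obtain ⟨u, hu, hu', rfl⟩ := hs.exists_heap h
        exact ⟨u, _, .heap (.load _ _ _ hu), hu', rfl, hs, rfl, rfl⟩
  | @store v w hv hw =>
    simp only [Expr.erase] at h
    generalize hv' : v.erase = v' at h
    generalize hw' : w.erase = w' at h
    cases h with
    | pure h => cases h
    | heap h =>
      cases h with
      | store _ _ _ _ h =>
        cases Val.erase_eq_lit hv'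
        obtain ⟨u, hu, -, -⟩ := hs.exists_heap h
        exact ⟨_, _, .heap (.store _ _ _ _ hu), .lit trivial, by rw [Val.erase_lit],
          hs.update hw hw', rfl, rfl⟩
  | @cmpXchg v w u hv hw hu =>
    simp only [Expr.erase] at h
    generalize hv' : v.erase = v' at h
    generalize hw' : w.erase = w' at h
    generalize hu' : u.erase = u' at h
    cases h with
    | pure h => cases h
    | heap h =>
      cases h with
      | cmpXchgTrue _ _ _ _ _ h he =>
        cases Val.erase_eq_lit hv'
        obtain ⟨a, ha, har, rfl⟩ := hs.exists_heap h
        subst hw'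
        exact ⟨_, _, .heap (.cmpXchgTrue _ _ _ _ _ ha he.of_erase), .pair har (.lit trivial),
          by simp only [Val.erase], hs.update hu hu', rfl, rfl⟩
      | cmpXchgFalse _ _ _ _ _ h he =>
        cases Val.erase_eq_lit hv'
        obtain ⟨a, ha, har, rfl⟩ := hs.exists_heap h
        subst hw'
        exact ⟨_, _, .heap (.cmpXchgFalse _ _ _ _ _ ha he.of_erase), .pair har (.lit trivial),
          by simp only [Val.erase], hs, rfl, rfl⟩
  | @xchg v w hv hw =>
    simp only [Expr.erase] at h
    generalize hv' : v.erase = v' at h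
    generalize hw' : w.erase = w' at h
    cases h with
    | pure h => cases h
    | heap h =>
      cases h with
      | xchg _ _ _ _ h =>
        cases Val.erase_eq_lit hv'
        obtain ⟨u, hu, hur, rfl⟩ := hs.exists_heap h
        exact ⟨_, _, .heap (.xchg _ _ _ _ hu), hur, rfl, hs.update hw hw', rfl, rfl⟩
  | @faa v w hv hw =>
    simp only [Expr.erase] at h
    generalize hv' : v.erase = v' at h
    generalize hw' : w.erase = w' at h
    cases h with
    | pure h => cases h
    | heap h =>
      cases h with
      | faa _ _ _ _ h =>
        cases Val.erase_eq_lit hv'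
        cases Val.erase_eq_lit hw'
        obtain ⟨u, hu, hur, hu'⟩ := hs.exists_heap h
        cases Val.erase_eq_lit hu'
        exact ⟨_, _, .heap (.faa _ _ _ _ hu), hur, by rw [Val.erase_lit],
          hs.update (.lit trivial) (Val.erase_lit _), rfl, rfl⟩
  | @alloc v w hv hw =>
    simp only [Expr.erase] at h
    generalize hv' : v.erase = v' at h
    generalize hw' : w.erase = w' at h
    cases h with
    | pure h => cases h
    | heap h => cases h
    | @alloc _ z n _ _ hz h =>
      cases Val.erase_eq_lit hv'
      have hfree : FreeRange σ.heap (.real n) z := by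
        intro i hi hiz
        have := h i hi hiz
        rwa [hs.heap, Option.map_eq_none_iff] at this
      exact ⟨_, _, .alloc hz hfree fun i hi hiz => hs.heapOK.dom _ (hfree i hi hiz),
        .lit trivial, by rw [Val.erase_lit], hs.alloc hw hw', rfl, rfl⟩
  | newProph =>
    simp only [Expr.erase] at h
    cases h with
    | pure h => cases h
    | heap h =>
      cases h with
      | newProph p _ h =>
        rw [hs.prophs] at h
        exact ⟨_, _, .heap (.newProph p _ h), .lit trivial, by rw [Val.erase_lit],
          hs.newProph p, rfl, rfl⟩
  | @recI f x y e hv =>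
    simp only [Expr.erase] at h
    cases h with
    | heap h => cases h
    | pure h =>
      cases h with
      | recI => exact ⟨_, σ, .pure (.recI _ _ _ _), hv, by simp only [Val.erase], hs, rfl, rfl⟩

-- Determinism of the basic operations

theorem UnOpEval.unique {o : UnOp} {v w w' : Val} (h : UnOpEval o v w) (h' : UnOpEval o v w') :
    w = w' := by
  cases h <;> cases h' <;> rfl

theorem BinOpEval.unique {o : BinOp} {v₁ v₂ w w' : Val} (h : BinOpEval o v₁ v₂ w)
    (h' : BinOpEval o v₁ v₂ w') : w = w' := by
  cases h with
  | eqTrue _ _ h =>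
    cases h' with
    | eqTrue => rfl
    | eqFalse _ _ h' => exact (h'.1 h.1).elim
  | eqFalse _ _ h =>
    cases h' with
    | eqTrue _ _ h' => exact (h.1 h'.1).elim
    | eqFalse => rfl
  | _ => cases h'; rfl

theorem PureStep.unique {e e₁ e₂ : Expr} (h₁ : PureStep e e₁) (h₂ : PureStep e e₂) : e₁ = e₂ := by
  cases h₁ with
  | unop _ _ _ h => cases h₂ with | unop _ _ _ h' => rw [h.unique h']
  | binop _ _ _ _ h => cases h₂ with | binop _ _ _ _ h' => rw [h.unique h']
  | _ => cases h₂; rfl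

theorem HeapStep.unique {e e₁ e₂ : Expr} {r r₁ r₂ : RealState} (hn : e ≠ .newProph)
    (h₁ : HeapStep e r e₁ r₁) (h₂ : HeapStep e r e₂ r₂) : e₁ = e₂ ∧ r₁ = r₂ := by
  cases h₁ with
  | newProph => exact (hn rfl).elim
  | load _ _ _ h =>
    cases h₂ with
    | load _ _ _ h' => simp_all
  | store _ _ _ _ h => cases h₂ with | store _ _ _ _ h' => simp_all
  | xchg _ _ _ _ h => cases h₂ with | xchg _ _ _ _ h' => simp_all
  | faa _ _ _ _ h => cases h₂ with | faa _ _ _ _ h' => simp_all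
  | cmpXchgTrue _ _ _ _ _ h he =>
    cases h₂ with
    | cmpXchgTrue _ _ _ _ _ h' => simp_all
    | cmpXchgFalse _ _ _ _ _ h' he' =>
      cases h.symm.trans h'
      exact (he'.1 he.1).elim
  | cmpXchgFalse _ _ _ _ _ h he =>
    cases h₂ with
    | cmpXchgFalse _ _ _ _ _ h' => simp_all
    | cmpXchgTrue _ _ _ _ _ h' he' =>
      cases h.symm.trans h'
      exact (he.1 he'.1).elim

theorem PureStep.not_heapStep {e e₁ e₂ : Expr} {r r' : RealState} (h₁ : PureStep e e₁)
    (h₂ : HeapStep e r e₂ r') : False := by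
  cases h₁ <;> cases h₂

/-- Basic operations other than allocations are deterministic. -/
theorem BasicRedex.unique {P : Params} {t : ℕ} {m : Mode} {R e₁ e₂ : Expr} {σ σ₁ σ₂ : State}
    {κ₁ κ₂ : List Obs} {es₁ es₂ : List (ℕ × Expr)} (hR : BasicRedex R)
    (hn : R ≠ .newProph) (ha : ∀ e e', R ≠ .alloc e e')
    (h₁ : HeadStep P t m R σ κ₁ e₁ σ₁ es₁) (h₂ : HeadStep P t m R σ κ₂ e₂ σ₂ es₂) :
    e₁ = e₂ ∧ σ₁ = σ₂ := by
  cases h₁ with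
  | pure h₁ =>
    cases h₂ with
    | pure h₂ => exact ⟨h₁.unique h₂, rfl⟩
    | heap h₂ => exact (h₁.not_heapStep h₂).elim
    | _ => nomatch h₁
  | heap h₁ =>
    cases h₂ with
    | pure h₂ => exact (h₂.not_heapStep h₁).elim
    | heap h₂ =>
      obtain ⟨rfl, rfl⟩ := h₁.unique hn h₂
      exact ⟨rfl, rfl⟩
    | _ => nomatch h₁
  | free =>
    cases h₂ with
    | pure h => cases h
    | heap h => cases h
    | free => exact ⟨rfl, rfl⟩
  | alloc => exact (ha _ _ rfl).elim
  | _ => cases hR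

/-! ## Matching of steps -/

/-- The step to `E₂` matches the erased step to `e₁`. In an atomic block it is the given step to
`E₁`, except that the result of the block may be chosen. -/
structure Match (p : Pos) (e₁ : Expr) (r₁ : RealState) (es₁ : List Expr) (E₁ : Expr) (σ₁ : State)
    (E₂ : Expr) (σ₂ : State) (κ₂ : List Obs) (es₂ : List (ℕ × Expr)) : Prop where
  code : RealCode p ∅ E₂
  erase : E₂.erase = e₁
  sim : Sim σ₂ r₁
  forks : List.Forall₂ (fun a b => ∃ c, a.2 = Expr.thenFinish c ∧ RealCode .thread ∅ c ∧
    c.erase = b) es₂ es₁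
  -- Needed below a prophecy resolution, whose rule demands that the operation steps to a value.
  isVal : E₁.IsVal → E₂.IsVal
  -- Away from the end of a block the step must coincide with the given one, for otherwise the rest
  -- of the given evaluation would start from another state.
  same : p = .blockInner → E₂ = E₁ ∧ σ₂ = σ₁
  -- In a block, either the given evaluation can be followed further, or the step produces a value
  -- and the block is finished.
  block : p ≠ .thread → κ₂ = [] ∧ es₂ = [] ∧ (E₂ = E₁ ∧ σ₂ = σ₁ ∨ E₂.IsVal)

/-- Each head step of the erasure of `R` is matched by a head step of `R`, if there is one. -/
def HeadMatch (P : Params) (t : ℕ) (m : Mode) (p : Pos) (R : Expr) : Prop :=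
  ∀ ⦃σ r κ₀ E₁ σ₁ es₀ κ e₁ r₁ es₁⦄, Sim σ r → HeadStep P t m R σ κ₀ E₁ σ₁ es₀ →
    ErasedHeadStep m R.erase r κ e₁ r₁ es₁ →
    ∃ E₂ σ₂ κ₂ es₂, HeadStep P t m R σ κ₂ E₂ σ₂ es₂ ∧ Match p e₁ r₁ es₁ E₁ σ₁ E₂ σ₂ κ₂ es₂

theorem Operand.cases {A : Set String} {e : Expr} (h : Operand A e) :
    (∃ v, e = .val v ∧ RealVal v) ∨ (∃ x, e = .var x) ∨ ∃ f x y b, e = .recI f x y b := by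
  cases h with
  | val h => exact .inl ⟨_, rfl, h⟩
  | var => exact .inr (.inl ⟨_, rfl⟩)
  | recI => exact .inr (.inr ⟨_, _, _, _, rfl⟩)

theorem Operand.realVal {f x y : Binder} {b : Expr} (h : Operand ∅ (.recI f x y b)) :
    RealVal (.recI f x y b) := by
  cases h with
  | recI h => exact .recI (by simpa using h)

theorem RealVal.operand {v : Val} (h : RealVal v) {A : Set String} : Operand A (.val v) :=
  .val h

/-- In A-normal form only an operand can be due before an operation: a variable, which is stuck, or
a function definition, which becomes its value in corresponding contexts of the code and of its
erasure. The recursion on the size descends below prophecy resolutions. -/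
theorem Operation.of_next {p : Pos} {R e₁ : Expr} {k : CtxItem} (h : Operation p ∅ R)
    (hn : R.next = some (k, e₁)) :
    (∃ x, e₁ = .var x) ∨ ∃ f x y b, e₁ = .recI f x y b ∧ RealVal (.recI f x y b) ∧
      Operation p ∅ (k.fill (.val (.recI f x y b))) ∧
      ∃ k', R.erase.next = some (k', e₁.erase) ∧
        (k.fill (.val (.recI f x y b))).erase = k'.fill (.val (Val.recI f x y b).erase) := by
  induction hR : R.size using Nat.strong_induction_on generalizing R k with
  | _ n ih =>
  subst hR
  cases h with
  | newProph => cases hn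
  | forkVal => cases hn
  | forkVar => cases hn; exact .inl ⟨_, rfl⟩
  | atomic => cases hn
  | app h₁ h₂ h₃ =>
    obtain ⟨v₂, rfl, -⟩ | ⟨x, rfl⟩ | ⟨f, x, y, b, rfl⟩ := h₂.cases
    · obtain ⟨v₁, rfl, -⟩ | ⟨x, rfl⟩ | ⟨f, x, y, b, rfl⟩ := h₁.cases
      · cases hn
      · cases hn; exact .inl ⟨_, rfl⟩
      · cases hn
        exact .inr ⟨_, _, _, _, rfl, h₁.realVal, .app h₁.realVal.operand h₂ h₃, _, rfl, rfl⟩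
    · cases hn; exact .inl ⟨_, rfl⟩
    · cases hn
      exact .inr ⟨_, _, _, _, rfl, h₂.realVal, .app h₁ h₂.realVal.operand h₃, _, rfl, rfl⟩
  | case h h₁ h₂ =>
    obtain ⟨v, rfl, -⟩ | ⟨x, rfl⟩ | ⟨f, x, y, b, rfl⟩ := h.cases
    · cases hn
    · cases hn; exact .inl ⟨_, rfl⟩
    · cases hn
      exact .inr ⟨_, _, _, _, rfl, h.realVal, .case h.realVal.operand h₁ h₂, _, rfl, rfl⟩
  | cmpXchg h₁ h₂ h₃ =>
    obtain ⟨v₃, rfl, -⟩ | ⟨x, rfl⟩ | ⟨f, x, y, b, rfl⟩ := h₃.cases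
    · obtain ⟨v₂, rfl, -⟩ | ⟨x, rfl⟩ | ⟨f, x, y, b, rfl⟩ := h₂.cases
      · obtain ⟨v₁, rfl, -⟩ | ⟨x, rfl⟩ | ⟨f, x, y, b, rfl⟩ := h₁.cases
        · cases hn
        · cases hn; exact .inl ⟨_, rfl⟩
        · cases hn
          exact .inr ⟨_, _, _, _, rfl, h₁.realVal, .cmpXchg h₁.realVal.operand h₂ h₃, _, rfl, rfl⟩
      · cases hn; exact .inl ⟨_, rfl⟩
      · cases hn
        exact .inr ⟨_, _, _, _, rfl, h₂.realVal, .cmpXchg h₁ h₂.realVal.operand h₃, _, rfl, rfl⟩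
    · cases hn; exact .inl ⟨_, rfl⟩
    · cases hn
      exact .inr ⟨_, _, _, _, rfl, h₃.realVal, .cmpXchg h₁ h₂ h₃.realVal.operand, _, rfl, rfl⟩
  | @resolve _ e₁ e₂ e₃ h₁ h₂ h₃ =>
    obtain ⟨v₃, rfl, -⟩ | ⟨x, rfl⟩ | ⟨f, x, y, b, rfl⟩ := h₃.cases
    · obtain ⟨v₂, rfl, -⟩ | ⟨x, rfl⟩ | ⟨f, x, y, b, rfl⟩ := h₂.cases
      · simp only [Expr.next, nextIn_val, Option.map_eq_some_iff, Prod.mk.injEq] at hn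
        obtain ⟨⟨k', e'⟩, hn, rfl, rfl⟩ := hn
        obtain hx | ⟨f, x, y, b, rfl, hv, hop, k'', hn'', hk''⟩ :=
          ih _ (by simp only [Expr.size]; omega) h₁ hn rfl
        · exact .inl hx
        · refine .inr ⟨_, _, _, _, rfl, hv, .resolve hop h₂ h₃, .resolveL k'' v₂.erase v₃.erase,
            ?_, ?_⟩
          · simp only [Expr.erase, Expr.next, nextIn_val] at hn'' ⊢
            rw [hn'']
            rfl
          · simp only [CtxItem.fill, Expr.erase]
            rw [hk'']
      · cases hn; exact .inl ⟨_, rfl⟩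
      · cases hn
        exact .inr ⟨_, _, _, _, rfl, h₂.realVal, .resolve h₁ h₂.realVal.operand h₃, _, rfl, rfl⟩
    · cases hn; exact .inl ⟨_, rfl⟩
    · cases hn
      exact .inr ⟨_, _, _, _, rfl, h₃.realVal, .resolve h₁ h₂ h₃.realVal.operand, _, rfl, rfl⟩
  | alloc hp h₁ h₂ =>
    obtain ⟨v₂, rfl, -⟩ | ⟨x, rfl⟩ | ⟨f, x, y, b, rfl⟩ := h₂.cases
    · obtain ⟨v₁, rfl, -⟩ | ⟨x, rfl⟩ | ⟨f, x, y, b, rfl⟩ := h₁.cases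
      · cases hn
      · cases hn; exact .inl ⟨_, rfl⟩
      · cases hn
        exact .inr ⟨_, _, _, _, rfl, h₁.realVal, .alloc hp h₁.realVal.operand h₂, _, rfl, rfl⟩
    · cases hn; exact .inl ⟨_, rfl⟩
    · cases hn
      exact .inr ⟨_, _, _, _, rfl, h₂.realVal, .alloc hp h₁ h₂.realVal.operand, _, rfl, rfl⟩
  | binop h₁ h₂ | pair h₁ h₂ | store h₁ h₂ | xchg h₁ h₂ | faa h₁ h₂ =>
    obtain ⟨v₂, rfl, -⟩ | ⟨x, rfl⟩ | ⟨f, x, y, b, rfl⟩ := h₂.cases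
    · obtain ⟨v₁, rfl, -⟩ | ⟨x, rfl⟩ | ⟨f, x, y, b, rfl⟩ := h₁.cases
      · cases hn
      · cases hn; exact .inl ⟨_, rfl⟩
      · cases hn
        exact .inr ⟨_, _, _, _, rfl, h₁.realVal, by constructor; exacts [h₁.realVal.operand, h₂],
          _, rfl, rfl⟩
    · cases hn; exact .inl ⟨_, rfl⟩
    · cases hn
      exact .inr ⟨_, _, _, _, rfl, h₂.realVal, by constructor; exacts [h₁, h₂.realVal.operand],
        _, rfl, rfl⟩
  | unop h | fst h | snd h | inl h | inr h | free h | load h =>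
    obtain ⟨v, rfl, -⟩ | ⟨x, rfl⟩ | ⟨f, x, y, b, rfl⟩ := h.cases
    · cases hn
    · cases hn; exact .inl ⟨_, rfl⟩
    · cases hn
      exact .inr ⟨_, _, _, _, rfl, h.realVal, by constructor; exact h.realVal.operand, _, rfl, rfl⟩

/-- Operations in atomic blocks. -/
theorem Operation.basicRedex {p : Pos} {R : Expr} (h : Operation p ∅ R) (hn : R.next = none)
    (hp : p ≠ .thread) : BasicRedex R := by
  cases h with
  | newProph => exact .newProph
  | cmpXchg h₁ h₂ h₃ =>
    obtain ⟨v₃, rfl, hv₃, hn⟩ := nextIn_eq_none h₃ hn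
    obtain ⟨v₂, rfl, hv₂, hn⟩ := nextIn_eq_none h₂ hn
    obtain ⟨v₁, rfl, hv₁, hn⟩ := nextIn_eq_none h₁ hn
    exact .cmpXchg hv₁ hv₂ hv₃
  | binop h₁ h₂ | pair h₁ h₂ | store h₁ h₂ | xchg h₁ h₂ | faa h₁ h₂ | alloc hp h₁ h₂ =>
    obtain ⟨v₂, rfl, hv₂, hn⟩ := nextIn_eq_none h₂ hn
    obtain ⟨v₁, rfl, hv₁, hn⟩ := nextIn_eq_none h₁ hn
    constructor <;> assumption
  | unop h | fst h | snd h | inl h | inr h | free h | load h =>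
    obtain ⟨v, rfl, hv, hn⟩ := nextIn_eq_none h hn
    constructor; assumption
  | _ => exact (hp rfl).elim

/-- Operands that are values erase to values, so a redex stays a redex and the erased step is a head
step as well. -/
theorem Operation.erase_next {p : Pos} {R : Expr} (h : Operation p ∅ R) (hn : R.next = none) :
    R.erase.next = none := by
  induction hR : R.size using Nat.strong_induction_on generalizing R p with
  | _ n ih =>
  subst hR
  cases h with
  | newProph => rfl
  | forkVal => rfl
  | forkVar => cases hn
  | atomic => rfl
  | cmpXchg h₁ h₂ h₃ =>
    obtain ⟨v₃, rfl, -, hn⟩ := nextIn_eq_none h₃ hn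
    obtain ⟨v₂, rfl, -, hn⟩ := nextIn_eq_none h₂ hn
    obtain ⟨v₁, rfl, -, hn⟩ := nextIn_eq_none h₁ hn
    rfl
  | @resolve _ e₁ e₂ e₃ h₁ h₂ h₃ =>
    obtain ⟨v₃, rfl, -, hn⟩ := nextIn_eq_none h₃ hn
    obtain ⟨v₂, rfl, -, hn⟩ := nextIn_eq_none h₂ hn
    rw [Option.map_eq_none_iff] at hn
    have := ih e₁.size (by simp only [Expr.size]; omega) h₁ hn rfl
    simp only [Expr.erase, Expr.next, nextIn_val, this, Option.map_none]
  | app h₁ h₂ | alloc _ h₁ h₂ | binop h₁ h₂ | pair h₁ h₂ | store h₁ h₂ | xchg h₁ h₂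
  | faa h₁ h₂ =>
    obtain ⟨v₂, rfl, -, hn⟩ := nextIn_eq_none h₂ hn
    obtain ⟨v₁, rfl, -, hn⟩ := nextIn_eq_none h₁ hn
    rfl
  | unop h | fst h | snd h | inl h | inr h | free h | load h | case h =>
    obtain ⟨v, rfl, -, hn⟩ := nextIn_eq_none h hn
    rfl

theorem Operation.not_isAppA {p : Pos} {A : Set String} {R : Expr} (h : Operation p A R) :
    ¬ R.IsAppA := by
  induction hR : R.size using Nat.strong_induction_on generalizing R p with
  | _ n ih =>
  subst hR
  cases h with
  | @resolve _ e₁ e₂ e₃ h₁ =>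
    exact ih (R := e₁) e₁.size (by simp only [Expr.size]; omega) h₁ rfl
  | _ => exact id

theorem RealCode.not_isAppA {p : Pos} {A : Set String} {e : Expr} (h : RealCode p A e) :
    ¬ e.IsAppA := by
  cases h with
  | operand h => cases h <;> exact id
  | operation h => exact h.not_isAppA
  | _ => exact id

/-- The outcome is a value, so at the end of a block and in a thread it may differ from the given
one. Elsewhere allocation and `newProph` are excluded, and determinism gives equality. -/
theorem BasicRedex.headMatch {P : Params} {t : ℕ} {m : Mode} {p : Pos} {R : Expr}
    (hR : BasicRedex R)
    (hp : p = .blockInner → R ≠ .newProph ∧ ∀ e e', R ≠ .alloc e e') :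
    HeadMatch P t m p R := by
  intro σ r κ₀ E₁ σ₁ es₀ κ e₁ r₁ es₁ hs h h'
  obtain ⟨v, σ', hstep, hv, he, hs', -, rfl⟩ := hR.simulate (P := P) (t := t) hs h'
  exact ⟨_, _, _, _, hstep,
    { code := .operand hv.operand
      erase := by rw [he, Expr.erase]
      sim := hs'
      forks := .nil
      isVal := fun _ => ⟨_, rfl⟩
      same := fun h₀ => hR.unique (hp h₀).1 (hp h₀).2 hstep h
      block := fun _ => ⟨rfl, rfl, .inr ⟨_, rfl⟩⟩ }⟩

theorem Operation.ne_of_blockInner {A : Set String} {R : Expr}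
    (h : Operation .blockInner A R) : R ≠ .newProph ∧ ∀ e e', R ≠ .alloc e e' := by
  constructor
  · rintro rfl
    cases h with
    | newProph h => exact h rfl
  · rintro e e' rfl
    cases h with
    | alloc h => exact h rfl

/-- No auxiliary let is to be executed next, and the code is not a value. -/
def Expr.Normal (E : Expr) : Prop := ¬ E.IsVal ∧ ∀ K x e₁ e₂, E ≠ Ctx.fill K (.letA x e₁ e₂)

theorem Expr.Normal.letR_left {x : Binder} {e₁ e₂ : Expr} (h : Expr.Normal (.letR x e₁ e₂))
    (h₁ : ¬ e₁.IsVal) : e₁.Normal :=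
  ⟨h₁, fun K y a b he => h.2 (.letR x e₂ :: K) y a b (by rw [he]; rfl)⟩

/-- Erasure removes only auxiliary lets, and in normal code none is due. Hence the erased context
evaluates at the corresponding place, and a thread with normal code still counts as running for the
fairness of the erased execution. -/
theorem RealCode.erase_not_isVal {p : Pos} {A : Set String} {E : Expr} (h : RealCode p A E)
    (hn : E.Normal) : ¬ E.erase.IsVal := by
  rintro ⟨v, hv⟩
  cases h with
  | operand h =>
    cases h with
    | val => exact hn.1 ⟨_, rfl⟩
    | _ => simp [Expr.erase] at hv
  | operation h => cases h <;> simp [Expr.erase] at hv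
  | letA => exact hn.2 [] _ _ _ rfl
  | _ => simp [Expr.erase] at hv

theorem CtxStep.var_false {P : Params} {t : ℕ} {m : Mode} {x : String} {E : Expr} {σ σ' : State}
    {κ : List Obs} {es : List (ℕ × Expr)} (h : CtxStep P t m (.var x) σ κ E σ' es) : False := by
  cases h.headStep rfl with
  | pure hp => cases hp
  | heap hh => cases hh

theorem CtxStep.recI_inv {P : Params} {t : ℕ} {m : Mode} {f x y : Binder} {b E : Expr}
    {σ σ' : State} {κ : List Obs} {es : List (ℕ × Expr)}
    (h : CtxStep P t m (.recI f x y b) σ κ E σ' es) :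
    E = .val (.recI f x y b) ∧ σ' = σ ∧ κ = [] ∧ es = [] := by
  cases h.headStep rfl with
  | pure hp => cases hp; exact ⟨rfl, rfl, rfl, rfl⟩
  | heap hh => cases hh

theorem ErasedCtxStep.recI_inv {m : Mode} {f x y : Binder} {b E : Expr}
    {r r' : RealState} {κ : List Obs} {es : List Expr}
    (h : ErasedCtxStep m (.recI f x y b) r κ E r' es) :
    E = .val (.recI f x y b) ∧ r' = r ∧ es = [] := by
  cases h.headStep rfl with
  | pure hp => cases hp; exact ⟨rfl, rfl, rfl⟩
  | heap hh => cases hh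

/-- Each step of the erasure of normal real code is matched by a step of the code, if there is
one. -/
theorem RealCode.ctxMatch {P : Params} {t : ℕ} {m : Mode} {p : Pos} {E : Expr}
    (hop : p = .thread → ∀ R, Operation p ∅ R → R.next = none → HeadMatch P t m p R)
    {σ σ₁ : State} {r r₁ : RealState} {κ₀ κ : List Obs} {E₁ e₁ : Expr}
    {es₀ : List (ℕ × Expr)} {es₁ : List Expr} (hE : RealCode p ∅ E) (hn : E.Normal)
    (hs : Sim σ r) (h : CtxStep P t m E σ κ₀ E₁ σ₁ es₀)
    (h' : ErasedCtxStep m E.erase r κ e₁ r₁ es₁) :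
    ∃ E₂ σ₂ κ₂ es₂, CtxStep P t m E σ κ₂ E₂ σ₂ es₂ ∧
      Match p e₁ r₁ es₁ E₁ σ₁ E₂ σ₂ κ₂ es₂ := by
  induction hsz : E.size using Nat.strong_induction_on generalizing E E₁ e₁ p with
  | _ n ih =>
  subst hsz
  -- Both kinds of let at once: `q`, the position of the bound expression, is `thread` in a thread
  -- and `blockInner` in a block.
  have hletR : ∀ q x a b, (q ≠ .thread → q = .blockInner) → (q = .thread ↔ p = .thread) →
      E = .letR x a b → RealCode q ∅ a → RealCode p ∅ b →
      (∀ a', RealCode q ∅ a' → RealCode p ∅ (.letR x a' b)) → 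
      ∃ E₂ σ₂ κ₂ es₂, CtxStep P t m E σ κ₂ E₂ σ₂ es₂ ∧
        Match p e₁ r₁ es₁ E₁ σ₁ E₂ σ₂ κ₂ es₂ := by
    rintro q x a b hq hqp rfl ha hb hcode
    by_cases hv : a.IsVal
    · obtain ⟨v, rfl⟩ := hv
      have hval : RealVal v := by
        cases ha with
        | operand ha => cases ha with | val h => exact h
        | operation ha => cases ha
      cases h.headStep rfl with
      | heap hh => cases hh
      | pure hp =>
        cases hp
        simp only [Expr.erase] at h'
        cases h'.headStep rfl with
        | heap hh => cases hh
        | pure hp =>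
          cases hp
          exact ⟨_, _, _, _, .mk [] (.pure (.letR x v b)),
            { code := (hb.substB (.real hval) fun _ => hval).anti (Set.empty_subset _)
              erase := hb.erase_substB
              sim := hs
              forks := .nil
              isVal := id
              same := fun _ => ⟨rfl, rfl⟩
              block := fun _ => ⟨rfl, rfl, .inl ⟨rfl, rfl⟩⟩ }⟩
    · have hna := hn.letR_left hv
      have hnext : (Expr.letR x a b).next = some (.letR x b, a) :=
        CtxItem.next_fill (.letR x b) hv
      have hnext' : (Expr.letR x a b).erase.next = some (.letR x b.erase, a.erase) := by
        simp only [Expr.erase]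
        exact CtxItem.next_fill (.letR x b.erase) (ha.erase_not_isVal hna)
      obtain ⟨a₁, rfl, h₁⟩ := h.of_next id hnext
      obtain ⟨a₁', rfl, h₁'⟩ := h'.of_next hnext'
      obtain ⟨E₂, σ₂, κ₂, es₂, hstep, hm⟩ :=
        ih _ (by simp only [Expr.size]; omega) (p := q)
          (fun hq' => by obtain rfl := hq'.trans (hqp.1 hq').symm; exact hop (hqp.1 hq'))
          ha hna h₁ h₁' rfl
      refine ⟨_, _, _, _, hstep.fill (.letR x b),
            { code := hcode _ hm.code
              erase := by simp only [CtxItem.fill, Expr.erase, hm.erase]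
              sim := hm.sim
              forks := hm.forks
              isVal := fun hv => (CtxItem.fill_not_isVal _ _ hv).elim
              same := fun hp => ?_
              block := fun hp => ?_ }⟩
      · obtain ⟨rfl, rfl⟩ := hm.same (hq (by rw [Ne, hqp, hp]; simp))
        exact ⟨rfl, rfl⟩
      -- In a block the bound expression never comes last, so its step is exactly the given one, and
      -- so is the step of the let.
      · have hq' : q ≠ .thread := by rwa [Ne, hqp]
        obtain ⟨rfl, rfl⟩ := hm.same (hq hq')
        exact ⟨(hm.block hq').1, (hm.block hq').2.1, .inl ⟨rfl, rfl⟩⟩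
  -- The case in which a function definition among the operands is due; on both sides its only step
  -- leads to its value.
  have hctx : ∀ k k' f x y b, E.next = some (k, .recI f x y b) →
      RealCode p ∅ (k.fill (.val (.recI f x y b))) →
      E.erase.next = some (k', (Expr.recI f x y b).erase) →
      (k.fill (.val (.recI f x y b))).erase = k'.fill (.val (Val.recI f x y b).erase) →
      ∃ E₂ σ₂ κ₂ es₂, CtxStep P t m E σ κ₂ E₂ σ₂ es₂ ∧
        Match p e₁ r₁ es₁ E₁ σ₁ E₂ σ₂ κ₂ es₂ := by
    intro k k' f x y b hnext hcode hnext' herase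
    obtain ⟨a₁, rfl, h₁⟩ := h.of_next hE.not_isAppA hnext
    obtain ⟨a₁', rfl, h₁'⟩ := h'.of_next hnext'
    obtain ⟨rfl, rfl, rfl, rfl⟩ := h₁.recI_inv
    simp only [Expr.erase] at h₁'
    obtain ⟨rfl, rfl, rfl⟩ := h₁'.recI_inv
    exact ⟨_, _, _, _, h,
      { code := hcode
        erase := herase
        sim := hs
        forks := .nil
        isVal := id
        same := fun _ => ⟨rfl, rfl⟩
        block := fun _ => ⟨rfl, rfl, .inl ⟨rfl, rfl⟩⟩ }⟩
  cases hE with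
  | operand hE =>
    cases hE with
    | val => exact (hn.1 ⟨_, rfl⟩).elim
    | var => exact h.var_false.elim
    | recI hb =>
      obtain ⟨rfl, rfl, rfl, rfl⟩ := h.recI_inv
      simp only [Expr.erase] at h'
      obtain ⟨rfl, rfl, rfl⟩ := h'.recI_inv
      exact ⟨_, _, _, _, h,
        { code := .operand (Operand.realVal (.recI hb)).operand
          erase := by simp only [Expr.erase, Val.erase]
          sim := hs
          forks := .nil
          isVal := id
          same := fun _ => ⟨rfl, rfl⟩
          block := fun _ => ⟨rfl, rfl, .inl ⟨rfl, rfl⟩⟩ }⟩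
  | operation hE =>
    cases hnext : E.next with
    | none =>
      have hm : HeadMatch P t m p E := by
        by_cases hp : p = .thread
        · exact hop hp _ hE hnext
        · exact (hE.basicRedex hnext hp).headMatch (by rintro rfl; exact hE.ne_of_blockInner)
      have hstep := h.headStep hnext
      have hnext' : E.erase.next = none := hE.erase_next hnext
      obtain ⟨E₂, σ₂, κ₂, es₂, hstep, hm⟩ := hm hs hstep (h'.headStep hnext')
      exact ⟨_, _, _, _, hstep.ctxStep, hm⟩
    | some q =>
      obtain ⟨k, a⟩ := q
      obtain ⟨x, rfl⟩ | ⟨f, x, y, b, rfl, hv, hcode, k', hnext', herase⟩ := hE.of_next hnext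
      · obtain ⟨a₁, rfl, h₁⟩ := h.of_next hE.not_isAppA hnext
        exact h₁.var_false.elim
      · exact hctx _ _ _ _ _ _ hnext (.operation hcode) hnext' herase
  | @ite _ _ e a b he ha hb =>
    obtain ⟨v, rfl, hv⟩ | ⟨x, rfl⟩ | ⟨f, x, y, c, rfl⟩ := he.cases
    · simp only [Expr.erase] at h'
      cases h.headStep rfl with
      | heap hh => cases hh
      | pure h₁ =>
        generalize hv' : v.erase = v' at h'
        cases h'.headStep rfl with
        | heap hh => cases hh
        | pure h₁' =>
          cases h₁' with
          | iteTrue =>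
            cases Val.erase_eq_lit hv'
            cases h₁
            exact ⟨_, _, _, _, h,
              { code := ha
                erase := rfl
                sim := hs
                forks := .nil
                isVal := id
                same := fun _ => ⟨rfl, rfl⟩
                block := fun _ => ⟨rfl, rfl, .inl ⟨rfl, rfl⟩⟩ }⟩
          | iteFalse =>
            cases Val.erase_eq_lit hv'
            cases h₁
            exact ⟨_, _, _, _, h,
              { code := hb
                erase := rfl
                sim := hs
                forks := .nil
                isVal := id
                same := fun _ => ⟨rfl, rfl⟩
                block := fun _ => ⟨rfl, rfl, .inl ⟨rfl, rfl⟩⟩ }⟩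
    · obtain ⟨a₁, rfl, h₁⟩ := h.of_next (k := .ite a b) id rfl
      exact h₁.var_false.elim
    · exact hctx (.ite a b) (.ite a.erase b.erase) _ _ _ _ rfl (.ite he.realVal.operand ha hb)
        rfl rfl
  | @letThread _ x a b ha hb =>
    have hb' : RealCode .thread ∅ b := hb.anti (Set.empty_subset _)
    exact hletR .thread x a b (fun h => (h rfl).elim) Iff.rfl rfl ha hb'
      fun a' ha' => .letThread ha' hb
  | @letBlock _ _ x a b hp ha hb =>
    have hb' : RealCode p ∅ b := hb.anti (Set.empty_subset _)
    exact hletR .blockInner x a b (fun _ => rfl) (by simp [hp]) rfl ha hb'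
      fun a' ha' => .letBlock hp ha' hb
  | letA => exact (hn.2 [] _ _ _ rfl).elim
  | abort =>
    cases h.headStep rfl with
    | pure hp => cases hp
    | heap hh => cases hh

/-! ## Auxiliary lets and atomic blocks -/

theorem RealVal.recI_operand {f x y : Binder} {b : Expr} (h : RealVal (.recI f x y b)) :
    Operand ∅ (.recI f x y b) := by
  cases h with
  | recI h => exact .recI (by simpa using h)

/-- In real code, only operands and the bound expressions of lets are evaluated in contexts. -/
theorem RealCode.fill_inv {p : Pos} {k : CtxItem} {e : Expr} (h : RealCode p ∅ (k.fill e))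
    (hv : ¬ e.IsVal) (ho : ¬ Operand ∅ e) :
    ∃ x b q, k = .letR x b ∧ RealCode q ∅ e ∧ ∀ e', RealCode q ∅ e' → RealCode p ∅ (k.fill e') := by
  have hnext : (k.fill e).next = some (k, e) := k.next_fill hv
  generalize hE : k.fill e = E at h hnext
  cases h with
  | operand h => cases h <;> cases hnext
  | operation h =>
    obtain ⟨y, rfl⟩ | ⟨f, z, y, b, rfl, hr, -⟩ := h.of_next hnext
    exacts [(ho (.var (by simp))).elim, (ho hr.recI_operand).elim]
  | ite h =>
    cases k <;> cases hE
    exact (ho h).elim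
  | letA => cases hnext
  | abort => cases hnext
  | letThread h₁ h₂ =>
    cases k <;> cases hE
    exact ⟨_, _, _, rfl, h₁, fun e' h' => .letThread h' h₂⟩
  | letBlock hp h₁ h₂ =>
    cases k <;> cases hE
    exact ⟨_, _, _, rfl, h₁, fun e' h' => .letBlock hp h' h₂⟩

theorem Ctx.not_operand_fill {A : Set String} {R : Expr} (K : Ctx) (hv : ¬ R.IsVal)
    (hR : ¬ Operand A R) : ¬ Operand A (K.fill R) := by
  cases K with
  | nil => exact hR
  | cons k K =>
    intro ho
    have hn := k.next_fill (Ctx.fill_not_isVal K hv)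
    rw [← Ctx.fill_cons] at hn
    obtain ⟨v, h, -⟩ | ⟨y, h⟩ | ⟨f, z, y, e, h⟩ := ho.cases <;> rw [h] at hn <;> cases hn

theorem not_operand_letA {A : Set String} {x : Binder} {a b : Expr} :
    ¬ Operand A (.letA x a b) := by
  intro h; cases h

theorem not_operand_abort {A : Set String} : ¬ Operand A .abort := by
  intro h; cases h

/-- The execution of an auxiliary let in real code is invisible in the erasure. -/
theorem RealCode.letA_step {P : Params} {t : ℕ} {m : Mode} {p : Pos} {E E₁ : Expr} {K : Ctx}
    {x : Binder} {a b : Expr} {σ σ₁ : State} {r : RealState} {κ : List Obs}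
    {es : List (ℕ × Expr)} (hE : RealCode p ∅ E) (hK : E = K.fill (.letA x a b)) (hs : Sim σ r)
    (h : CtxStep P t m E σ κ E₁ σ₁ es) :
    RealCode p ∅ E₁ ∧ E₁.erase = E.erase ∧ Sim σ₁ r ∧ E₁.size < E.size ∧ es = [] := by
  induction K generalizing p E E₁ with
  | nil =>
    subst hK
    rw [Ctx.fill_nil] at h hE ⊢
    cases hE with
    | operand hE => cases hE
    | operation hE => cases hE
    | letA ha hb =>
      cases h.headStep rfl with
      | pure hp => cases hp
      | heap hh => cases hh
      | letA hbig =>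
        obtain ⟨hv, hσ, hr⟩ := BigStep.auxCode ha hs.heapOK hbig
        -- The bound variable is auxiliary: any auxiliary value may replace it, and the erasure does
        -- not contain it.
        refine ⟨(hb.substB hv fun hn => (hn Set.subset_union_right).elim).anti
          (Set.empty_subset _), ?_, hs.of_eq hσ hr, by simp [Expr.size, Expr.size_substB], rfl⟩
        rw [hb.erase_substB_of_subset Set.subset_union_right]
        simp only [Expr.erase]
  | cons k K ih =>
    rw [Ctx.fill_cons] at hK
    subst hK
    have hnv : ¬ (Ctx.fill K (.letA x a b)).IsVal :=
      Ctx.fill_not_isVal K (redex_letA x a b).not_isVal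
    obtain ⟨E', rfl, h'⟩ := h.of_next hE.not_isAppA (k.next_fill hnv)
    obtain ⟨y, c, q, rfl, hq, hcode⟩ := hE.fill_inv hnv
      (Ctx.not_operand_fill K (redex_letA x a b).not_isVal not_operand_letA)
    obtain ⟨hc, he, hs', hsz, hes⟩ := ih hq rfl h'
    exact ⟨hcode _ hc, by simp only [CtxItem.fill, Expr.erase, he], hs',
      CtxItem.size_fill_lt _ hsz, hes⟩

/-- Real code that aborts next has no step after erasure. -/
theorem RealCode.not_aborts {m : Mode} {p : Pos} {E e : Expr} {r r' : RealState} {κ : List Obs}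
    {es : List Expr} (hE : RealCode p ∅ E) (hn : E.Normal) (ha : Aborts E)
    (h : ErasedCtxStep m E.erase r κ e r' es) : False := by
  obtain ⟨K, rfl⟩ := ha
  induction K generalizing p e with
  | nil =>
    rw [Ctx.fill_nil] at h
    simp only [Expr.erase] at h
    cases h.headStep rfl with
    | pure hp => cases hp
    | heap hh => cases hh
  | cons k K ih =>
    rw [Ctx.fill_cons] at hE hn h
    have hnv := Ctx.fill_not_isVal K redex_abort.not_isVal
    obtain ⟨y, c, q, rfl, hq, -⟩ := hE.fill_inv hnv
      (Ctx.not_operand_fill K redex_abort.not_isVal not_operand_abort)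
    have hn' := Expr.Normal.letR_left hn hnv
    simp only [CtxItem.fill, Expr.erase] at h
    obtain ⟨e', -, h'⟩ := h.of_next
      (CtxItem.next_fill (.letR y c.erase) (hq.erase_not_isVal hn'))
    exact ih hq hn' h'

theorem BigStep.of_ctxStep {P : Params} {t : ℕ} {e e' : Expr} {v : Val} {σ σ' σ'' : State}
    (h : CtxStep P t .nested e σ [] e' σ' []) (h' : BigStep P t e' σ' v σ'') :
    BigStep P t e σ v σ'' := by
  generalize hκ : ([] : List Obs) = κ at h
  generalize hes : ([] : List (ℕ × Expr)) = es at h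
  cases h with
  | mk K h => subst hκ hes; exact .step rfl h h'

theorem ErasedBigStep.val_inv {v w : Val} {r r' : RealState}
    (h : ErasedBigStep (.val v) r w r') : v = w ∧ r = r' := by
  cases h with
  | done => exact ⟨rfl, rfl⟩
  | step hK h => exact (Ctx.fill_not_isVal _ h.redex.not_isVal (hK ▸ Expr.isVal_val v)).elim

theorem ErasedBigStep.ctxStep {e : Expr} {v : Val} {r r'' : RealState} (he : ¬ e.IsVal)
    (h : ErasedBigStep e r v r'') :
    ∃ e' r', ErasedCtxStep .nested e r [] e' r' [] ∧ ErasedBigStep e' r' v r'' := by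
  cases h with
  | done => exact (he ⟨_, rfl⟩).elim
  | step hK h h' => subst hK; exact ⟨_, _, .mk _ h, h'⟩

theorem RealCode.val_inv {p : Pos} {A : Set String} {v : Val} (h : RealCode p A (.val v)) :
    RealVal v := by
  cases h with
  | operand h => cases h with | val h => exact h
  | operation h => cases h

/-- The result of an atomic block of the erased language is a result of the atomic block. -/
theorem BigStep.simulate {P : Params} {t : ℕ} {p : Pos} (hp : p ≠ .thread) {E : Expr}
    {v₀ v' : Val} {σ σ₀ : State} {r r' : RealState} (hE : RealCode p ∅ E) (hs : Sim σ r)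
    (h : BigStep P t E σ v₀ σ₀) (h' : ErasedBigStep E.erase r v' r') :
    ∃ v σ', BigStep P t E σ v σ' ∧ RealVal v ∧ v.erase = v' ∧ Sim σ' r' := by
  -- The induction follows the instrumented evaluation, which also runs the auxiliary lets; the
  -- erased evaluation advances only when the code is normal.
  induction h using BigStep.rec (motive_1 := fun _ _ _ _ _ _ _ _ => True)
    generalizing r with
  | done =>
    simp only [Expr.erase] at h'
    obtain ⟨rfl, rfl⟩ := h'.val_inv
    exact ⟨_, _, .done, hE.val_inv, rfl, hs⟩
  | @step K e₀ e e' v σ σ' σ'' hK h₁ h₂ _ ih =>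
    subst hK
    have hstep : CtxStep P t .nested (K.fill e) σ [] (K.fill e') σ' [] := .mk K h₁
    by_cases hn : (K.fill e).Normal
    · obtain ⟨e₁, r₁, h₁', h₂'⟩ := h'.ctxStep (hE.erase_not_isVal hn)
      obtain ⟨E₂, σ₂, κ₂, es₂, hstep', hm⟩ :=
        hE.ctxMatch (fun h => (hp h).elim) hn hs hstep h₁'
      obtain ⟨rfl, rfl, ⟨rfl, rfl⟩ | ⟨v, rfl⟩⟩ := hm.block hp
      · obtain ⟨v, σ', hb, hv⟩ := ih hm.code hm.sim (by rwa [hm.erase])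
        exact ⟨v, σ', .of_ctxStep hstep' hb, hv⟩
      -- The matching step may have another outcome than the given one, but it is a value, so the
      -- erased evaluation ends here too and the rest of the given evaluation is not needed.
      · have he := hm.erase
        simp only [Expr.erase] at he
        subst he
        obtain ⟨rfl, rfl⟩ := h₂'.val_inv
        exact ⟨v, _, .of_ctxStep hstep' .done, hm.code.val_inv, rfl, hm.sim⟩
    -- An auxiliary let is due: the given step is taken while the erased evaluation waits.
    · have : ∃ K' x a b, K.fill e = Ctx.fill K' (.letA x a b) := by
        by_contra! hno
        exact hn ⟨hstep.not_isVal, hno⟩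
      obtain ⟨K', x, a, b, hK'⟩ := this
      obtain ⟨hc, he, hs', -⟩ := hE.letA_step hK' hs hstep
      obtain ⟨v, σ', hb, hv⟩ := ih hc hs' (by rwa [he])
      exact ⟨v, σ', .of_ctxStep hstep hb, hv⟩
  | _ => trivial

/-! ## Matching of thread steps -/

/-- The recursion descends below prophecy resolutions. A call, a case distinction and a fork take
the step provided by safety; for a call this works because its auxiliary argument neither touches
the real state nor shows in the erased body. An atomic block exchanges its evaluation by
`BigStep.simulate`, and the remaining operations are basic. -/
theorem Operation.headMatch {P : Params} {t : ℕ} {R : Expr} (hR : Operation .thread ∅ R)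
    (hn : R.next = none) : HeadMatch P t .full .thread R := by
  induction hsz : R.size using Nat.strong_induction_on generalizing R with
  | _ n ih =>
  subst hsz
  intro σ r κ₀ E₁ σ₁ es₀ κ e₁ r₁ es₁ hs h h'
  cases hR with
  | @resolve _ a₁ a₂ a₃ ha₁ ha₂ ha₃ =>
    obtain ⟨v₃, rfl, -, hn⟩ := nextIn_eq_none ha₃ hn
    obtain ⟨v₂, rfl, -, hn₁⟩ := nextIn_eq_none ha₂ hn
    rw [Option.map_eq_none_iff] at hn₁
    simp only [Expr.erase] at h'
    generalize hv₂ : v₂.erase = v₂' at h'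
    generalize hv₃ : v₃.erase = v₃' at h'
    cases h with
    | pure hp => cases hp
    | heap hh => cases hh
    | resolve hin =>
      cases h' with
      | pure hp => cases hp
      | heap hh => cases hh
      | resolve hin' =>
        obtain ⟨E₂, σ₂, κ₂, es₂, hstep, hm⟩ :=
          ih a₁.size (by simp only [Expr.size]; omega) ha₁ hn₁ rfl hs hin hin'
        obtain ⟨w, rfl⟩ := hm.isVal ⟨_, rfl⟩
        exact ⟨_, _, _, _, .resolve hstep,
          { hm with
            isVal := fun _ => ⟨_, rfl⟩
            same := by rintro ⟨⟩
            block := fun h => (h rfl).elim }⟩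
  | app h₁ h₂ h₃ =>
    obtain ⟨v, rfl, hv, hn⟩ := nextIn_eq_none h₂ hn
    obtain ⟨f, rfl, hf, -⟩ := nextIn_eq_none h₁ hn
    simp only [Expr.erase] at h'
    generalize hv' : v.erase = v' at h'
    have hstep := h
    cases h with
    | pure hp => cases hp
    | heap hh => cases hh
    | @beta _ f x y e _ _ w _ σ' CP CP' hcp hd hb hcp' =>
      simp only [Val.erase] at h'
      cases h' with
      | pure hp => cases hp
      | heap hh => cases hh
      | beta =>
        subst hv'
        obtain ⟨hw, hσ', hr⟩ := BigStep.auxCode h₃ hs.heapOK hb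
        cases hf with
        | recI hf =>
          obtain ⟨hc, he⟩ := hf.call hv hw
          exact ⟨_, _, _, _, hstep,
            { code := hc
              erase := by rw [he]; simp only [Val.erase]; rfl
              sim := (hs.of_eq hσ' hr).of_eq (hσ'.of_eq rfl rfl) rfl
              forks := .nil
              isVal := id
              same := by rintro ⟨⟩
              block := fun h => (h rfl).elim }⟩
  | case h₀ h₁ h₂ =>
    obtain ⟨v, rfl, hv, hn⟩ := nextIn_eq_none h₀ hn
    simp only [Expr.erase] at h'
    generalize hv' : v.erase = v' at h'
    have hstep := h
    cases h with
    | heap hh => cases hh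
    | pure hp =>
      cases h' with
      | heap hh => cases hh
      | pure hp' =>
        cases hp with
        | caseInl w =>
          simp only [Val.erase] at hv'
          subst hv'
          cases hp'
          exact ⟨_, _, _, _, hstep,
            { code := .operation (.app h₁ hv.inl_inv.operand (.val .lit))
              erase := by simp only [Expr.erase]
              sim := hs
              forks := .nil
              isVal := id
              same := by rintro ⟨⟩
              block := fun h => (h rfl).elim }⟩
        | caseInr w =>
          simp only [Val.erase] at hv'
          subst hv'
          cases hp'
          exact ⟨_, _, _, _, hstep,
            { code := .operation (.app h₂ hv.inr_inv.operand (.val .lit))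
              erase := by simp only [Expr.erase]
              sim := hs
              forks := .nil
              isVal := id
              same := by rintro ⟨⟩
              block := fun h => (h rfl).elim }⟩
  | forkVar => cases hn
  | forkVal hv hc =>
    simp only [Expr.erase] at h'
    have hstep := h
    cases h with
    | pure hp => cases hp
    | heap hh => cases hh
    | fork =>
      cases h' with
      | pure hp => cases hp
      | heap hh => cases hh
      | fork =>
        exact ⟨_, _, _, _, hstep,
          { code := .operand (RealVal.lit (l := .unit) trivial).operand
            erase := by simp only [Expr.erase, Val.erase]
            sim := hs.of_eq (hs.heapOK.of_eq rfl rfl) rfl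
            forks := .cons ⟨_, rfl, hc, rfl⟩ .nil
            isVal := id
            same := by rintro ⟨⟩
            block := fun h => (h rfl).elim }⟩
  | atomic hc =>
    simp only [Expr.erase] at h'
    cases h with
    | pure hp => cases hp
    | heap hh => cases hh
    | atomic hb =>
      cases h' with
      | pure hp => cases hp
      | heap hh => cases hh
      | atomic hb' =>
        obtain ⟨v, σ', hb'', hv, rfl, hs'⟩ := BigStep.simulate (by simp) hc hs hb hb'
        exact ⟨_, _, _, _, .atomic hb'',
          { code := .operand hv.operand
            erase := by simp only [Expr.erase]
            sim := hs'
            forks := .nil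
            isVal := fun _ => ⟨_, rfl⟩
            same := by rintro ⟨⟩
            block := fun h => (h rfl).elim }⟩
  | newProph => exact BasicRedex.newProph.headMatch (by rintro ⟨⟩) hs h h'
  | cmpXchg h₁ h₂ h₃ =>
    obtain ⟨v₃, rfl, hv₃, hn⟩ := nextIn_eq_none h₃ hn
    obtain ⟨v₂, rfl, hv₂, hn⟩ := nextIn_eq_none h₂ hn
    obtain ⟨v₁, rfl, hv₁, hn⟩ := nextIn_eq_none h₁ hn
    exact (BasicRedex.cmpXchg hv₁ hv₂ hv₃).headMatch (by rintro ⟨⟩) hs h h'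
  | binop h₁ h₂ | pair h₁ h₂ | store h₁ h₂ | xchg h₁ h₂ | faa h₁ h₂ | alloc hp h₁ h₂ =>
    obtain ⟨v₂, rfl, hv₂, hn⟩ := nextIn_eq_none h₂ hn
    obtain ⟨v₁, rfl, hv₁, hn⟩ := nextIn_eq_none h₁ hn
    exact BasicRedex.headMatch (by constructor <;> assumption) (by rintro ⟨⟩) hs h h'
  | unop h₁ | fst h₁ | snd h₁ | inl h₁ | inr h₁ | free h₁ | load h₁ =>
    obtain ⟨v, rfl, hv, hn⟩ := nextIn_eq_none h₁ hn
    exact BasicRedex.headMatch (by constructor; assumption) (by rintro ⟨⟩) hs h h'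

/-! ## Permissions, obligations and signals -/

/-- The part of the state on which the termination argument rests. -/
structure Ghost where
  signals : ℕ → Option (Val × Bool)
  obls : ℕ → Option Obls
  callPerms : ℕ → Option (Multiset Val)
  expectPerms : ℕ → Option (Multiset (ℕ × Val))

def State.ghost (σ : State) : Ghost where
  signals := σ.signals
  obls := σ.obls
  callPerms := σ.callPerms
  expectPerms := σ.expectPerms

/-- The events that are counted: the consumption of a call permission of a thread by a call, and
an expectation of a signal by a thread. -/
inductive GhostEvent where
  | call (t : ℕ)
  | expect (t s : ℕ)

def GhostEvent.signal : GhostEvent → Option ℕ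
  | .call _ => none
  | .expect _ s => some s

/-- Elementary changes of the ghost state within a thread. -/
inductive GhostStep (P : Params) : Ghost → List GhostEvent → Ghost → Prop
  | call {g : Ghost} {t : ℕ} {CP : Multiset Val} :
      g.callPerms t = some (P.deg₀ ::ₘ CP) →
      GhostStep P g [.call t] { g with callPerms := Function.update g.callPerms t (some CP) }
  | finish {g : Ghost} {t : ℕ} :
      g.obls t = some (.active 0) →
      GhostStep P g [] { g with obls := Function.update g.obls t (some .finished) }
  | lower {g : Ghost} {d d' : Val} {n t : ℕ} {CP : Multiset Val} :
      g.callPerms t = some (d ::ₘ CP) → P.degLt d' d →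
      GhostStep P g []
        { g with
          callPerms := Function.update g.callPerms t (some (CP + Multiset.replicate n d')) }
  | newSignal {g : Ghost} {s t : ℕ} {lev : Val} {O : Multiset (ℕ × Val)} :
      g.signals s = none → g.obls t = some (.active O) →
      GhostStep P g []
        { g with
          obls := Function.update g.obls t (some (.active ((s, lev) ::ₘ O)))
          signals := Function.update g.signals s (some (lev, false)) }
  | setSignal {g : Ghost} {s t : ℕ} {lev : Val} {b : Bool} {O O' : Multiset (ℕ × Val)} :
      g.signals s = some (lev, b) → g.obls t = some (.active O) →
      O = (s, lev) ::ₘ O' ∨ ((s, lev) ∉ O ∧ O' = O) →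
      GhostStep P g []
        { g with
          obls := Function.update g.obls t (some (.active O'))
          signals := Function.update g.signals s (some (lev, true)) }
  | newExpectPerm {g : Ghost} {s t : ℕ} {d d' : Val} {CP : Multiset Val}
      {EP : Multiset (ℕ × Val)} :
      g.callPerms t = some (d ::ₘ CP) → P.degLt d' d → g.expectPerms t = some EP →
      GhostStep P g []
        { g with
          callPerms := Function.update g.callPerms t (some CP)
          expectPerms := Function.update g.expectPerms t (some ((s, d') ::ₘ EP)) }
  | expect {g : Ghost} {s t : ℕ} {d lev : Val} {O : Multiset (ℕ × Val)} {CP : Multiset Val}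
      {EP : Multiset (ℕ × Val)} :
      g.signals s = some (lev, false) → g.obls t = some (.active O) →
      (∀ o ∈ O, P.levLt lev o.2) →
      g.expectPerms t = some EP → (s, d) ∈ EP → g.callPerms t = some CP →
      GhostStep P g [.expect t s]
        { g with callPerms := Function.update g.callPerms t (some (d ::ₘ CP)) }

/-- One machine step may perform many elementary changes, since auxiliary code and atomic blocks are
evaluated within a single step. The trace lists all their events in order. -/
inductive GhostTrace (P : Params) : Ghost → List GhostEvent → Ghost → Prop
  | refl (g : Ghost) : GhostTrace P g [] g
  | head {g g' g'' : Ghost} {τ τ' : List GhostEvent} :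
      GhostStep P g τ g' → GhostTrace P g' τ' g'' → GhostTrace P g (τ ++ τ') g''

/-- Thread `t` forks thread `t'`. -/
inductive GhostFork (t t' : ℕ) : Ghost → Ghost → Prop
  | mk {g : Ghost} {O L : Multiset (ℕ × Val)} {CP : Multiset Val} {EP : Multiset (ℕ × Val)} :
      g.obls t = some (.active (O + L)) → g.callPerms t = some CP → g.expectPerms t = some EP →
      IsLeast {k : ℕ | 0 < k ∧ g.obls k = none} t' →
      GhostFork t t' g
        { g with
          obls := Function.update (Function.update g.obls t (some (.active O))) t'
            (some (.active L))
          callPerms := Function.update g.callPerms t' (some CP)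
          expectPerms := Function.update g.expectPerms t' (some EP) }

section
variable {P : Params}

theorem GhostStep.trace {g g' : Ghost} {τ : List GhostEvent} (h : GhostStep P g τ g') :
    GhostTrace P g τ g' := by
  simpa using GhostTrace.head h (.refl g')

theorem GhostTrace.trans {g g' g'' : Ghost} {τ τ' : List GhostEvent} (h : GhostTrace P g τ g')
    (h' : GhostTrace P g' τ' g'') : GhostTrace P g (τ ++ τ') g'' := by
  induction h with
  | refl => exact h'
  | head h₁ _ ih => rw [List.append_assoc]; exact .head h₁ (ih h')

mutual
/-- A head step forks, or it acts on the ghost state by elementary steps. It makes the code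
smaller, or it consumes a call permission. -/
theorem HeadStep.ghost {t : ℕ} {m : Mode} {e e' : Expr} {σ σ' : State} {κ : List Obs}
    {es : List (ℕ × Expr)} :
    HeadStep P t m e σ κ e' σ' es →
      (es = [] ∧ ∃ τ, GhostTrace P σ.ghost τ σ'.ghost ∧ (e'.size < e.size ∨ .call t ∈ τ)) ∨
      ∃ t' c, es = [(t', c)] ∧ GhostFork t t' σ.ghost σ'.ghost ∧ e'.size < e.size ∧
        c.size < e.size
  | .pure h => .inl ⟨rfl, _, .refl _, .inl h.size_lt⟩
  | .heap h => .inl ⟨rfl, _, .refl _, .inl h.size_lt⟩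
  | .alloc _ _ _ => .inl ⟨rfl, _, .refl _, .inl (by simp [Expr.size])⟩
  | .free _ => .inl ⟨rfl, _, .refl _, .inl (by simp [Expr.size])⟩
  | .resolve h => by
    obtain ⟨rfl, τ, hτ, -⟩ | ⟨t', c, rfl, hf, hs, hc⟩ := HeadStep.ghost h
    · exact .inl ⟨rfl, τ, hτ, .inl (by simp [Expr.size])⟩
    · exact .inr ⟨t', c, rfl, hf, by simp [Expr.size], by simp only [Expr.size]; omega⟩
  -- The only rule that may enlarge the code; it is paid for with a call permission.
  | .beta _ _ hb hcp => by
    obtain ⟨τ, hτ⟩ := BigStep.ghost hb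
    exact .inl ⟨rfl, _, hτ.trans (GhostStep.call hcp).trace, .inr (by simp)⟩
  | .betaA h₁ h₂ => by
    obtain ⟨τ₁, hτ₁⟩ := BigStep.ghost h₁
    obtain ⟨τ₂, hτ₂⟩ := BigStep.ghost h₂
    exact .inl ⟨rfl, _, hτ₁.trans hτ₂, .inl (by simp [Expr.size])⟩
  | .atomic h => by
    obtain ⟨τ, hτ⟩ := BigStep.ghost h
    exact .inl ⟨rfl, τ, hτ, .inl (by simp [Expr.size, Expr.size_pos])⟩
  | .fork h₁ h₂ h₃ h₄ =>
    .inr ⟨_, _, rfl, .mk h₁ h₂ h₃ h₄, by simp [Expr.size],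
      by simp [Expr.thenFinish, Expr.seq, Expr.size]; omega⟩
  | .letA h => by
    obtain ⟨τ, hτ⟩ := BigStep.ghost h
    exact .inl ⟨rfl, τ, hτ, .inl (by simp [Expr.size, Expr.size_substB])⟩
  | .allocA _ _ _ => .inl ⟨rfl, _, .refl _, .inl (by simp [Expr.size])⟩
  | .loadA _ => .inl ⟨rfl, _, .refl _, .inl (by simp [Expr.size])⟩
  | .storeA _ => .inl ⟨rfl, _, .refl _, .inl (by simp [Expr.size])⟩
  | .currentThread => .inl ⟨rfl, _, .refl _, .inl (by simp [Expr.size])⟩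
  | .finish h => .inl ⟨rfl, _, GhostStep.trace (.finish h), .inl (by simp [Expr.size])⟩
  | .lower h h' => .inl ⟨rfl, _, GhostStep.trace (.lower h h'), .inl (by simp [Expr.size])⟩
  | .newSignal h h' => .inl ⟨rfl, _, GhostStep.trace (.newSignal h h'), .inl (by simp [Expr.size])⟩
  | .setSignal h h' h'' =>
    .inl ⟨rfl, _, GhostStep.trace (.setSignal h h' h''), .inl (by simp [Expr.size])⟩
  | .newExpectPerm _ h h' h'' =>
    .inl ⟨rfl, _, GhostStep.trace (.newExpectPerm h h' h''), .inl (by simp [Expr.size])⟩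
  | .expect h₁ h₂ h₃ h₄ h₅ h₆ =>
    .inl ⟨rfl, _, GhostStep.trace (.expect h₁ h₂ h₃ h₄ h₅ h₆), .inl (by simp [Expr.size])⟩
theorem BigStep.ghost {t : ℕ} {e : Expr} {v : Val} {σ σ' : State} :
    BigStep P t e σ v σ' → ∃ τ, GhostTrace P σ.ghost τ σ'.ghost
  | .done => ⟨_, .refl _⟩
  | .step _ h₁ h₂ => by
    obtain ⟨-, τ₁, hτ₁, -⟩ | ⟨t', c, hes, -⟩ := HeadStep.ghost h₁
    · obtain ⟨τ₂, hτ₂⟩ := BigStep.ghost h₂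
      exact ⟨_, hτ₁.trans hτ₂⟩
    · cases hes
end

theorem ThreadStep.ghost {t : ℕ} {e e' : Expr} {σ σ' : State} {κ : List Obs}
    {es : List (ℕ × Expr)} (h : ThreadStep P t e σ κ e' σ' es) :
    (es = [] ∧ ∃ τ, GhostTrace P σ.ghost τ σ'.ghost ∧ (e'.size < e.size ∨ .call t ∈ τ)) ∨
      ∃ t' c, es = [(t', c)] ∧ GhostFork t t' σ.ghost σ'.ghost ∧ e'.size < e.size ∧
        c.size < e.size := by
  cases h with
  | mk K h =>
    obtain ⟨rfl, τ, hτ, hs⟩ | ⟨t', c, rfl, hf, hs, hc⟩ := h.ghost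
    · exact .inl ⟨rfl, τ, hτ, hs.imp_left (Ctx.size_fill_lt K)⟩
    · exact .inr ⟨t', c, rfl, hf, Ctx.size_fill_lt K hs, hc.trans_le (Ctx.size_le_fill K _)⟩

/-! ### Invariants -/

/-- Thread `t` holds the obligation to set the signal `s` of level `lev`. -/
def Ghost.Holds (g : Ghost) (t s : ℕ) (lev : Val) : Prop :=
  ∃ O, g.obls t = some (.active O) ∧ (s, lev) ∈ O

/-- The signals of `g` persist in `g'`, with the same levels, and set signals remain set. -/
def Ghost.SigLe (g g' : Ghost) : Prop :=
  ∀ s lev b, g.signals s = some (lev, b) →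
    ∃ b', g'.signals s = some (lev, b') ∧ (b = true → b' = true)

/-- Each unset signal is an obligation of some thread. -/
def Ghost.AllHeld (g : Ghost) : Prop :=
  ∀ s lev, g.signals s = some (lev, false) → ∃ t, g.Holds t s lev

def Ghost.IsSet (g : Ghost) (s : ℕ) : Prop := ∃ lev, g.signals s = some (lev, true)

theorem Ghost.SigLe.refl (g : Ghost) : g.SigLe g := fun _ _ b h => ⟨b, h, id⟩

theorem Ghost.SigLe.trans {g g' g'' : Ghost} (h : g.SigLe g') (h' : g'.SigLe g'') :
    g.SigLe g'' := by
  intro s lev b hs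
  obtain ⟨b', hs', hb⟩ := h s lev b hs
  obtain ⟨b'', hs'', hb'⟩ := h' s lev b' hs'
  exact ⟨b'', hs'', hb' ∘ hb⟩

theorem Ghost.SigLe.isSet {g g' : Ghost} (h : g.SigLe g') {s : ℕ} (hs : g.IsSet s) :
    g'.IsSet s := by
  obtain ⟨lev, hs⟩ := hs
  obtain ⟨b, hs', hb⟩ := h _ _ _ hs
  exact ⟨lev, by rw [hs', hb rfl]⟩

/-- Levels are fixed at creation, new signals are fresh, and no step resets a signal. -/
theorem GhostStep.sigLe {g g' : Ghost} {τ : List GhostEvent} (h : GhostStep P g τ g') :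
    g.SigLe g' := by
  intro s lev b hs
  cases h with
  | @newSignal s' _ _ _ h₁ =>
    refine ⟨b, ?_, id⟩
    dsimp only
    rw [Function.update_of_ne, hs]
    rintro rfl
    rw [hs] at h₁
    cases h₁
  | @setSignal s' _ lev' _ _ _ h₁ =>
    dsimp only
    by_cases hss : s = s'
    · subst hss
      rw [hs] at h₁
      cases h₁
      exact ⟨true, by simp, fun _ => rfl⟩
    · exact ⟨b, by rw [Function.update_of_ne hss, hs], id⟩
  | _ => exact ⟨b, hs, id⟩

theorem GhostStep.obls_eq_none_iff {g g' : Ghost} {τ : List GhostEvent} (h : GhostStep P g τ g')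
    (k : ℕ) : g'.obls k = none ↔ g.obls k = none := by
  cases h with
  | finish h | newSignal _ h | setSignal _ h =>
    dsimp only
    rw [Function.update_apply]
    split
    · next hk => subst hk; simp [h]
    · rfl
  | _ => rfl

theorem GhostStep.obls_finished {g g' : Ghost} {τ : List GhostEvent} (h : GhostStep P g τ g')
    {k : ℕ} (hk : g.obls k = some .finished) : g'.obls k = some .finished := by
  cases h with
  | finish h | newSignal _ h | setSignal _ h =>
    dsimp only
    rw [Function.update_of_ne, hk]
    rintro rfl
    rw [hk] at h
    cases h
  | _ => exact hk

/-- Only `setSignal` removes an obligation, and it sets that very signal; `finish` demands that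
there is no obligation at all. -/
theorem GhostStep.holds {g g' : Ghost} {τ : List GhostEvent} (h : GhostStep P g τ g') {t s : ℕ}
    {lev : Val} (ht : g.Holds t s lev) : g'.IsSet s ∨ g'.Holds t s lev := by
  obtain ⟨O, hO, hs⟩ := ht
  cases h with
  | @finish t' h₁ =>
    refine .inr ⟨O, ?_, hs⟩
    dsimp only
    rw [Function.update_of_ne, hO]
    rintro rfl
    rw [hO] at h₁
    cases h₁
    simp at hs
  | @newSignal s' t' lev' O' h₁ h₂ =>
    by_cases ht : t = t'
    · subst ht
      rw [hO] at h₂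
      cases h₂
      exact .inr ⟨_, Function.update_self .., Multiset.mem_cons_of_mem hs⟩
    · exact .inr ⟨O, by rw [← hO]; exact Function.update_of_ne ht .., hs⟩
  | @setSignal s' t' lev' b O₁ O₂ h₁ h₂ h₃ =>
    by_cases hss : s = s'
    · subst hss
      exact .inl ⟨lev', Function.update_self ..⟩
    · by_cases ht : t = t'
      · subst ht
        rw [hO] at h₂
        cases h₂
        refine .inr ⟨_, Function.update_self .., ?_⟩
        obtain rfl | ⟨-, rfl⟩ := h₃
        · simpa [hss] using hs
        · exact hs
      · exact .inr ⟨O, by rw [← hO]; exact Function.update_of_ne ht .., hs⟩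
  | _ => exact .inr ⟨O, hO, hs⟩

/-- A signal that is unset afterwards either was unset before, so its holder keeps the obligation,
or has just been created together with an obligation. -/
theorem GhostStep.allHeld {g g' : Ghost} {τ : List GhostEvent} (h : GhostStep P g τ g')
    (hg : g.AllHeld) : g'.AllHeld := by
  intro s lev hs
  by_cases hs' : g.signals s = some (lev, false)
  · obtain ⟨t, ht⟩ := hg s lev hs'
    obtain ⟨lev', hset⟩ | ht' := h.holds ht
    · rw [hs] at hset
      cases hset
    · exact ⟨t, ht'⟩
  · cases h with
    | @newSignal s' t' lev' O' h₁ h₂ =>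
      by_cases hss : s = s'
      · subst hss
        dsimp only at hs
        rw [Function.update_self] at hs
        cases hs
        exact ⟨t', _, Function.update_self .., Multiset.mem_cons_self _ _⟩
      · dsimp only at hs
        rw [Function.update_of_ne hss] at hs
        exact (hs' hs).elim
    | @setSignal s' t' lev' b O₁ O₂ h₁ h₂ h₃ =>
      dsimp only at hs
      rw [Function.update_apply] at hs
      split at hs
      · cases hs
      · exact (hs' hs).elim
    | _ => exact (hs' hs).elim

/-- Extracts what the termination argument needs to know about `Expect`: the signal is unset, and
its level lies below all obligations of the thread. -/
theorem GhostStep.expect_mem {g g' : Ghost} {τ : List GhostEvent} (h : GhostStep P g τ g')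
    {t s : ℕ} (hs : .expect t s ∈ τ) :
    ∃ lev, g.signals s = some (lev, false) ∧
      ∀ s' lev', g.Holds t s' lev' → P.levLt lev lev' := by
  cases h with
  | @expect _ _ _ lev _ _ _ h₁ h₂ h₃ =>
    simp only [List.mem_singleton, GhostEvent.expect.injEq] at hs
    obtain ⟨rfl, rfl⟩ := hs
    refine ⟨lev, h₁, ?_⟩
    rintro s' lev' ⟨O, hO, hs'⟩
    rw [h₂] at hO
    cases hO
    exact h₃ _ hs'
  | call => simp at hs
  | _ => cases hs

theorem GhostTrace.sigLe {g g' : Ghost} {τ : List GhostEvent} (h : GhostTrace P g τ g') :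
    g.SigLe g' := by
  induction h with
  | refl => exact .refl _
  | head h _ ih => exact h.sigLe.trans ih

theorem GhostTrace.obls_eq_none_iff {g g' : Ghost} {τ : List GhostEvent}
    (h : GhostTrace P g τ g') (k : ℕ) : g'.obls k = none ↔ g.obls k = none := by
  induction h with
  | refl => rfl
  | head h _ ih => exact ih.trans (h.obls_eq_none_iff k)

theorem GhostTrace.obls_finished {g g' : Ghost} {τ : List GhostEvent} (h : GhostTrace P g τ g')
    {k : ℕ} (hk : g.obls k = some .finished) : g'.obls k = some .finished := by
  induction h with
  | refl => exact hk
  | head h _ ih => exact ih (h.obls_finished hk)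

theorem GhostTrace.allHeld {g g' : Ghost} {τ : List GhostEvent} (h : GhostTrace P g τ g')
    (hg : g.AllHeld) : g'.AllHeld := by
  induction h with
  | refl => exact hg
  | head h _ ih => exact ih (h.allHeld hg)

/-- While a thread holds an obligation, it expects signals of lower levels only. -/
theorem GhostTrace.holds {g g' : Ghost} {τ : List GhostEvent} (h : GhostTrace P g τ g') {t s : ℕ}
    {lev : Val} (ht : g.Holds t s lev) (hs : ¬ g'.IsSet s) :
    g'.Holds t s lev ∧ ∀ s', .expect t s' ∈ τ →
      ∃ lev' b, g'.signals s' = some (lev', b) ∧ P.levLt lev' lev := by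
  induction h with
  | refl => exact ⟨ht, fun s' h => by cases h⟩
  | head h h' ih =>
    obtain hset | ht' := h.holds ht
    -- Set signals remain set, so the obligation cannot have been discharged on the way.
    · exact (hs (h'.sigLe.isSet hset)).elim
    · obtain ⟨h₁, h₂⟩ := ih ht' hs
      refine ⟨h₁, fun s' hs' => ?_⟩
      rw [List.mem_append] at hs'
      obtain hs' | hs' := hs'
      · obtain ⟨lev', hlev', hlt⟩ := h.expect_mem hs'
        obtain ⟨b, hb, -⟩ := (h.sigLe.trans h'.sigLe) _ _ _ hlev'
        exact ⟨lev', b, hb, hlt _ _ ht⟩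
      · exact h₂ s' hs'

theorem GhostTrace.expect_mem {g g' : Ghost} {τ : List GhostEvent} (h : GhostTrace P g τ g')
    {t s : ℕ} (hs : .expect t s ∈ τ) :
    ¬ g.IsSet s ∧ ∃ lev b, g'.signals s = some (lev, b) := by
  induction h with
  | refl => cases hs
  | head h h' ih =>
    rw [List.mem_append] at hs
    obtain hs | hs := hs
    · obtain ⟨lev, hlev, -⟩ := h.expect_mem hs
      obtain ⟨b, hb, -⟩ := (h.sigLe.trans h'.sigLe) _ _ _ hlev
      refine ⟨?_, lev, b, hb⟩
      rintro ⟨lev', hlev'⟩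
      rw [hlev] at hlev'
      cases hlev'
    · obtain ⟨h₁, h₂⟩ := ih hs
      exact ⟨fun hset => h₁ (h.sigLe.isSet hset), h₂⟩

theorem GhostFork.ne {t t' : ℕ} {g g' : Ghost} (h : GhostFork t t' g g') : t ≠ t' := by
  cases h with
  | mk h₁ _ _ h₄ =>
    rintro rfl
    have := h₄.1.2
    rw [h₁] at this
    cases this

theorem GhostFork.obls_eq_none {t t' : ℕ} {g g' : Ghost} (h : GhostFork t t' g g') :
    g.obls t' = none := by
  cases h with
  | mk h₁ _ _ h₄ => exact h₄.1.2

theorem GhostFork.isLeast {t t' : ℕ} {g g' : Ghost} (h : GhostFork t t' g g') :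
    IsLeast {k : ℕ | 0 < k ∧ g.obls k = none} t' := by
  cases h with
  | mk h₁ _ _ h₄ => exact h₄

theorem GhostFork.signals {t t' : ℕ} {g g' : Ghost} (h : GhostFork t t' g g') :
    g'.signals = g.signals := by
  cases h with
  | mk => rfl

theorem GhostFork.obls_eq_none_iff {t t' : ℕ} {g g' : Ghost} (h : GhostFork t t' g g') (k : ℕ) :
    g'.obls k = none ↔ g.obls k = none ∧ k ≠ t' := by
  have hne := h.ne
  cases h with
  | mk h₁ =>
    dsimp only
    rw [Function.update_apply, Function.update_apply]
    grind

theorem GhostFork.obls_finished {t t' : ℕ} {g g' : Ghost} (h : GhostFork t t' g g')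
    {k : ℕ} (hk : g.obls k = some .finished) : g'.obls k = some .finished := by
  have hne := h.obls_eq_none
  cases h with
  | mk h₁ =>
    dsimp only
    rw [Function.update_apply, Function.update_apply]
    grind

theorem GhostFork.holds {t t' : ℕ} {g g' : Ghost} (h : GhostFork t t' g g') {k s : ℕ} {lev : Val}
    (hk : g.Holds k s lev) : g'.Holds k s lev ∨ k = t ∧ g'.Holds t' s lev := by
  have hne := h.ne
  have hnone := h.obls_eq_none
  obtain ⟨A, hA, hs⟩ := hk
  cases h with
  | @mk O L _ _ h₁ =>
    by_cases hkt : k = t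
    · subst hkt
      rw [h₁] at hA
      cases hA
      rw [Multiset.mem_add] at hs
      obtain hs | hs := hs
      · exact .inl ⟨O, by dsimp only; rw [Function.update_of_ne hne, Function.update_self], hs⟩
      · exact .inr ⟨rfl, L, Function.update_self .., hs⟩
    · refine .inl ⟨A, ?_, hs⟩
      dsimp only
      rw [Function.update_of_ne, Function.update_of_ne hkt, hA]
      rintro rfl
      rw [hA] at hnone
      cases hnone

theorem GhostFork.allHeld {t t' : ℕ} {g g' : Ghost} (h : GhostFork t t' g g')
    (hg : g.AllHeld) : g'.AllHeld := by
  intro s lev hs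
  rw [h.signals] at hs
  obtain ⟨k, hk⟩ := hg s lev hs
  obtain hk | ⟨-, hk⟩ := h.holds hk
  exacts [⟨k, hk⟩, ⟨t', hk⟩]

end

/-! ### The measure -/

/-- The strict and the weak multiset order induced by `r`. -/
abbrev MultisetLt {α : Type*} (r : α → α → Prop) : Multiset α → Multiset α → Prop :=
  Relation.TransGen (Relation.CutExpand r)

abbrev MultisetLe {α : Type*} (r : α → α → Prop) : Multiset α → Multiset α → Prop :=
  Relation.ReflTransGen (Relation.CutExpand r)

section
variable {α : Type*} {r : α → α → Prop}

theorem MultisetLt.replace {a : α} {s : Multiset α} (hs : ∀ b ∈ s, r b a) (t : Multiset α) :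
    MultisetLt r (s + t) (a ::ₘ t) := by
  rw [← Multiset.singleton_add]
  exact .single ((Relation.cutExpand_add_right t).2 (Relation.cutExpand_singleton hs))

theorem MultisetLt.cons (a : α) (t : Multiset α) : MultisetLt r t (a ::ₘ t) := by
  simpa using MultisetLt.replace (r := r) (s := 0) (a := a) (by simp) t

theorem MultisetLe.of_le {s t : Multiset α} (h : s ≤ t) : MultisetLe r s t := by
  obtain ⟨u, rfl⟩ := Multiset.le_iff_exists_add.1 h
  clear h
  induction u using Multiset.induction with
  | empty => simpa using Relation.ReflTransGen.refl
  | cons a u ih =>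
    rw [Multiset.add_cons]
    exact ih.trans (MultisetLt.cons a _).to_reflTransGen

theorem MultisetLe.add_right {s t : Multiset α} (h : MultisetLe r s t) (u : Multiset α) :
    MultisetLe r (s + u) (t + u) :=
  Relation.ReflTransGen.lift (· + u) (fun _ _ h => (Relation.cutExpand_add_right u).2 h) _ _ h

theorem MultisetLt.add_right {s t : Multiset α} (h : MultisetLt r s t) (u : Multiset α) :
    MultisetLt r (s + u) (t + u) :=
  Relation.TransGen.lift (· + u) (fun _ _ h => (Relation.cutExpand_add_right u).2 h) _ _ h

end

/-- The number of expectations of `s`. -/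
def expectCount (τ : List GhostEvent) (s : ℕ) : ℕ := (τ.filterMap GhostEvent.signal).count s

open Classical in
/-- The numbers of expectations of the signals in `F`, given the numbers `R` of those after the
trace `τ`. -/
noncomputable def addExpects (F : Set ℕ) (R : ℕ → ℕ) (τ : List GhostEvent) (s : ℕ) : ℕ :=
  if s ∈ F then R s + expectCount τ s else R s

theorem addExpects_append (F : Set ℕ) (R : ℕ → ℕ) (τ τ' : List GhostEvent) :
    addExpects F R (τ ++ τ') = addExpects F (addExpects F R τ') τ := by
  funext s
  simp only [addExpects, expectCount, List.filterMap_append, List.count_append]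
  split <;> omega

theorem addExpects_nil (F : Set ℕ) (R : ℕ → ℕ) : addExpects F R [] = R := by
  funext s
  simp [addExpects, expectCount]

theorem le_addExpects (F : Set ℕ) (R : ℕ → ℕ) (τ : List GhostEvent) (s : ℕ) :
    R s ≤ addExpects F R τ s := by
  simp only [addExpects]
  split <;> omega

/-- The call permissions that the expect permissions `EP` are worth, if the signals are expected
`R` times. -/
def expectValue (EP : Multiset (ℕ × Val)) (R : ℕ → ℕ) : Multiset Val :=
  EP.bind fun p => Multiset.replicate (R p.1) p.2

theorem expectValue_mono (EP : Multiset (ℕ × Val)) {R R' : ℕ → ℕ} (h : ∀ s, R s ≤ R' s) :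
    expectValue EP R ≤ expectValue EP R' := by
  induction EP using Multiset.induction with
  | empty => exact le_rfl
  | cons p EP ih =>
    simp only [expectValue, Multiset.cons_bind] at ih ⊢
    exact add_le_add (Multiset.replicate_mono _ (h p.1)) ih

/-- The call permissions of thread `t`, including those it may still gain from expectations. -/
def Ghost.weight (g : Ghost) (R : ℕ → ℕ) (t : ℕ) : Multiset Val :=
  (g.callPerms t).getD 0 + expectValue ((g.expectPerms t).getD 0) R

section
variable {P : Params}

theorem Ghost.weight_mono (g : Ghost) {R R' : ℕ → ℕ} (h : ∀ s, R s ≤ R' s) (t : ℕ) :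
    MultisetLe P.degLt (g.weight R t) (g.weight R' t) :=
  .of_le (add_le_add le_rfl (expectValue_mono _ h))

/-- `R` counts the expectations after the step, so the earlier weight uses the larger counts
`addExpects F R τ`. A call gives up a permission. `lower` and `newExpectPerm` exchange a degree for
finitely many smaller ones, in the second case as many as expectations of the signal remain. An
expectation gains one permission, but one expectation fewer remains. Only expectations by `t` itself
must be counted in `F`; those of other threads can only raise the earlier weight. -/
theorem GhostStep.weight {g g' : Ghost} {τ : List GhostEvent} (h : GhostStep P g τ g')
    {F : Set ℕ} {t : ℕ} (hF : ∀ s, .expect t s ∈ τ → s ∈ F) (R : ℕ → ℕ) :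
    MultisetLe P.degLt (g'.weight R t) (g.weight (addExpects F R τ) t) ∧
      (.call t ∈ τ → MultisetLt P.degLt (g'.weight R t) (g.weight (addExpects F R τ) t)) := by
  have hmono := g.weight_mono (P := P) (le_addExpects F R τ) t
  have hlt : MultisetLt P.degLt (g'.weight R t) (g.weight R t) →
    MultisetLe P.degLt (g'.weight R t) (g.weight (addExpects F R τ) t) ∧
      (.call t ∈ τ → MultisetLt P.degLt (g'.weight R t) (g.weight (addExpects F R τ) t)) :=
    fun h => ⟨h.to_reflTransGen.trans hmono, fun _ => h.trans_left hmono⟩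
  cases h with
  | @call t' CP h =>
    by_cases ht : t = t'
    · subst ht
      apply hlt
      simp only [Ghost.weight, h, Function.update_self, Option.getD_some, Multiset.cons_add]
      exact .cons _ _
    · refine ⟨?_, fun hc => ?_⟩
      · refine Relation.ReflTransGen.trans ?_ hmono
        simp only [Ghost.weight, Function.update_of_ne ht]
        exact .refl
      · simp only [List.mem_singleton, GhostEvent.call.injEq] at hc
        exact (ht hc).elim
  | finish h => exact ⟨hmono, fun hc => by cases hc⟩
  | newSignal h => exact ⟨hmono, fun hc => by cases hc⟩
  | setSignal h => exact ⟨hmono, fun hc => by cases hc⟩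
  | @lower d d' n t' CP h hd =>
    by_cases ht : t = t'
    · subst ht
      apply hlt
      simp only [Ghost.weight, h, Function.update_self, Option.getD_some]
      refine MultisetLt.add_right ?_ _
      rw [add_comm]
      refine MultisetLt.replace (fun b hb => ?_) _
      rwa [Multiset.eq_of_mem_replicate hb]
    · refine ⟨?_, fun hc => by cases hc⟩
      refine Relation.ReflTransGen.trans ?_ hmono
      simp only [Ghost.weight, Function.update_of_ne ht]
      exact .refl
  | @newExpectPerm s t' d d' CP EP h hd h' =>
    by_cases ht : t = t'
    · subst ht
      apply hlt
      simp only [Ghost.weight, h, h', Function.update_self, Option.getD_some, expectValue,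
        Multiset.cons_bind]
      rw [← add_assoc]
      refine MultisetLt.add_right ?_ _
      rw [add_comm]
      refine MultisetLt.replace (fun b hb => ?_) _
      rwa [Multiset.eq_of_mem_replicate hb]
    · refine ⟨?_, fun hc => by cases hc⟩
      refine Relation.ReflTransGen.trans ?_ hmono
      simp only [Ghost.weight, Function.update_of_ne ht]
      exact .refl
  | @expect s t' d lev O CP EP h₁ h₂ h₃ h₄ h₅ h₆ =>
    refine ⟨?_, fun hc => by simp at hc⟩
    by_cases ht : t = t'
    · subst ht
      have hs := hF s (by simp)
      obtain ⟨EP', rfl⟩ := Multiset.exists_cons_of_mem h₅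
      refine .of_le ?_
      simp only [Ghost.weight, h₄, h₆, Function.update_self, Option.getD_some, expectValue,
        Multiset.cons_bind]
      -- The expectation under way was still counted before the step; its copy of `d` in the earlier
      -- weight pays for the new call permission.
      have h₇ : addExpects F R [.expect t s] s = R s + 1 := by
        simp [addExpects, hs, expectCount, GhostEvent.signal]
      rw [h₇, Multiset.replicate_succ, Multiset.cons_add, Multiset.cons_add, Multiset.add_cons]
      exact Multiset.cons_le_cons _ (add_le_add le_rfl (add_le_add le_rfl
        (expectValue_mono EP' (le_addExpects F R _))))
    · refine Relation.ReflTransGen.trans ?_ hmono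
      simp only [Ghost.weight, Function.update_of_ne ht]
      exact .refl

theorem GhostTrace.weight {g g' : Ghost} {τ : List GhostEvent} (h : GhostTrace P g τ g')
    {F : Set ℕ} {t : ℕ} (hF : ∀ s, .expect t s ∈ τ → s ∈ F) (R : ℕ → ℕ) :
    MultisetLe P.degLt (g'.weight R t) (g.weight (addExpects F R τ) t) ∧
      (.call t ∈ τ → MultisetLt P.degLt (g'.weight R t) (g.weight (addExpects F R τ) t)) := by
  induction h with
  | refl => rw [addExpects_nil]; exact ⟨.refl, fun h => by cases h⟩
  | @head _ _ _ τ₁ τ₂ h _ ih =>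
    obtain ⟨h₁, h₂⟩ := ih fun s hs => hF s (List.mem_append_right _ hs)
    obtain ⟨h₃, h₄⟩ := h.weight (fun s hs => hF s (List.mem_append_left _ hs)) (addExpects F R τ₂)
    rw [addExpects_append]
    refine ⟨h₁.trans h₃, fun hc => ?_⟩
    obtain hc | hc := List.mem_append.1 hc
    · exact Relation.TransGen.trans_right h₁ (h₄ hc)
    · exact (h₂ hc).trans_left h₃

theorem GhostFork.weight {t t' : ℕ} {g g' : Ghost} (h : GhostFork t t' g g') {k : ℕ}
    (hk : g.obls k ≠ none) (R : ℕ → ℕ) : g'.weight R k = g.weight R k := by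
  have hne := h.obls_eq_none
  have hkt : k ≠ t' := by rintro rfl; exact hk hne
  cases h with
  | mk => simp only [Ghost.weight, Function.update_of_ne hkt]

/-- Permissions are copied to the new thread, so only the smaller code makes its measure smaller
than that of its parent. -/
theorem GhostFork.weight_new {t t' : ℕ} {g g' : Ghost} (h : GhostFork t t' g g') (R : ℕ → ℕ) :
    g'.weight R t' = g.weight R t := by
  cases h with
  | mk h₁ h₂ h₃ => simp only [Ghost.weight, h₂, h₃, Function.update_self]

end

/-! ## The termination argument -/

/-- A step of the thread at position `i` that does not abort the program. -/
inductive PoolStep (P : Params) (i : ℕ) : Config → Config → Prop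
  | mk {T : List Expr} {e e' : Expr} {σ σ' : State} {κ : List Obs} {es : List (ℕ × Expr)} :
      T[i]? = some e → ThreadStep P (i + 1) e σ κ e' σ' es →
      es.map Prod.fst = List.range' (T.length + 1) es.length →
      PoolStep P i (T, σ) (T.set i e' ++ es.map Prod.snd, σ')

theorem PoolStep.machineStep {P : Params} {i : ℕ} {c c' : Config} (h : PoolStep P i c c') :
    MachineStep P i c c' := by
  cases h with
  | @mk T e e' σ σ' κ es h₁ h₂ h₃ =>
    obtain ⟨hi, he⟩ := List.getElem?_eq_some_iff.1 h₁
    have hT : T = T.take i ++ e :: T.drop (i + 1) := by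
      rw [← he, List.getElem_cons_drop, List.take_append_drop]
    have hT' : T.set i e' = T.take i ++ e' :: T.drop (i + 1) :=
      List.set_eq_take_append_cons_drop.trans (if_pos hi)
    have hlen : (T.take i).length = i := by simp; omega
    have hlen' : (T.take i).length + (T.drop (i + 1)).length + 2 = T.length + 1 := by
      simp; omega
    have := MachineStep.step (P := P) (T.take i) (T.drop (i + 1)) (e := e) (e' := e') (σ := σ)
      (σ' := σ') (κ := κ) (es := es) (by rwa [hlen]) (by rwa [hlen'])
    rwa [hlen, ← hT, ← hT'] at this

/-- The threads with obligations are those of the pool, and unset signals are obligations. -/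
structure Config.OK (c : Config) : Prop where
  dom : ∀ k, c.2.obls k ≠ none ↔ 1 ≤ k ∧ k ≤ c.1.length
  allHeld : c.2.ghost.AllHeld

/-- The measure of the thread at position `j`: its call permissions, and the size of its code. -/
def Config.measure (c : Config) (R : ℕ → ℕ) (j : ℕ) : Multiset Val × ℕ :=
  (c.2.ghost.weight R (j + 1), (c.1[j]?.map Expr.size).getD 0)

/-- The order on measures. -/
def MeasureLt (P : Params) (a b : Multiset Val × ℕ) : Prop :=
  MultisetLt P.degLt a.1 b.1 ∨ MultisetLe P.degLt a.1 b.1 ∧ a.2 < b.2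

abbrev MeasureLe (P : Params) : Multiset Val × ℕ → Multiset Val × ℕ → Prop :=
  Relation.ReflTransGen (MeasureLt P)

theorem MeasureLe.of_fst {P : Params} {a b : Multiset Val × ℕ}
    (h : MultisetLe P.degLt a.1 b.1) (h' : a.2 = b.2) : MeasureLe P a b := by
  obtain heq | h := Relation.reflTransGen_iff_eq_or_transGen.1 h
  · rw [Prod.ext heq.symm h']
  · exact .single (.inl h)

/-- A weak decrease is an equality or a strict decrease, so the relation is contained in the
lexicographic product of the multiset order with `ℕ`. -/
theorem wellFounded_measureLt {P : Params} (h : WellFounded P.degLt) :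
    WellFounded (MeasureLt P) := by
  refine Subrelation.wf ?_ (WellFounded.prod_lex h.cutExpand.transGen (wellFounded_lt (α := ℕ)))
  rintro ⟨a, m⟩ ⟨b, n⟩ (h | ⟨h, h'⟩)
  · exact .left _ _ h
  · obtain heq | h := Relation.reflTransGen_iff_eq_or_transGen.1 h
    · dsimp only at heq
      subst heq
      exact .right _ h'
    · exact .left _ _ h

/-- The effect of a step of the thread at position `i`, with trace `τ`. -/
structure StepSummary (P : Params) (i : ℕ) (c : Config) (τ : List GhostEvent) (c' : Config) :
    Prop where
  lt : i < c.1.length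
  length_le : c.1.length ≤ c'.1.length
  sigLe : c.2.ghost.SigLe c'.2.ghost
  expect_mem : ∀ t s, .expect t s ∈ τ →
    ¬ c.2.ghost.IsSet s ∧ ∃ lev b, c'.2.ghost.signals s = some (lev, b)
  -- `F` is the set of signals whose expectations are counted and `R` gives the counts after the
  -- step. Both stay arbitrary here, since they depend on the whole infinite run.
  other : ∀ F R j, j < c.1.length → j ≠ i → (∀ s, .expect (j + 1) s ∈ τ → s ∈ F) →
    MeasureLe P (c'.measure R j) (c.measure (addExpects F R τ) j)
  self : ∀ F R, (∀ s, .expect (i + 1) s ∈ τ → s ∈ F) →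
    MeasureLt P (c'.measure R i) (c.measure (addExpects F R τ) i)
  -- New threads are compared with their parent before the step.
  new : ∀ F R j, c.1.length ≤ j → j < c'.1.length →
    MeasureLt P (c'.measure R j) (c.measure (addExpects F R τ) i)
  expect_of_holds : ∀ t s lev, c.2.ghost.Holds t s lev → ¬ c'.2.ghost.IsSet s →
    ∀ s', .expect t s' ∈ τ →
      ∃ lev' b, c'.2.ghost.signals s' = some (lev', b) ∧ P.levLt lev' lev
  holds : ∀ j s lev, c.2.ghost.Holds (j + 1) s lev → ¬ c'.2.ghost.IsSet s →
    c'.2.ghost.Holds (j + 1) s lev ∨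
      j = i ∧ ∃ j', c.1.length ≤ j' ∧ j' < c'.1.length ∧ c'.2.ghost.Holds (j' + 1) s lev

theorem PoolStep.summary {P : Params} {i : ℕ} {c c' : Config} (h : PoolStep P i c c')
    (hc : c.OK) : c'.OK ∧ ∃ τ, StepSummary P i c τ c' := by
  cases h with
  | @mk T e e' σ σ' κ es h₁ h₂ h₃ =>
    obtain ⟨hi, he⟩ := List.getElem?_eq_some_iff.1 h₁
    obtain ⟨rfl, τ, hτ, hs⟩ | ⟨t', a, rfl, hf, hs, ha⟩ := h₂.ghost
    · simp only [List.map_nil, List.append_nil]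
      refine ⟨⟨fun k => ?_, hτ.allHeld hc.allHeld⟩, τ,
        { lt := hi
          length_le := by simp
          sigLe := hτ.sigLe
          expect_mem := fun t s hs => hτ.expect_mem hs
          other := fun F R j hj hji hF => ?_
          self := fun F R hF => ?_
          new := fun F R j hj hj' => ?_
          expect_of_holds := fun t s lev ht hs => (hτ.holds ht hs).2
          holds := fun j s lev ht hs => .inl (hτ.holds ht hs).1 }⟩
      · have := hc.dom k
        dsimp only at this ⊢
        rw [List.length_set, ← this]
        exact not_congr (hτ.obls_eq_none_iff k)
      · refine .of_fst (hτ.weight hF R).1 ?_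
        simp only [Config.measure]
        rw [List.getElem?_set_ne (Ne.symm hji)]
      · obtain hs | hs := hs
        · refine .inr ⟨(hτ.weight hF R).1, ?_⟩
          simp only [Config.measure]
          rw [List.getElem?_set_self hi, h₁]
          exact hs
        · exact .inl ((hτ.weight hF R).2 hs)
      · simp at hj hj'
        omega
    · simp only [List.map_cons, List.map_nil, List.length_singleton, List.range'_one,
        List.cons.injEq, and_true] at h₃ ⊢
      -- The new identifier is the old number of threads plus one, so the new thread sits at
      -- position `T.length`.
      subst h₃
      have hobl : ∀ j, j < T.length → σ.ghost.obls (j + 1) ≠ none := fun j hj =>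
        (hc.dom (j + 1)).2 ⟨by omega, hj⟩
      refine ⟨⟨fun k => ?_, hf.allHeld hc.allHeld⟩, [],
        { lt := hi
          length_le := by simp
          sigLe := fun s lev b hs => ⟨b, by rw [hf.signals, hs], id⟩
          expect_mem := fun t s hs => by cases hs
          other := fun F R j hj hji hF => ?_
          self := fun F R hF => ?_
          new := fun F R j hj hj' => ?_
          expect_of_holds := fun t s lev ht hs s' hs' => by cases hs'
          holds := fun j s lev ht hs => ?_ }⟩
      · have := hc.dom k
        dsimp only at this ⊢
        rw [Ne, show σ'.obls k = none ↔ _ from hf.obls_eq_none_iff k, not_and_or,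
          show ¬ σ.ghost.obls k = none ↔ _ from this]
        simp only [List.length_append, List.length_set, List.length_singleton]
        omega
      · rw [addExpects_nil]
        dsimp only at hj
        simp only [Config.measure]
        rw [hf.weight (hobl j hj), List.getElem?_append_left (by simpa using hj),
          List.getElem?_set_ne (Ne.symm hji)]
      · rw [addExpects_nil]
        refine .inr ⟨?_, ?_⟩
        · simp only [Config.measure]
          rw [hf.weight (hobl i hi)]
        · simp only [Config.measure]
          rw [List.getElem?_append_left (by simpa using hi), List.getElem?_set_self hi, h₁]
          exact hs
      · have hj'' : j = T.length := by
          simp at hj hj'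
          omega
        subst hj''
        rw [addExpects_nil]
        refine .inr ⟨?_, ?_⟩
        · simp only [Config.measure]
          rw [hf.weight_new]
        · simp only [Config.measure]
          rw [List.getElem?_append_right (by simp), h₁]
          simpa using ha
      · obtain ht | ⟨hj, ht⟩ := hf.holds ht
        · exact .inl ht
        · refine .inr ⟨by omega, T.length, le_rfl, by simp, ht⟩

/-- Finitely many steps of the threads at the listed positions. -/
inductive PoolRun (P : Params) : List ℕ → Config → Config → Prop
  | nil (c : Config) : PoolRun P [] c c
  | cons {i : ℕ} {l : List ℕ} {c c' c'' : Config} :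
      PoolStep P i c c' → PoolRun P l c' c'' → PoolRun P (i :: l) c c''

/-- The steps are kept separate, because the holder of an obligation can change within the run and
has to be followed from step to step. -/
inductive RunSummary (P : Params) : List ℕ → Config → List GhostEvent → Config → Prop
  | nil (c : Config) : RunSummary P [] c [] c
  | cons {i : ℕ} {l : List ℕ} {c c' c'' : Config} {τ τ' : List GhostEvent} :
      StepSummary P i c τ c' → RunSummary P l c' τ' c'' → RunSummary P (i :: l) c (τ ++ τ') c''

theorem PoolRun.append {P : Params} {l l' : List ℕ} {c c' c'' : Config} (h : PoolRun P l c c')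
    (h' : PoolRun P l' c' c'') : PoolRun P (l ++ l') c c'' := by
  induction h with
  | nil => exact h'
  | cons h _ ih => exact .cons h (ih h')

theorem PoolRun.summary {P : Params} {l : List ℕ} {c c' : Config} (h : PoolRun P l c c')
    (hc : c.OK) : c'.OK ∧ ∃ τ, RunSummary P l c τ c' := by
  induction h with
  | nil c => exact ⟨hc, _, .nil c⟩
  | cons h _ ih =>
    obtain ⟨hc', τ, hτ⟩ := h.summary hc
    obtain ⟨hc'', τ', hτ'⟩ := ih hc'
    exact ⟨hc'', _, .cons hτ hτ'⟩

theorem RunSummary.sigLe {P : Params} {l : List ℕ} {c c' : Config} {τ : List GhostEvent}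
    (h : RunSummary P l c τ c') : c.2.ghost.SigLe c'.2.ghost := by
  induction h with
  | nil => exact .refl _
  | cons h _ ih => exact h.sigLe.trans ih

theorem RunSummary.expect_mem {P : Params} {l : List ℕ} {c c' : Config} {τ : List GhostEvent}
    (h : RunSummary P l c τ c') {t s : ℕ} (hs : .expect t s ∈ τ) :
    ¬ c.2.ghost.IsSet s ∧ ∃ lev b, c'.2.ghost.signals s = some (lev, b) := by
  induction h with
  | nil => cases hs
  | cons h h' ih =>
    rw [List.mem_append] at hs
    obtain hs | hs := hs
    · obtain ⟨h₁, lev, b, h₂⟩ := h.expect_mem _ _ hs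
      obtain ⟨b', hb, -⟩ := h'.sigLe _ _ _ h₂
      exact ⟨h₁, lev, b', hb⟩
    · obtain ⟨h₁, h₂⟩ := ih hs
      exact ⟨fun hset => h₁ (h.sigLe.isSet hset), h₂⟩

/-- If all signals of lower levels are in `F`, the measure of the holder of an obligation that
is not discharged does not increase, and decreases when the holder takes a step. -/
theorem RunSummary.holds {P : Params} {l : List ℕ} {c c' : Config} {τ : List GhostEvent}
    (h : RunSummary P l c τ c') {F : Set ℕ} {s : ℕ} {lev : Val} (hs : ¬ c'.2.ghost.IsSet s)
    (hF : ∀ s' lev' b, c'.2.ghost.signals s' = some (lev', b) → P.levLt lev' lev → s' ∈ F)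
    (R : ℕ → ℕ) {j : ℕ} (hj : c.2.ghost.Holds (j + 1) s lev) (hjlt : j < c.1.length) :
    ∃ j', c'.2.ghost.Holds (j' + 1) s lev ∧
      MeasureLe P (c'.measure R j') (c.measure (addExpects F R τ) j) ∧
      (j ∈ l → Relation.TransGen (MeasureLt P) (c'.measure R j')
        (c.measure (addExpects F R τ) j)) ∧
      (j ∉ l → j' = j) := by
  induction h generalizing j with
  | nil c =>
    rw [addExpects_nil]
    exact ⟨j, hj, .refl, fun h => by simp at h, fun _ => rfl⟩
  | @cons i l c c₁ c' τ τ' h h' ih =>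
    have hs₁ : ¬ c₁.2.ghost.IsSet s := fun h => hs (h'.sigLe.isSet h)
    -- The holder expects only signals below the level of its obligation, and all of these are
    -- counted.
    have hexp : ∀ s', .expect (j + 1) s' ∈ τ → s' ∈ F := by
      intro s' hs'
      obtain ⟨lev', b, h₁, h₂⟩ := h.expect_of_holds _ _ _ hj hs₁ s' hs'
      obtain ⟨b', h₃, -⟩ := h'.sigLe _ _ _ h₁
      exact hF _ _ _ h₃ h₂
    rw [addExpects_append]
    by_cases hji : j = i
    · subst hji
      -- The holder itself moves. It keeps the obligation or hands it to a forked thread, and the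
      -- new holder has a smaller measure in either case.
      have : ∃ j₁, c₁.2.ghost.Holds (j₁ + 1) s lev ∧ j₁ < c₁.1.length ∧
          MeasureLt P (c₁.measure (addExpects F R τ') j₁)
            (c.measure (addExpects F (addExpects F R τ') τ) j) := by
        obtain hh | ⟨-, j₁, h₁, h₂, h₃⟩ := h.holds _ _ _ hj hs₁
        · exact ⟨j, hh, hjlt.trans_le h.length_le, h.self F _ hexp⟩
        · exact ⟨j₁, h₃, h₂, h.new F _ _ h₁ h₂⟩
      obtain ⟨j₁, h₁, h₂, h₃⟩ := this
      obtain ⟨j', h₄, h₅, -, -⟩ := ih hs hF h₁ h₂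
      have h₆ := Relation.TransGen.trans_right h₅ (.single h₃)
      exact ⟨j', h₄, h₆.to_reflTransGen, fun _ => h₆, fun hn => (hn List.mem_cons_self).elim⟩
    · have hj₁ : c₁.2.ghost.Holds (j + 1) s lev := by
        obtain hh | ⟨hh, -⟩ := h.holds _ _ _ hj hs₁
        · exact hh
        · exact (hji hh).elim
      -- Another thread moves: the holder stays the same and its measure does not grow.
      have hle := h.other F (addExpects F R τ') j hjlt hji hexp
      obtain ⟨j', h₁, h₂, h₃, h₄⟩ := ih hs hF hj₁ (hjlt.trans_le h.length_le)
      refine ⟨j', h₁, h₂.trans hle, fun hm => ?_, fun hm => h₄ fun h => hm ?_⟩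
      · obtain rfl | hm := List.mem_cons.1 hm
        · exact (hji rfl).elim
        · exact (h₃ hm).trans_left hle
      · exact List.mem_cons_of_mem _ h

/-- The measure of a configuration. -/
def Config.total (c : Config) (R : ℕ → ℕ) : Multiset (Multiset Val × ℕ) :=
  (Multiset.range c.1.length).map (c.measure R)

theorem MultisetLe.map {α ι : Type*} {r : α → α → Prop} {f g : ι → α} {s : Multiset ι}
    (h : ∀ j ∈ s, Relation.ReflTransGen r (f j) (g j)) : MultisetLe r (s.map f) (s.map g) := by
  induction s using Multiset.induction with
  | empty => exact .refl
  | cons a s ih =>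
    have h₁ := ih fun j hj => h j (Multiset.mem_cons_of_mem hj)
    have h₂ := h a (Multiset.mem_cons_self a s)
    rw [Multiset.map_cons, Multiset.map_cons]
    have h₃ : MultisetLe r {f a} {g a} :=
      Relation.ReflTransGen.lift (p := Relation.CutExpand r) (fun x => ({x} : Multiset α))
        (fun _ _ h => Relation.cutExpand_singleton_singleton h) _ _ h₂
    have h₄ := (h₃.add_right (s.map f)).trans
      (by simpa only [add_comm] using h₁.add_right {g a})
    rwa [Multiset.singleton_add, add_comm, Multiset.singleton_add] at h₄

/-- When all signals are counted, the measure of the moving thread is replaced by finitely many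
smaller ones, its own and those of new threads, and all other measures weakly decrease. This is a
decrease in the multiset order. -/
theorem StepSummary.total {P : Params} {i : ℕ} {c c' : Config} {τ : List GhostEvent}
    (h : StepSummary P i c τ c') (R : ℕ → ℕ) :
    MultisetLt (MeasureLt P) (c'.total R) (c.total (addExpects Set.univ R τ)) := by
  set f := c'.measure R
  set g := c.measure (addExpects Set.univ R τ)
  obtain ⟨n, hn⟩ := Nat.exists_eq_add_of_le h.length_le
  obtain ⟨S, hS⟩ := Multiset.exists_cons_of_mem (Multiset.mem_range.2 h.lt)
  have hiS : i ∉ S := by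
    have := Multiset.nodup_range c.1.length
    rw [hS, Multiset.nodup_cons] at this
    exact this.1
  have h₁ : c'.total R = (f i ::ₘ ((Multiset.range n).map fun j => f (c.1.length + j))) +
      S.map f := by
    rw [Config.total, hn, Multiset.range_add, hS, Multiset.map_add, Multiset.map_cons,
      Multiset.map_map, Multiset.cons_add, Multiset.cons_add, add_comm]
    rfl
  have h₂ : c.total (addExpects Set.univ R τ) = g i ::ₘ S.map g := by
    rw [Config.total, hS, Multiset.map_cons]
  rw [h₁, h₂]
  -- `S` consists of the positions other than `i`; the replacement at `i` and the weak decrease on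
  -- `S` are chained.
  refine Relation.TransGen.trans_left (MultisetLt.replace (a := g i) (fun b hb => ?_) _) ?_
  · obtain rfl | hb := Multiset.mem_cons.1 hb
    · exact h.self _ _ fun _ _ => trivial
    · obtain ⟨j, hj, rfl⟩ := Multiset.mem_map.1 hb
      rw [Multiset.mem_range] at hj
      exact h.new _ _ _ (by omega) (by omega)
  · have h₃ : MultisetLe (MeasureLt P) (S.map f) (S.map g) := by
      refine .map fun j hj => h.other _ _ _ ?_ (fun hji => hiS (hji ▸ hj)) fun _ _ => trivial
      rw [← Multiset.mem_range, hS]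
      exact Multiset.mem_cons_of_mem hj
    have h₄ := h₃.add_right {g i}
    rwa [add_comm, Multiset.singleton_add, add_comm, Multiset.singleton_add] at h₄

theorem RunSummary.total {P : Params} {l : List ℕ} {c c' : Config} {τ : List GhostEvent}
    (h : RunSummary P l c τ c') (hl : l ≠ []) (R : ℕ → ℕ) :
    MultisetLt (MeasureLt P) (c'.total R) (c.total (addExpects Set.univ R τ)) := by
  induction h with
  | nil => exact (hl rfl).elim
  | @cons i l c c₁ c' τ τ' h h' ih =>
    rw [addExpects_append]
    by_cases hl' : l = []
    · subst hl'
      cases h'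
      rw [addExpects_nil]
      exact h.total R
    · exact (ih hl').trans (h.total _)

theorem exists_expect_of_count {τ : List GhostEvent} {s : ℕ} (h : expectCount τ s ≠ 0) :
    ∃ t, .expect t s ∈ τ := by
  have h' := List.count_pos_iff.1 (Nat.pos_of_ne_zero h)
  obtain ⟨ev, hev, hs⟩ := List.mem_filterMap.1 h'
  cases ev with
  | call => cases hs
  | expect t s' => cases hs; exact ⟨t, hev⟩

/-- There is no infinite run in which each thread with an obligation eventually takes a step. -/
theorem no_infinite_run {P : Params} (hdeg : WellFounded P.degLt) (hlev : WellFounded P.levLt)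
    (c : ℕ → Config) (l : ℕ → List ℕ) (hc : ∀ n, (c n).OK)
    (hrun : ∀ n, PoolRun P (l n) (c n) (c (n + 1))) (hl : ∀ n, l n ≠ [])
    (hfair : ∀ n j s lev, (c n).2.ghost.Holds (j + 1) s lev → ∃ k, j ∈ l (n + k)) : False := by
  classical
  have hsum := fun n => ((hrun n).summary (hc n)).2
  choose τ hτ using hsum
  -- The signals that are expected only finitely often, by any threads.
  set F : Set ℕ := {s | ∃ B, ∀ n, B ≤ n → expectCount (τ n) s = 0}
  have hB : ∀ s, ∃ B, s ∈ F → ∀ n, B ≤ n → expectCount (τ n) s = 0 := by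
    intro s
    by_cases hs : s ∈ F
    · obtain ⟨B, hB⟩ := hs
      exact ⟨B, fun _ => hB⟩
    · exact ⟨0, fun h => (hs h).elim⟩
  choose B hB using hB
  -- The number of expectations of `s` from time `n` on, a finite sum because none occurs after `B
  -- s`. Signals outside `F` get the dummy value 0.
  set R : ℕ → ℕ → ℕ := fun n s =>
    if s ∈ F then ∑ k ∈ Finset.Ico n (B s), expectCount (τ k) s else 0
  have hR : ∀ n, R n = addExpects F (R (n + 1)) (τ n) := by
    intro n
    funext s
    by_cases hs : s ∈ F
    · simp only [R, addExpects, if_pos hs]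
      by_cases hn : n < B s
      · rw [Finset.sum_eq_sum_Ico_succ_bot hn, add_comm]
      · rw [Finset.Ico_eq_empty (by omega), Finset.Ico_eq_empty (by omega),
          hB s hs n (by omega)]
        rfl
    · simp only [R, addExpects, if_neg hs]
  have hmono : ∀ n k, (c n).2.ghost.SigLe (c (n + k)).2.ghost := by
    intro n k
    induction k with
    | zero => exact .refl _
    | succ k ih => exact ih.trans (hτ (n + k)).sigLe
  -- If all signals are expected finitely often, the total measures descend forever.
  by_cases hF : F = Set.univ
  · have hwf := (wellFounded_measureLt hdeg).cutExpand.transGen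
    obtain ⟨_, ⟨n, rfl⟩, hmin⟩ := hwf.has_min (Set.range fun n => (c n).total (R n)) ⟨_, 0, rfl⟩
    refine hmin _ ⟨n + 1, rfl⟩ ?_
    have := (hτ n).total (hl n) (R (n + 1))
    rw [← hF, ← hR] at this
    exact this
  · obtain ⟨s₀, hs₀⟩ := (Set.ne_univ_iff_exists_notMem F).1 hF
    have hexp : ∀ s ∉ F, ∀ n, ∃ k t, .expect t s ∈ τ (n + k) := by
      intro s hs n
      by_contra! hno
      refine hs ⟨n, fun m hm => ?_⟩
      obtain ⟨k, rfl⟩ := Nat.exists_eq_add_of_le hm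
      by_contra hne
      obtain ⟨t, ht⟩ := exists_expect_of_count hne
      exact hno k t ht
    obtain ⟨k₀, t₀, ht₀⟩ := hexp s₀ hs₀ 0
    obtain ⟨-, lev₀, b₀, hlev₀⟩ := (hτ _).expect_mem ht₀
    -- Minimality of the level puts every signal of a lower level into `F`.
    obtain ⟨lev, ⟨s, hs, n, b, hlevn⟩, hmin⟩ := hlev.has_min
      {lev | ∃ s ∉ F, ∃ n b, (c n).2.ghost.signals s = some (lev, b)}
      ⟨lev₀, s₀, hs₀, _, b₀, hlev₀⟩
    -- The signal is expected again at some later time, and it has to be unset then.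
    have hunset : ∀ n, ¬ (c n).2.ghost.IsSet s := by
      intro n hset
      obtain ⟨k, t, ht⟩ := hexp s hs n
      exact ((hτ _).expect_mem ht).1 ((hmono n k).isSet hset)
    have hb : b = false := by
      cases b with
      | false => rfl
      | true => exact (hunset n ⟨lev, hlevn⟩).elim
    subst hb
    have hlt : ∀ n j, (c n).2.ghost.Holds (j + 1) s lev → j < (c n).1.length := by
      rintro n j ⟨O, hO, -⟩
      have := ((hc n).dom (j + 1)).1 (by rw [show (c n).2.obls (j + 1) = _ from hO]; simp)
      omega
    have hstep : ∀ n j, (c n).2.ghost.Holds (j + 1) s lev →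
        ∃ j', (c (n + 1)).2.ghost.Holds (j' + 1) s lev ∧
          MeasureLe P ((c (n + 1)).measure (R (n + 1)) j') ((c n).measure (R n) j) ∧
          (j ∈ l n → Relation.TransGen (MeasureLt P) ((c (n + 1)).measure (R (n + 1)) j')
            ((c n).measure (R n) j)) ∧ (j ∉ l n → j' = j) := by
      intro n j hj
      rw [hR n]
      refine (hτ n).holds (hunset _) (fun s' lev' b h₁ h₂ => ?_) (R (n + 1)) hj (hlt n j hj)
      by_contra hs'
      exact hmin lev' ⟨s', hs', _, b, h₁⟩ h₂
    -- Induction on the waiting time: until the holder moves it remains the holder and its measure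
    -- does not grow, and when it moves the measure drops.
    have hdesc : ∀ k n j, j ∈ l (n + k) → (c n).2.ghost.Holds (j + 1) s lev →
        ∃ n' j', (c n').2.ghost.Holds (j' + 1) s lev ∧
          Relation.TransGen (MeasureLt P) ((c n').measure (R n') j') ((c n).measure (R n) j) := by
      intro k
      induction k with
      | zero =>
        intro n j hk hj
        obtain ⟨j', h₁, -, h₂, -⟩ := hstep n j hj
        exact ⟨n + 1, j', h₁, h₂ hk⟩
      | succ k ih =>
        intro n j hk hj
        obtain ⟨j', h₁, h₂, h₃, h₄⟩ := hstep n j hj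
        by_cases hjn : j ∈ l n
        · exact ⟨n + 1, j', h₁, h₃ hjn⟩
        · obtain rfl := h₄ hjn
          obtain ⟨n', j'', h₅, h₆⟩ := ih (n + 1) j' (by convert hk using 2; omega) h₁
          exact ⟨n', j'', h₅, h₆.trans_left h₂⟩
    obtain ⟨t, ht⟩ := (hc n).allHeld s lev hlevn
    obtain ⟨O, hO, -⟩ := id ht
    have ht₁ := ((hc n).dom t).1 (by rw [show (c n).2.obls t = _ from hO]; simp)
    obtain ⟨j, rfl⟩ := Nat.exists_eq_add_of_le' ht₁.1
    -- A least measure over all times and all holders of `s`; fairness then makes this holder move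
    -- and produces a smaller one.
    obtain ⟨_, ⟨⟨n, j⟩, hj, rfl⟩, hmin'⟩ := (wellFounded_measureLt hdeg).transGen.has_min
      ((fun p : ℕ × ℕ => (c p.1).measure (R p.1) p.2) ''
        {p | (c p.1).2.ghost.Holds (p.2 + 1) s lev}) ⟨_, (n, j), ht, rfl⟩
    obtain ⟨k, hk⟩ := hfair n j s lev hj
    obtain ⟨n', j', h₁, h₂⟩ := hdesc k n j hk hj
    exact hmin' _ ⟨(n', j'), h₁, rfl⟩ h₂

/-! ## The simulation -/

section
variable {P : Params}

theorem PoolStep.obls_finished {i k : ℕ} {c c' : Config} (h : PoolStep P i c c')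
    (hk : c.2.ghost.obls k = some .finished) : c'.2.ghost.obls k = some .finished := by
  cases h with
  | mk _ h _ =>
    obtain ⟨-, τ, hτ, -⟩ | ⟨t', a, -, hf, -⟩ := h.ghost
    · exact hτ.obls_finished hk
    · exact hf.obls_finished hk

theorem PoolRun.obls_finished {l : List ℕ} {k : ℕ} {c c' : Config} (h : PoolRun P l c c')
    (hk : c.2.ghost.obls k = some .finished) : c'.2.ghost.obls k = some .finished := by
  induction h with
  | nil => exact hk
  | cons h _ ih => exact ih (h.obls_finished hk)

theorem PoolRun.reach {l : List ℕ} {c c' : Config} (h : PoolRun P l c c') :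
    Relation.ReflTransGen (fun a b => ∃ i, MachineStep P i a b) c c' := by
  induction h with
  | nil => exact .refl
  | cons h _ ih => exact .head ⟨_, h.machineStep⟩ ih

theorem PoolRun.safe {l : List ℕ} {c c' : Config} (h : PoolRun P l c c') (hc : Safe P c) :
    Safe P c' :=
  fun c'' h' => hc c'' (h.reach.trans h')

theorem PoolStep.run {i : ℕ} {c c' : Config} (h : PoolStep P i c c') : PoolRun P [i] c c' :=
  .cons h (.nil _)

/-- A thread that runs real code is not stuck in a safe configuration. -/
theorem Safe.ctxStep {c : Config} (hc : Safe P c) {j : ℕ} {E : Expr}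
    (hj : c.1[j]? = some E.thenFinish) (hE : ¬ E.IsVal) :
    (∃ κ E' σ' es, CtxStep P (j + 1) .full E c.2 κ E' σ' es) ∨ Aborts E := by
  have hn : E.thenFinish.next = some (.letR none .finish, E) :=
    CtxItem.next_fill (.letR none .finish) hE
  obtain ⟨v, hv⟩ | ⟨κ, E', σ', es, h⟩ | h := hc c .refl j _ hj
  · cases hv
  · obtain ⟨E₁, -, h₁⟩ := h.ctxStep.of_next id hn
    exact .inl ⟨_, _, _, _, h₁⟩
  · exact .inr (h.of_next hn)

/-- The identifiers of forked threads are the positions of these threads in the pool. -/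
theorem ThreadStep.forks {t : ℕ} {c : Config} {e e' : Expr} {σ' : State} {κ : List Obs}
    {es : List (ℕ × Expr)} (h : ThreadStep P t e c.2 κ e' σ' es) (hc : c.OK) :
    es.map Prod.fst = List.range' (c.1.length + 1) es.length := by
  obtain ⟨rfl, -⟩ | ⟨t', a, rfl, hf, -⟩ := h.ghost
  · rfl
  · obtain ⟨⟨h₁, h₂⟩, h₃⟩ := hf.isLeast
    have h₄ : t' ≤ c.1.length + 1 := h₃ ⟨by omega, by
      by_contra hne
      have := (hc.dom _).1 hne
      omega⟩
    have h₅ : ¬ (1 ≤ t' ∧ t' ≤ c.1.length) := fun hle => (hc.dom t').2 hle h₂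
    simp only [List.map_cons, List.map_nil, List.length_singleton, List.range'_one,
      List.cons.injEq, and_true]
    omega

theorem CtxStep.poolStep {c : Config} (hc : c.OK) {i : ℕ} {E E' : Expr} {σ' : State}
    {κ : List Obs} {es : List (ℕ × Expr)} (hi : c.1[i]? = some E.thenFinish)
    (h : CtxStep P (i + 1) .full E c.2 κ E' σ' es) :
    PoolStep P i c (c.1.set i E'.thenFinish ++ es.map Prod.snd, σ') :=
  have h' := (h.fill (.letR none .finish)).threadStep
  .mk hi h' (h'.forks hc)

/-- The relation between a thread, between executions of its auxiliary code, and its erasure. -/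
inductive ThreadRel (g : Ghost) (t : ℕ) : Expr → Expr → Prop
  | active {E : Expr} : RealCode .thread ∅ E → E.Normal → ThreadRel g t E.thenFinish E.erase
  | done {v w : Val} : g.obls t = some .finished → ThreadRel g t (.val v) (.val w)

/-- The code of the thread is real code with erasure `e`. -/
def ThreadPre (E e : Expr) : Prop :=
  ∃ E₀, E = Expr.thenFinish E₀ ∧ RealCode .thread ∅ E₀ ∧ E₀.erase = e

/-- The relation depends on the ghost state only through finished obligations, and these stay
finished. So the steps of one thread do not disturb the relation for the others. -/
theorem ThreadRel.of_run {l : List ℕ} {c c' : Config} (hr : PoolRun P l c c') {t : ℕ} {E e : Expr}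
    (h : ThreadRel c.2.ghost t E e) : ThreadRel c'.2.ghost t E e := by
  cases h with
  | active h h' => exact .active h h'
  | done h => exact .done (hr.obls_finished h)

/-- Running the auxiliary code that is to be executed next. -/
theorem RealCode.normalize {j : ℕ} {r : RealState} {E : Expr} {c : Config}
    (hE : RealCode .thread ∅ E) (hj : c.1[j]? = some E.thenFinish) (hsafe : Safe P c)
    (hc : c.OK) (hs : Sim c.2 r) :
    ∃ l E' σ', PoolRun P l c (c.1.set j E', σ') ∧ ThreadRel σ'.ghost (j + 1) E' E.erase ∧
      Sim σ' r := by
  induction hsz : E.size using Nat.strong_induction_on generalizing E c with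
  | _ n ih =>
  subst hsz
  have hjl : j < c.1.length := (List.getElem?_eq_some_iff.1 hj).1
  by_cases hv : E.IsVal
  · obtain ⟨v, rfl⟩ := hv
    -- The real code is done and `Finish` is all that remains.
    have h₁ : PoolStep P j c (c.1.set j .finish, c.2) := by
      have h : ThreadStep P (j + 1) (Expr.val v).thenFinish c.2 [] .finish c.2 [] :=
        .mk [] (.pure (.letR none v .finish))
      simpa using PoolStep.mk hj h rfl
    have hj₁ : (c.1.set j .finish)[j]? = some .finish := List.getElem?_set_self hjl
    -- Safety is what guarantees that no obligation is left: otherwise `Finish` would be stuck.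
    obtain ⟨v', hv'⟩ | ⟨κ, E', σ', es, h⟩ | h := h₁.run.safe hsafe _ .refl j _ hj₁
    · cases hv'
    · have hstep := h
      cases h.ctxStep.headStep rfl with
      | pure hp => cases hp
      | heap hh => cases hh
      | finish hO =>
        have h₂ := (PoolStep.mk hj₁ hstep rfl).run
        simp only [List.map_nil, List.append_nil, List.set_set] at h₂
        refine ⟨_, _, _, h₁.run.append h₂, ?_, hs.of_eq (hs.heapOK.of_eq rfl rfl) rfl⟩
        simp only [Expr.erase]
        exact .done (Function.update_self ..)
    · cases h.eq_abort rfl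
  by_cases hn : E.Normal
  · have hset : c.1.set j E.thenFinish = c.1 := by
      rw [← (List.getElem?_eq_some_iff.1 hj).2, List.set_getElem_self]
    exact ⟨[], E.thenFinish, c.2, by rw [hset]; exact .nil c, .active hE hn, hs⟩
  -- Safety provides a step, which can only execute the auxiliary let that is due; it makes the code
  -- smaller, so the recursion ends.
  · have hK : ∃ K x a b, E = Ctx.fill K (.letA x a b) := by
      by_contra! hno
      exact hn ⟨hv, hno⟩
    obtain ⟨K, x, a, b, hK⟩ := hK
    obtain ⟨κ, E', σ', es, h⟩ | ⟨K', hK'⟩ := hsafe.ctxStep hj hv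
    · obtain ⟨hE', he, hs', hsz, rfl⟩ := hE.letA_step hK hs h
      have h₁ := (h.poolStep hc hj).run
      simp only [List.map_nil, List.append_nil] at h₁
      obtain ⟨l, E'', σ'', h₂, hrel, hs''⟩ := ih _ hsz (c := (_, σ')) hE'
        (List.getElem?_set_self hjl) (h₁.safe hsafe) (h₁.summary hc).1 hs' rfl
      rw [List.set_set] at h₂
      rw [he] at hrel
      exact ⟨_, _, _, h₁.append h₂, hrel, hs''⟩
    -- The redex is unique, so an abort cannot be due at the same time as the let.
    · cases Expr.Redex.unique (redex_letA x a b) redex_abort (hK.symm.trans hK')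

/-- The relation between configurations; the threads in `S` may have to execute auxiliary code. -/
structure Rel (S : Set ℕ) (c : Config) (d : ErasedConfig) : Prop where
  length : c.1.length = d.1.length
  sim : Sim c.2 d.2
  thread : ∀ j E e, c.1[j]? = some E → d.1[j]? = some e →
    ThreadRel c.2.ghost (j + 1) E e ∨ j ∈ S ∧ ThreadPre E e

theorem Rel.normalize {S : Set ℕ} {c : Config} {d : ErasedConfig} (h : Rel S c d)
    (hsafe : Safe P c) (hc : c.OK) (j : ℕ) :
    ∃ l c', PoolRun P l c c' ∧ Rel (S \ {j}) c' d := by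
  by_cases hex : ∃ E e, c.1[j]? = some E ∧ d.1[j]? = some e ∧ ThreadPre E e
  · obtain ⟨E, e, hj, hj', E₀, rfl, hE, rfl⟩ := hex
    obtain ⟨l, E', σ', hr, hrel, hs⟩ := hE.normalize hj hsafe hc h.sim
    refine ⟨l, _, hr, by simpa using h.length, hs, fun k E e hk hk' => ?_⟩
    by_cases hkj : k = j
    · subst hkj
      rw [List.getElem?_set_self (List.getElem?_eq_some_iff.1 hj).1] at hk
      rw [hj'] at hk'
      cases hk
      cases hk'
      exact .inl hrel
    · rw [List.getElem?_set_ne (Ne.symm hkj)] at hk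
      exact (h.thread k E e hk hk').imp (fun h => h.of_run hr) fun h => ⟨⟨h.1, hkj⟩, h.2⟩
  · refine ⟨[], c, .nil c, h.length, h.sim, fun k E e hk hk' => ?_⟩
    refine (h.thread k E e hk hk').imp_right fun hp => ⟨⟨hp.1, ?_⟩, hp.2⟩
    rintro rfl
    exact hex ⟨E, e, hk, hk', hp.2⟩

/-- Each step of the erased program is matched by steps of the program, among them one of the same
thread. -/
theorem Rel.step {c : Config} {d : ErasedConfig} (h : Rel ∅ c d) (hsafe : Safe P c) (hc : c.OK)
    {i : ℕ} {e e' : Expr} {r' : RealState} {κ : List Obs} {es : List Expr}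
    (hi : d.1[i]? = some e) (hstep : ErasedThreadStep e d.2 κ e' r' es) :
    ∃ l c', PoolRun P l c c' ∧ i ∈ l ∧ Rel ∅ c' (d.1.set i e' ++ es, r') := by
  have hil : i < d.1.length := (List.getElem?_eq_some_iff.1 hi).1
  have hil' : i < c.1.length := h.length ▸ hil
  obtain hrel | ⟨hf, -⟩ := h.thread i _ _ (List.getElem?_eq_getElem hil') hi
  swap
  · exact hf.elim
  generalize hE₀ : c.1[i] = E₀ at hrel
  have hci : c.1[i]? = some E₀ := by rw [List.getElem?_eq_getElem hil', hE₀]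
  cases hrel with
  | done => exact (hstep.ctxStep.not_isVal ⟨_, rfl⟩).elim
  | @active E hE hn =>
    obtain ⟨κ₀, E₁, σ₁, es₁, h₁⟩ | ha := hsafe.ctxStep hci hn.1
    swap
    · exact (hE.not_aborts hn ha hstep.ctxStep).elim
    obtain ⟨E₂, σ₂, κ₂, es₂, h₂, hm⟩ := hE.ctxMatch
      (fun _ _ hR hR' => hR.headMatch hR') hn h.sim h₁ hstep.ctxStep
    have hrun := (h₂.poolStep hc hci).run
    -- A step forks at most one thread, so `c.1.length` is the only position that can be new.
    have hes : es₂.length ≤ 1 := by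
      obtain ⟨rfl, -⟩ | ⟨t', a, rfl, -⟩ := h₂.threadStep.ghost <;> simp
    have hlen := hm.forks.length_eq
    -- Auxiliary code can become due only in the thread that moved and in the thread that it forked;
    -- these two are normalized next.
    have hrel : Rel {i, c.1.length} (c.1.set i E₂.thenFinish ++ es₂.map Prod.snd, σ₂)
        (d.1.set i e' ++ es, r') := by
      refine ⟨by simp [h.length, hlen], hm.sim, fun k E e hk hk' => ?_⟩
      dsimp only at hk hk'
      by_cases hkl : k < c.1.length
      · rw [List.getElem?_append_left (by simpa using hkl)] at hk
        rw [List.getElem?_append_left (by simpa using h.length ▸ hkl)] at hk'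
        by_cases hki : k = i
        · subst hki
          rw [List.getElem?_set_self hkl] at hk
          rw [List.getElem?_set_self hil] at hk'
          cases hk
          cases hk'
          exact .inr ⟨.inl rfl, _, rfl, hm.code, hm.erase⟩
        · rw [List.getElem?_set_ne (Ne.symm hki)] at hk hk'
          obtain ht | ⟨hf, -⟩ := h.thread k E e hk hk'
          · exact .inl (ht.of_run hrun)
          · exact hf.elim
      · rw [List.getElem?_append_right (by simpa using not_lt.1 hkl)] at hk
        rw [List.getElem?_append_right (by simpa using h.length ▸ not_lt.1 hkl)] at hk'
        rw [List.length_set] at hk hk'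
        rw [← h.length] at hk'
        rw [List.getElem?_map, Option.map_eq_some_iff] at hk
        obtain ⟨a, ha, rfl⟩ := hk
        obtain ⟨hk₁, rfl⟩ := List.getElem?_eq_some_iff.1 ha
        obtain ⟨hk₂, rfl⟩ := List.getElem?_eq_some_iff.1 hk'
        refine .inr ⟨.inr ?_, (List.forall₂_iff_get.1 hm.forks).2 _ hk₁ hk₂⟩
        rw [Set.mem_singleton_iff]
        omega
    obtain ⟨l₁, c₁, hr₁, hrel₁⟩ := hrel.normalize (hrun.safe hsafe) (hrun.summary hc).1 i
    have hr₁ := hrun.append hr₁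
    obtain ⟨l₂, c₂, hr₂, hrel₂⟩ := hrel₁.normalize (hr₁.safe hsafe) (hr₁.summary hc).1 c.1.length
    refine ⟨_, c₂, hr₁.append hr₂, by simp, ?_⟩
    convert hrel₂ using 1
    ext k
    simp

end

-- Absence of aborts, initial configurations and conclusion

theorem ErasedMachineStep.threadStep {i : ℕ} {d d' : ErasedConfig} (h : ErasedMachineStep i d d') :
    (∃ e e' r' κ es, d.1[i]? = some e ∧ ErasedThreadStep e d.2 κ e' r' es ∧
      d' = (d.1.set i e' ++ es, r')) ∨ ∀ e ∈ d'.1, e.IsVal := by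
  cases h with
  | step T₁ T₂ h => exact .inl ⟨_, _, _, _, _, by simp, h, by simp⟩
  | abort T₁ T₂ h =>
    refine .inr fun e he => ?_
    obtain ⟨a, -, rfl⟩ := List.mem_map.1 he
    exact ⟨_, rfl⟩

theorem ErasedMachineStep.exists_not_isVal {i : ℕ} {d d' : ErasedConfig}
    (h : ErasedMachineStep i d d') : ∃ e ∈ d.1, ¬ e.IsVal := by
  cases h with
  | step T₁ T₂ h => exact ⟨_, by simp, h.ctxStep.not_isVal⟩
  | abort T₁ T₂ h =>
    obtain ⟨K, rfl⟩ := h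
    exact ⟨_, by simp, Ctx.fill_not_isVal K redex_abort.not_isVal⟩

theorem Config.OK.init (E : Expr) (CP : Multiset Val) : Config.OK ([E], State.init CP) where
  dom k := by
    simp only [State.init, List.length_singleton]
    split <;> simp <;> omega
  allHeld s lev h := by cases h

theorem Sim.init (CP : Multiset Val) : Sim (State.init CP) RealState.empty where
  heapOK :=
    { heap := fun l v h => by cases h
      heapA := fun l v h => by cases h
      dom := fun _ _ => rfl }
  heap _ := rfl
  prophs := rfl

end HLT

open HLT

theorem mainTheorem3 (P : Params) (hdeg : WellFounded P.degLt) (hlev : WellFounded P.levLt)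
    (hmin : ∀ d, ¬ P.degLt d P.deg₀)
    (e : Expr) (he : Erasable e) (CP : Multiset Val)
    (hsafe : Safe P ([e.thenFinish], State.init CP)) :
    ¬ HasInfiniteFairExecution ([e.erase], RealState.empty) := by
  rintro ⟨run, sched, h₀, hstep, hfair⟩
  have hthread : ∀ n, ∃ e e' r' κ es, (run n).1[sched n]? = some e ∧
      ErasedThreadStep e (run n).2 κ e' r' es ∧
      run (n + 1) = ((run n).1.set (sched n) e' ++ es, r') := by
    intro n
    -- An abort would leave only values, and the next step of the infinite execution could not take
    -- place.
    refine (hstep n).threadStep.resolve_right fun hv => ?_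
    obtain ⟨e, he, hne⟩ := (hstep (n + 1)).exists_not_isVal
    exact hne (hv e he)
  let Inv (n : ℕ) (c : Config) : Prop := Safe P c ∧ c.OK ∧ Rel ∅ c (run n)
  have hinit : ∃ c, Inv 0 c := by
    -- The program may begin with auxiliary code, which is run before the first erased step.
    have hrel : Rel {0} ([e.thenFinish], State.init CP) (run 0) := by
      rw [h₀]
      refine ⟨rfl, .init CP, fun j E e' hj hj' => ?_⟩
      cases j with
      | zero =>
        cases hj
        cases hj'
        exact .inr ⟨rfl, e, rfl, he, rfl⟩
      | succ j => cases hj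
    obtain ⟨l, c, hr, hc⟩ := hrel.normalize hsafe (.init _ CP) 0
    exact ⟨c, hr.safe hsafe, (hr.summary (.init _ CP)).1, by simpa using hc⟩
  -- The configuration is bundled with its invariant, so that the lifted run can be defined by
  -- recursion along the erased execution.
  have hnext : ∀ n (c : {c // Inv n c}), ∃ (c' : {c // Inv (n + 1) c}) (l : List ℕ),
      PoolRun P l c.1 c'.1 ∧ sched n ∈ l := by
    rintro n ⟨c, hs, hc, hrel⟩
    obtain ⟨e, e', r', κ, es, hi, h, heq⟩ := hthread n
    obtain ⟨l, c', hr, hl, hrel'⟩ := hrel.step hs hc hi h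
    exact ⟨⟨c', hr.safe hs, (hr.summary hc).1, heq ▸ hrel'⟩, l, hr, hl⟩
  choose next l hrun hmem using hnext
  obtain ⟨c₀, hc₀⟩ := hinit
  let c : ∀ n, {c // Inv n c} := fun n => Nat.rec ⟨c₀, hc₀⟩ (fun n c => next n c) n
  refine no_infinite_run hdeg hlev (fun n => (c n).1) (fun n => l n (c n))
    (fun n => (c n).2.2.1) (fun n => hrun n (c n)) (fun n => List.ne_nil_of_mem (hmem n (c n)))
    fun n j s lev hh => ?_
  obtain ⟨-, hc, hrel⟩ := (c n).2
  obtain ⟨O, hO, -⟩ := hh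
  have hj : j < (c n).1.1.length := by
    have := (hc.dom (j + 1)).1 fun h => by
      rw [show (c n).1.2.obls (j + 1) = _ from hO] at h
      cases h
    omega
  have hj' : j < (run n).1.length := hrel.length ▸ hj
  -- A thread with an obligation is not finished, hence it runs normal code, whose erasure is not a
  -- value; so fairness of the erased execution applies to it.
  have hnv : ¬ (run n).1[j].IsVal := by
    obtain ht | ⟨hf, -⟩ := hrel.thread j _ _ (List.getElem?_eq_getElem hj)
      (List.getElem?_eq_getElem hj')
    · generalize (run n).1[j] = a at ht
      generalize (c n).1.1[j] = b at ht
      cases ht with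
      | active hE hn => exact hE.erase_not_isVal hn
      | done hfin =>
        rw [hO] at hfin
        cases hfin
    · exact hf.elim
  obtain ⟨m, hm, rfl⟩ := hfair n j _ (List.getElem?_eq_getElem hj') hnv
  obtain ⟨k, rfl⟩ := Nat.exists_eq_add_of_le hm
  exact ⟨k, hmem _ _⟩
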